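/- Let $k$ be a field and let $X$ be a del Pezzo surface of degree $2$ over $k$, given as a smooth surface $w^2+fw=g$ in the weighted projective space $\mathbb{P}=\mathbb{P}(1,1,1,2)$ with coordinates $x,y,z,w$, where $f,g\in k[x,y,z]$ are homogeneous of degrees $2$ and $4$. Set $\Omega=(0:0:0:1)$ and $U=\mathbb{P}\setminus\{\Omega\}$, let $\varphi\colon U\to\mathbb{P}^2$, $(x:y:z:w)\mapsto(x:y:z)$ be the projection away from $\Omega$, and let $\pi=\varphi|_X\colon X\to\mathbb{P}^2$, a double cover with branch locus $B\colon f^2+4g=0$ and involution $\iota\colon(x:y:z:w)\mapsto(x:y:z:-f-w)$. Let $P\in X(k)$ be a point that does not lie on the ramification locus $\pi^{-1}(B)$, and set $Q=\pi(P)$. Let $\mathfrak{L}_Q\cong\mathbb{P}^1$ be the variety of lines in $\mathbb{P}^2$ through $Q$, and let $\mathrm{bl}_Q\colon\mathrm{Bl}_Q\mathbb{P}^2=\{(S,L)\in\mathbb{P}^2\times\mathfrak{L}_Q : S\in L\}\to\mathbb{P}^2$ be the blow-up of $\mathbb{P}^2$ at $Q$. Lines, points and curves are taken over a fixed algebraically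 closed field containing $k$ unless said otherwise. For every $L\in\mathfrak{L}_Q$ there is a unique morphism $\tau_L\colon L\to U$ with $\varphi\circ\tau_L=\mathrm{id}_L$ whose image intersects $X$ at $P$ with multiplicity at least $3$. Define $\nu\colon\mathrm{Bl}_Q\mathbb{P}^2\to U$ by $\nu(S,L)=\tau_L(S)$. Let $\mathrm{Bl}_{P,\iota(P)}X$ be the blow-up of $X$ at $P$ and $\iota(P)$, let $\psi\colon\mathrm{Bl}_{P,\iota(P)}X\to\mathfrak{L}_Q$ be the elliptic fibration induced by projecting $\pi$ away from $Q$, and let $\sigma_P,\sigma_{\iota(P)}$ be the sections of $\psi$ given by the exceptional curves above $P$ and $\iota(P)$. In the group of sections of $\psi$ over $k$ with neutral element $\sigma_{\iota(P)}$ there is a unique section $-\sigma_P$; let $\rho\colon\mathfrak{L}_Q\to X$ be its composition with the blow-up morphism $\mathrm{Bl}_{P,\iota(P)}X\to X$. Then the map $\nu$ factors as $\nu=\xi\circ\mathrm{bl}_Q$ for a unique morphism $\xi\colon\mathbb{P}^2\to U$ over $k$. Moreover: 1. For every $L\in\mathfrak{L}_Q$, the restriction of $\xi$ to $L$ equals $\tau_L$.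 2. The morphism $\xi$ is a section of $\varphi$, that is, $\varphi\circ\xi=\mathrm{id}$, and $\xi(Q)=P$. 3. The image $\xi(\mathbb{P}^2)$ is a surface of degree $2$ in $\mathbb{P}(1,1,1,2)$, that is, the zero locus of a geometrically irreducible weighted homogeneous polynomial of degree $2$ over $k$. 4. The intersection $X\cap\xi(\mathbb{P}^2)$ is, as a set, the union of $\rho(\mathfrak{L}_Q)$ and the exceptional curves on $X$ that contain $P$ (irreducible curves $E$ with $E\cdot E=E\cdot K_X=-1$). -/

import Mathlib

open MvPolynomial
open scoped LinearAlgebra.Projectivization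

/-
Conventions.  `k` is the ground field and `K` an algebraically closed field containing `k`.
Varieties over `k` are described by their `K`-points, subvarieties over `K` by their points or by
their homogeneous prime ideals, and morphisms over `k` are maps on `K`-points that are locally
given by homogeneous polynomials with coefficients in `k`.
-/

namespace DelPezzoTwo

noncomputable section

/-! ### The weighted projective space `P(1,1,1,2)` -/

/-- The weights of the coordinates `x, y, z, w`. -/
def wt : Fin 4 → ℕ := ![1, 1, 1, 2]

/-- Two nonzero vectors are equivalent if they differ by the weighted action of a scalar. -/
def weightedSetoid (K : Type*) [Field K] : Setoid {v : Fin 4 → K // v ≠ 0} where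
  r v v' := ∃ c : K, c ≠ 0 ∧ ∀ i, v'.1 i = c ^ wt i * v.1 i
  iseqv :=
    { refl := fun v => ⟨1, one_ne_zero, fun i => by simp⟩
      symm := by
        rintro v v' ⟨c, hc, h⟩
        refine ⟨c⁻¹, inv_ne_zero hc, fun i => ?_⟩
        rw [h i, ← mul_assoc, ← mul_pow, inv_mul_cancel₀ hc, one_pow, one_mul]
      trans := by
        rintro v v' v'' ⟨c, hc, h⟩ ⟨d, hd, h'⟩
        refine ⟨d * c, mul_ne_zero hd hc, fun i => ?_⟩
        rw [h' i, h i, mul_pow, mul_assoc] }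

/-- The `K`-points of the weighted projective space `P(1,1,1,2)`, for `K` algebraically closed. -/
def WP (K : Type*) [Field K] : Type _ := Quotient (weightedSetoid K)

/-- The point `(v₀ : v₁ : v₂ : v₃)`. -/
def WP.mk {K : Type*} [Field K] (v : Fin 4 → K) (hv : v ≠ 0) : WP K :=
  Quotient.mk (weightedSetoid K) ⟨v, hv⟩

/-- A vector of homogeneous coordinates of a point. -/
def WP.rep {K : Type*} [Field K] (x : WP K) : Fin 4 → K := (Quotient.out x).1

theorem WP.rep_ne_zero {K : Type*} [Field K] (x : WP K) : x.rep ≠ 0 := (Quotient.out x).2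

theorem WP.mk_rep {K : Type*} [Field K] (x : WP K) : WP.mk x.rep x.rep_ne_zero = x :=
  Quotient.out_eq x

/-- The point `Ω = (0 : 0 : 0 : 1)`. -/
def Omega (K : Type*) [Field K] : WP K :=
  WP.mk ![0, 0, 0, 1] (fun h => one_ne_zero (congrFun h 3))

/-- The open subset `U`, the complement of `Ω`. -/
abbrev U (K : Type*) [Field K] : Type _ := {x : WP K // x ≠ Omega K}

theorem WP.mk_eq_Omega {K : Type*} [Field K] [IsAlgClosed K] {v : Fin 4 → K} (hv : v ≠ 0)
    (h : ∀ i : Fin 3, v i.castSucc = 0) : WP.mk v hv = Omega K := by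
  have h0 : v 0 = 0 := h 0
  have h1 : v 1 = 0 := h 1
  have h2 : v 2 = 0 := h 2
  have h3 : v 3 ≠ 0 := by
    intro h3
    apply hv
    funext i
    fin_cases i
    exacts [h0, h1, h2, h3]
  obtain ⟨c, hc⟩ := IsAlgClosed.exists_pow_nat_eq (v 3)⁻¹ (n := 2) (by norm_num)
  have hc0 : c ≠ 0 := by
    rintro rfl
    exact inv_ne_zero h3 (by rw [← hc]; norm_num)
  refine Quotient.sound ⟨c, hc0, fun i => ?_⟩
  fin_cases i
  · simp [h0]
  · simp [h1]
  · simp [h2]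
  · simp [wt, hc, h3]

theorem WP.castSucc_eq_zero_of_mk_eq_Omega {K : Type*} [Field K] {v : Fin 4 → K} (hv : v ≠ 0)
    (h : WP.mk v hv = Omega K) (i : Fin 3) : v i.castSucc = 0 := by
  obtain ⟨c, hc, h'⟩ := Quotient.exact h
  have h2 : (![0, 0, 0, 1] : Fin 4 → K) i.castSucc = c ^ wt i.castSucc * v i.castSucc :=
    h' i.castSucc
  have h3 : (![0, 0, 0, 1] : Fin 4 → K) i.castSucc = 0 := by fin_cases i <;> rfl
  rw [h3] at h2
  exact (mul_eq_zero.mp h2.symm).resolve_left (pow_ne_zero _ hc)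

theorem U.rep_ne_zero {K : Type*} [Field K] [IsAlgClosed K] (x : U K) :
    (fun i : Fin 3 => x.1.rep i.castSucc) ≠ 0 := by
  intro h
  exact x.2 ((WP.mk_rep x.1).symm.trans
    (WP.mk_eq_Omega x.1.rep_ne_zero (fun i => congrFun h i)))

/-- The projection `φ : U → P²`, `(x : y : z : w) ↦ (x : y : z)`, away from `Ω`. -/
def phi {K : Type*} [Field K] [IsAlgClosed K] (x : U K) : ℙ K (Fin 3 → K) :=
  Projectivization.mk K (fun i : Fin 3 => x.1.rep i.castSucc) x.rep_ne_zero

/-- The zero locus in `P(1,1,1,2)` of a set of weighted homogeneous polynomials. -/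
def zeroLocus {K : Type*} [Field K] (I : Set (MvPolynomial (Fin 4) K)) : Set (WP K) :=
  {x | ∀ A ∈ I, eval x.rep A = 0}

/-- `Y ⊆ P(1,1,1,2)` is a (geometrically integral) surface over `k` of degree `d`: the zero locus of
a weighted homogeneous polynomial over `k` of weighted degree `d` that is irreducible over `K`. -/
def IsSurfaceOfDegree (k : Type*) {K : Type*} [Field k] [Field K] [Algebra k K]
    (Y : Set (WP K)) (d : ℕ) : Prop :=
  ∃ H : MvPolynomial (Fin 4) k, IsWeightedHomogeneous wt H d ∧
    Irreducible (MvPolynomial.map (algebraMap k K) H) ∧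
    Y = zeroLocus {MvPolynomial.map (algebraMap k K) H}

/-! ### Morphisms -/

/-- The polynomials `H₀, …, H₃` over `k`, homogeneous of degrees `e, e, e, 2e`, describe the map
`φ : S → U` from a subset `S` of the projective plane, wherever the homogeneous polynomial `h`
does not vanish.  (All regular maps to `U` are locally of this form, as `U` is covered by the charts
where one of the coordinates of weight one is nonzero.) -/
structure IsLocalRep (k : Type*) {K : Type*} [Field k] [Field K] [Algebra k K]
    {S : Set (ℙ K (Fin 3 → K))} (φ : S → U K) (h : MvPolynomial (Fin 3) k)
    (H : Fin 4 → MvPolynomial (Fin 3) k) : Prop where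
  homogeneous_h : ∃ d : ℕ, h.IsHomogeneous d
  homogeneous_H : ∃ e : ℕ, ∀ i, (H i).IsHomogeneous (e * wt i)
  eq_on : ∀ (s : S) (v : Fin 3 → K) (hv : v ≠ 0), Projectivization.mk K v hv = s.1 →
    aeval v h ≠ 0 →
    ∃ hH : (fun i => aeval v (H i)) ≠ 0, WP.mk (fun i => aeval v (H i)) hH = (φ s).1

/-- `φ : S → U` is a morphism over `k`: around every point it is given by polynomials over `k`. -/
def IsMorphism (k : Type*) {K : Type*} [Field k] [Field K] [Algebra k K]
    {S : Set (ℙ K (Fin 3 → K))} (φ : S → U K) : Prop :=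
  ∀ s : S, ∃ (h : MvPolynomial (Fin 3) k) (H : Fin 4 → MvPolynomial (Fin 3) k),
    IsLocalRep k φ h H ∧ aeval s.1.rep h ≠ 0

/-! ### Lines and the blow-up of the plane -/

/-- The points of the line with the given coefficients, a point of the dual plane. -/
def line {K : Type*} [Field K] (L : ℙ K (Fin 3 → K)) : Set (ℙ K (Fin 3 → K)) :=
  {S | L.orthogonal S}

/-- The pencil of lines through `Q`, a line in the dual plane. -/
def linesThrough {K : Type*} [Field K] (Q : ℙ K (Fin 3 → K)) : Set (ℙ K (Fin 3 → K)) :=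
  {L | Q ∈ line L}

/-- The blow-up of `P²` at `Q`: pairs `(S, L)` of a line `L` through `Q` and a point `S` on it. -/
abbrev Bl {K : Type*} [Field K] (Q : ℙ K (Fin 3 → K)) : Type _ :=
  {SL : ℙ K (Fin 3 → K) × linesThrough Q // SL.1 ∈ line SL.2.1}

/-- The blow-up morphism `(S, L) ↦ S`. -/
def bl {K : Type*} [Field K] {Q : ℙ K (Fin 3 → K)} (b : Bl Q) : ℙ K (Fin 3 → K) := b.1.1

/-- The map `ν : (S, L) ↦ τ_L(S)` on the blow-up, for a family of maps `τ_L : L → U`. -/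
def nu {K : Type*} [Field K] {Q : ℙ K (Fin 3 → K)}
    (τ : (L : linesThrough Q) → line L.1 → U K) (b : Bl Q) : U K :=
  τ b.1.2 ⟨b.1.1, b.2⟩

/-! ### The surface `X` -/

/-- The polynomial `w² + f w - g` defining `X`. -/
def surfacePoly {k : Type*} [Field k] (f g : MvPolynomial (Fin 3) k) : MvPolynomial (Fin 4) k :=
  X 3 ^ 2 + rename Fin.castSucc f * X 3 - rename Fin.castSucc g

/-- The `K`-points of the surface `X : w² + f w = g`. -/
def surface {k : Type*} (K : Type*) [Field k] [Field K] [Algebra k K]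
    (f g : MvPolynomial (Fin 3) k) : Set (WP K) :=
  {x | aeval x.rep (surfacePoly f g) = 0}

/-- `X` is smooth over `k`, by the Jacobian criterion at all `K`-points of the punctured affine cone
(`X` does not contain `Ω`, and the cone without its vertex is a `𝔾ₘ`-torsor over `X`). -/
def IsSmoothSurface {k : Type*} (K : Type*) [Field k] [Field K] [Algebra k K]
    (f g : MvPolynomial (Fin 3) k) : Prop :=
  ∀ v : Fin 4 → K, v ≠ 0 → aeval v (surfacePoly f g) = 0 →
    ∃ i, aeval v (pderiv i (surfacePoly f g)) ≠ 0

/-- The branch locus `f² + 4 g = 0` of `π : X → P²`. -/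
def branch {k : Type*} (K : Type*) [Field k] [Field K] [Algebra k K]
    (f g : MvPolynomial (Fin 3) k) : Set (ℙ K (Fin 3 → K)) :=
  {S | aeval S.rep (f ^ 2 + 4 * g) = 0}

/-- The coordinates of the image under the involution `w ↦ -f - w`. -/
def iotaVec {k K : Type*} [Field k] [Field K] [Algebra k K] (f : MvPolynomial (Fin 3) k)
    (v : Fin 4 → K) : Fin 4 → K :=
  Function.update v 3 (-(aeval (fun i : Fin 3 => v i.castSucc) f) - v 3)

theorem iotaVec_castSucc {k K : Type*} [Field k] [Field K] [Algebra k K]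
    (f : MvPolynomial (Fin 3) k) (v : Fin 4 → K) (i : Fin 3) :
    iotaVec f v i.castSucc = v i.castSucc := by
  unfold iotaVec
  rw [Function.update_of_ne]
  fin_cases i <;> decide

theorem iotaVec_ne_zero {k K : Type*} [Field k] [Field K] [Algebra k K] [IsAlgClosed K]
    (f : MvPolynomial (Fin 3) k) (x : U K) : iotaVec f x.1.rep ≠ 0 := by
  intro h
  apply x.rep_ne_zero
  funext i
  have h' := iotaVec_castSucc f x.1.rep i
  rw [h] at h'
  exact h'.symm

/-- The involution `ι : (x : y : z : w) ↦ (x : y : z : -f - w)`; it swaps the points in the fibres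
of `π : X → P²`. -/
def iota {k K : Type*} [Field k] [Field K] [Algebra k K] [IsAlgClosed K]
    (f : MvPolynomial (Fin 3) k) (x : U K) : U K :=
  ⟨WP.mk (iotaVec f x.1.rep) (iotaVec_ne_zero f x), fun h => x.rep_ne_zero <| by
    funext i
    exact (iotaVec_castSucc f x.1.rep i).symm.trans
      (WP.castSucc_eq_zero_of_mk_eq_Omega _ h i)⟩

/-! ### The sections `τ_L` -/

/-- The image of `τ : L → U` intersects `X` at `τ(S)` with multiplicity at least `n`, for a map `τ`
with `φ ∘ τ = id`, so that `τ` is an isomorphism onto its image: the pull-back along `τ` of a local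
equation of `X` vanishes at `S` to order at least `n`.  The local parameter on `L` at `S` is `t`, in
the parametrisation `S + t v` of `L`. -/
def MeetsSurface {k K : Type*} [Field k] [Field K] [Algebra k K] (f g : MvPolynomial (Fin 3) k)
    {L : ℙ K (Fin 3 → K)} (τ : line L → U K) (S : ℙ K (Fin 3 → K)) (n : ℕ) : Prop :=
  ∃ (h : MvPolynomial (Fin 3) K) (H : Fin 4 → MvPolynomial (Fin 3) K) (v : Fin 3 → K),
    IsLocalRep K τ h H ∧ aeval S.rep h ≠ 0 ∧
    LinearIndependent K ![S.rep, v] ∧ dotProduct L.rep v = 0 ∧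
    (Polynomial.X : Polynomial K) ^ n ∣
      aeval (fun i => aeval (fun j => Polynomial.C (S.rep j) + Polynomial.X * Polynomial.C (v j))
        (H i)) (MvPolynomial.map (algebraMap k K) (surfacePoly f g))

/-- `τ` is a morphism `L → U` with `φ ∘ τ = id_L` whose image intersects `X` at `P` with
multiplicity at least `3`. -/
structure IsTau {k K : Type*} [Field k] [Field K] [Algebra k K] [IsAlgClosed K]
    (f g : MvPolynomial (Fin 3) k) (P : U K) (L : linesThrough (phi P)) (τ : line L.1 → U K) :
    Prop where
  morphism : IsMorphism K τ
  sec : ∀ S, phi (τ S) = S.1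
  through : τ ⟨phi P, L.2⟩ = P
  meets : MeetsSurface f g τ (phi P) 3

/-! ### Multiplicities -/

/-- The homogeneous prime ideal of the point `(v₀ : v₁ : v₂ : v₃)`: the kernel of
`X i ↦ v i * T ^ wt i`. -/
def pointIdeal {M : Type*} [Field M] (v : Fin 4 → M) : Ideal (MvPolynomial (Fin 4) M) :=
  RingHom.ker (aeval (fun i => Polynomial.C (v i) * Polynomial.X ^ wt i) :
    MvPolynomial (Fin 4) M →ₐ[M] Polynomial M)

instance pointIdeal_isPrime {M : Type*} [Field M] (v : Fin 4 → M) : (pointIdeal v).IsPrime :=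
  RingHom.ker_isPrime _

/-- The multiplicity of the subscheme defined by the homogeneous ideal `J` at the homogeneous prime
`𝔭`: the length of `(S / J)_𝔭`, where `S` is the weighted polynomial ring. -/
def mult {M : Type*} [Field M] (J 𝔭 : Ideal (MvPolynomial (Fin 4) M)) [𝔭.IsPrime] : ℕ∞ :=
  Module.length (Localization.AtPrime 𝔭)
    (Localization.AtPrime 𝔭 ⧸ J.map (algebraMap _ (Localization.AtPrime 𝔭)))

/-- An ideal is homogeneous for the weighted grading. -/
def IsHomogeneousIdeal {M : Type*} [Field M] (I : Ideal (MvPolynomial (Fin 4) M)) : Prop :=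
  ∀ A ∈ I, ∀ n, weightedHomogeneousComponent wt n A ∈ I

/-! ### Exceptional curves -/

/-- The intersection number with `-K_X` of the curve `E` in `X` with ideal `I` is `n`.  The class
`-K_X` is the class of the hyperplane sections of `X`, so this is the number of points, counted with
multiplicity, of the intersection of `E` with any hyperplane that does not contain it (there are
finitely many such points). -/
def AnticanonicalDegree {K : Type*} [Field K] (I : Ideal (MvPolynomial (Fin 4) K)) (n : ℕ) : Prop :=
  ∀ m : MvPolynomial (Fin 4) K, IsWeightedHomogeneous wt m 1 → m ∉ I →
    ∑ᶠ x : WP K, mult (I ⊔ Ideal.span {m}) (pointIdeal x.rep) = n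

/-- The self-intersection number on the smooth surface `X` with equation `F` of the curve `E` with
ideal `I` is `n`.  Take a hypersurface section `div A` of degree `d` of `X` that contains `E` with
multiplicity one, so `div A = E + D` with `D` effective, not containing `E`, and defined on `X` by
the ideal quotient `((F, A) : I)`; then `E · E = d (E · (-K_X)) - E · D`, where `E · D` is the
number of intersection points, counted with multiplicity. -/
def SelfIntersection {K : Type*} [Field K] (F : MvPolynomial (Fin 4) K)
    (I : Ideal (MvPolynomial (Fin 4) K)) (n : ℤ) : Prop :=
  ∃ (d : ℕ) (A : MvPolynomial (Fin 4) K) (a b : ℕ),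
    IsWeightedHomogeneous wt A d ∧ A ∈ I ∧
    ¬ (Ideal.span {F, A}).colon (I : Set (MvPolynomial (Fin 4) K)) ≤ I ∧
    AnticanonicalDegree I a ∧
    ∑ᶠ x : WP K, mult (I ⊔ (Ideal.span {F, A}).colon (I : Set (MvPolynomial (Fin 4) K)))
      (pointIdeal x.rep) = b ∧
    n = (d : ℤ) * a - b

/-- `I` is the homogeneous ideal of an exceptional curve `E` on `X` over `K`: an irreducible curve
with `E · E = E · K_X = -1`. -/
structure IsExceptionalCurve {k K : Type*} [Field k] [Field K] [Algebra k K]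
    (f g : MvPolynomial (Fin 3) k) (I : Ideal (MvPolynomial (Fin 4) K)) : Prop where
  prime : I.IsPrime
  homogeneous : IsHomogeneousIdeal I
  le_surface : MvPolynomial.map (algebraMap k K) (surfacePoly f g) ∈ I
  -- the affine cone over a curve has dimension two
  dim : ringKrullDim (MvPolynomial (Fin 4) K ⧸ I) = 2
  degree : AnticanonicalDegree I 1
  selfIntersection : SelfIntersection (MvPolynomial.map (algebraMap k K) (surfacePoly f g)) I (-1)

/-! ### The group of sections of the elliptic fibration, and `ρ`

The blow-up of `X` at `P` and `ι(P)` is the fibre product of `X` and the blow-up of `P²` at `Q` over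
`P²`, that is, the set of pairs `(x, L)` with `x ∈ X`, `L` a line through `Q`, and `π(x) ∈ L`; the
fibration `ψ` is `(x, L) ↦ L`.  A section of `ψ` is `L ↦ (σ(L), L)` for a morphism `σ` from the
pencil to `X` with `π(σ(L)) ∈ L`, and `σ` is its composition with the blow-up morphism.  Sections
correspond to rational points of the generic fibre, which is the curve `π⁻¹(L)` for the generic line
`L` through `Q`, a curve of genus one over the function field `k(t)` of the pencil. -/

/-- `L ↦ (σ(L), L)` is a section over `k` of `ψ`. -/
structure IsSection {k K : Type*} [Field k] [Field K] [Algebra k K] [IsAlgClosed K]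
    (f g : MvPolynomial (Fin 3) k) {Q : ℙ K (Fin 3 → K)} (σ : linesThrough Q → U K) : Prop where
  morphism : IsMorphism k σ
  mem_surface : ∀ L, (σ L).1 ∈ surface K f g
  mem_line : ∀ L, phi (σ L) ∈ line L.1

/-- The coefficients `a + t b` of the generic line in the pencil spanned by the lines `a`, `b`. -/
def genericLine {k : Type*} [Field k] (a b : Fin 3 → k) : Fin 3 → RatFunc k :=
  fun i => RatFunc.C (a i) + RatFunc.X * RatFunc.C (b i)

/-- The vector `y` consists of homogeneous coordinates over `k(t)` of the value of `σ` at the generic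
line of the pencil. -/
def IsGenericValue {k K : Type*} [Field k] [Field K] [Algebra k K] {Q : ℙ K (Fin 3 → K)}
    (a b : Fin 3 → k) (σ : linesThrough Q → U K) (y : Fin 4 → RatFunc k) : Prop :=
  ∃ (h : MvPolynomial (Fin 3) k) (H : Fin 4 → MvPolynomial (Fin 3) k),
    IsLocalRep k σ h H ∧ aeval (genericLine a b) h ≠ 0 ∧
    y = fun i => aeval (genericLine a b) (H i)

open Classical in
/-- The prime divisor of the rational point `v`, as a function on homogeneous prime ideals. -/
def pointDivisor {M : Type*} [Field M] (v : Fin 4 → M) (𝔭 : Ideal (MvPolynomial (Fin 4) M)) : ℕ∞ :=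
  if 𝔭 = pointIdeal v then 1 else 0

/-- On the curve over `M` with homogeneous ideal `G`, the divisors `(v₁) + (v₂)` and `(v₃) + (v₄)`
are linearly equivalent: there is a rational function `A / B`, a quotient of two forms of the same
degree that do not vanish on the curve, with divisor `(v₁) + (v₂) - (v₃) - (v₄)`.  The ideals `𝔭`
in the statement are the points (closed or generic) of the curve. -/
def LinearlyEquivalent {M : Type*} [Field M] (G : Ideal (MvPolynomial (Fin 4) M))
    (v₁ v₂ v₃ v₄ : Fin 4 → M) : Prop :=
  ∃ (n : ℕ) (A B : MvPolynomial (Fin 4) M),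
    IsWeightedHomogeneous wt A n ∧ IsWeightedHomogeneous wt B n ∧ A ∉ G ∧ B ∉ G ∧
    ∀ (𝔭 : Ideal (MvPolynomial (Fin 4) M)) [𝔭.IsPrime], IsHomogeneousIdeal 𝔭 → G ≤ 𝔭 →
      (∃ i : Fin 3, X i.castSucc ∉ 𝔭) →
      mult (G ⊔ Ideal.span {A}) 𝔭 + pointDivisor v₃ 𝔭 + pointDivisor v₄ 𝔭 =
        mult (G ⊔ Ideal.span {B}) 𝔭 + pointDivisor v₁ 𝔭 + pointDivisor v₂ 𝔭

/-- `σ₁ + σ₂ = σ₃` in the group of sections of `ψ` with neutral element `o`, that is, in the group of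
rational points of the generic fibre, a curve of genus one with neutral element `o`: the divisors
`(σ₁) + (σ₂)` and `(σ₃) + (o)` on it are linearly equivalent. -/
def SectionAdd {k K : Type*} [Field k] [Field K] [Algebra k K]
    (f g : MvPolynomial (Fin 3) k) {Q : ℙ K (Fin 3 → K)}
    (o σ₁ σ₂ σ₃ : linesThrough Q → U K) : Prop :=
  ∃ (a b : Fin 3 → k) (yo y₁ y₂ y₃ : Fin 4 → RatFunc k),
    LinearIndependent k ![a, b] ∧
    dotProduct (fun i => algebraMap k K (a i)) Q.rep = 0 ∧
    dotProduct (fun i => algebraMap k K (b i)) Q.rep = 0 ∧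
    IsGenericValue a b o yo ∧ IsGenericValue a b σ₁ y₁ ∧
    IsGenericValue a b σ₂ y₂ ∧ IsGenericValue a b σ₃ y₃ ∧
    LinearlyEquivalent
      (Ideal.span {MvPolynomial.map (algebraMap k (RatFunc k)) (surfacePoly f g),
        ∑ i : Fin 3, C (genericLine a b i) * X i.castSucc})
      y₁ y₂ y₃ yo

/-- `ρ` is the composition with the blow-up morphism of the section `-σ_P` of `ψ`, in the group of
sections with neutral element `σ_{ι(P)}`.  The sections `σ_P` and `σ_{ι(P)}` compose with the
blow-up morphism to the constant maps to `P` and `ι(P)`. -/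
structure IsRho {k K : Type*} [Field k] [Field K] [Algebra k K] [IsAlgClosed K]
    (f g : MvPolynomial (Fin 3) k) (P : U K) (ρ : linesThrough (phi P) → U K) : Prop where
  isSection : IsSection f g ρ
  isNeg : SectionAdd f g (fun _ => iota f P) (fun _ => P) ρ (fun _ => iota f P)

end

end DelPezzoTwo

/-!
Since `P` is not on the ramification locus, the surface `w² + f w = g` is near `P` a graph over the
plane. Its Taylor expansion of order two at `Q` is the only quadratic form `q` for which
`Φ = q² + f q - g` vanishes to order three at `Q` (`exists_osculating_section`); it is defined over
`k`. The morphism `ξ` is the section `S ↦ (S : q(S))` of the projection, and its image is the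
surface `w = q`. In coordinates `u, v, l` of the plane for which `Q` is the point `u = v = 0`,
`Φ = P₃(u, v) l + P₄(u, v)` for binary forms `P₃`, `P₄` of degrees 3 and 4
(`Osculation`).

*The maps `τ_L`.* A section of the projection above a line `L` is given by a binary quadratic form
`N` (`Frame.exists_quadratic_form`). If it meets the surface three times at `P`, then
`(N - q)(N + f + q)` vanishes to order three at `Q`. The second factor does not vanish at `Q`, so
`N - q`, of degree two, is zero (`Osculation.isTau_unique`).

*The section `ρ`.* Write `P₃ = D A` and `P₄ = D B` with `A`, `B` without common zeros. On a line
through `Q`, the form `Φ` vanishes three times at `Q`, and once more at a residual point, whose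
coordinates are forms in `A` and `B`; this defines `ρ` (`Osculation.Residual.rho`). On the generic
fibre `E` of the elliptic fibration, `w - q` has the divisor `3 P + R`, where `R` is the value of
`ρ`, and a linear form `u` that vanishes at `Q` has the divisor `P + ι(P)`. The quotient
`(w - q) / u²` shows that `P + R` is linearly equivalent to `2 ι(P)`, that is, `R = -P`
(`Frame.Osculates.linearlyEquivalent`). Conversely, if a rational function `a / b` realises a linear
equivalence of `P + y` and `2 ι(P)`, then `a u²` is locally divisible by `b` on `E`. The local rings
of `E` are principal, because they are local rings of the smooth surface outside the base points
(`isLocPrincipal_fibre`), and local divisibility is global, because the coordinate ring of the cone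
over `E` is free over that of a line (`mem_span_pair_of_pow_mul_mem`). The quotient is a form of
weighted degree two that vanishes three times at `P`, so it is a multiple of `w - q`, and `y = R`
(`Frame.Osculates.pointIdeal_eq_of_linearlyEquivalent`). Two morphisms on the pencil with the same
value at its generic member are equal (`SpansPencil.eq_of_pointIdeal_eq`).

*The intersection.* A point of the intersection of the surface with `w = q` above a line `L`, other
than `P`, is `ρ(L)`, unless `D` vanishes at `L`. In that case `Φ` vanishes on `L`, and the part of
the surface above `L` splits into `w = q` and its conjugate, two exceptional curves
(`Frame.Osculates.isExceptionalCurve`). Conversely, an exceptional curve through `P` and another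
point has degree one, so it lies above the line through their images; as the part of the surface
above this line is not integral of degree two, `Φ` vanishes on the line and the curve lies on
`w = q` (`Frame.Osculates.X_sub_mem`). Finally, `P` itself is of one of these two kinds, because `D`
or the cubic form `A` has a zero (`Osculation.Residual.point_mem`).
-/

namespace DelPezzoTwo

noncomputable section

/-! ### Multiplicities -/

section Mult

variable {M : Type*} [Field M]

/-- The local ring at `𝔭` of the subscheme defined by `J`. -/
def LocRing (J 𝔭 : Ideal (MvPolynomial (Fin 4) M)) [𝔭.IsPrime] : Type _ :=
  Localization.AtPrime 𝔭 ⧸ J.map (algebraMap _ (Localization.AtPrime 𝔭))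

instance (J 𝔭 : Ideal (MvPolynomial (Fin 4) M)) [𝔭.IsPrime] : CommRing (LocRing J 𝔭) :=
  inferInstanceAs (CommRing
    (Localization.AtPrime 𝔭 ⧸ J.map (algebraMap _ (Localization.AtPrime 𝔭))))

instance (J 𝔭 : Ideal (MvPolynomial (Fin 4) M)) [𝔭.IsPrime] : IsNoetherianRing (LocRing J 𝔭) :=
  inferInstanceAs (IsNoetherianRing
    (Localization.AtPrime 𝔭 ⧸ J.map (algebraMap _ (Localization.AtPrime 𝔭))))

/-- The quotient map from the local ring of the cone over `P(1,1,1,2)`. -/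
def mkLoc (J 𝔭 : Ideal (MvPolynomial (Fin 4) M)) [𝔭.IsPrime] :
    Localization.AtPrime 𝔭 →+* LocRing J 𝔭 :=
  Ideal.Quotient.mk (J.map (algebraMap _ (Localization.AtPrime 𝔭)))

theorem mkLoc_surjective (J 𝔭 : Ideal (MvPolynomial (Fin 4) M)) [𝔭.IsPrime] :
    Function.Surjective (mkLoc J 𝔭) := Ideal.Quotient.mk_surjective

/-- The image of a polynomial in the local ring at `𝔭` of the subscheme defined by `J`. -/
def toLoc (J 𝔭 : Ideal (MvPolynomial (Fin 4) M)) [𝔭.IsPrime] :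
    MvPolynomial (Fin 4) M →+* LocRing J 𝔭 :=
  (mkLoc J 𝔭).comp (algebraMap _ (Localization.AtPrime 𝔭))

theorem exists_mul_toLoc (J 𝔭 : Ideal (MvPolynomial (Fin 4) M)) [𝔭.IsPrime] (x : LocRing J 𝔭) :
    ∃ a s : MvPolynomial (Fin 4) M, s ∉ 𝔭 ∧ toLoc J 𝔭 s * x = toLoc J 𝔭 a := by
  obtain ⟨y, rfl⟩ := mkLoc_surjective J 𝔭 x
  obtain ⟨⟨a, s⟩, h⟩ := IsLocalization.surj 𝔭.primeCompl y
  refine ⟨a, s, s.2, ?_⟩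
  simp only [toLoc, RingHom.comp_apply, ← map_mul]
  rw [mul_comm, ← h]

theorem isUnit_toLoc {J 𝔭 : Ideal (MvPolynomial (Fin 4) M)} [𝔭.IsPrime]
    {s : MvPolynomial (Fin 4) M} (hs : s ∉ 𝔭) : IsUnit (toLoc J 𝔭 s) :=
  (IsLocalization.map_units (Localization.AtPrime 𝔭) (⟨s, hs⟩ : 𝔭.primeCompl)).map (mkLoc J 𝔭)

theorem toLoc_eq_zero_iff {J 𝔭 : Ideal (MvPolynomial (Fin 4) M)} [𝔭.IsPrime]
    {a : MvPolynomial (Fin 4) M} : toLoc J 𝔭 a = 0 ↔ ∃ s, s ∉ 𝔭 ∧ s * a ∈ J := by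
  refine Ideal.Quotient.eq_zero_iff_mem.trans ?_
  rw [IsLocalization.algebraMap_mem_map_algebraMap_iff 𝔭.primeCompl]
  rfl

theorem toLoc_dvd_iff {J 𝔭 : Ideal (MvPolynomial (Fin 4) M)} [𝔭.IsPrime]
    {a b : MvPolynomial (Fin 4) M} :
    toLoc J 𝔭 a ∣ toLoc J 𝔭 b ↔ ∃ s, s ∉ 𝔭 ∧ s * b ∈ J ⊔ Ideal.span {a} := by
  constructor
  · rintro ⟨x, hx⟩
    obtain ⟨c, s, hs, hc⟩ := exists_mul_toLoc J 𝔭 x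
    have h0 : toLoc J 𝔭 (s * b - a * c) = 0 := by
      rw [map_sub, map_mul, map_mul, hx, ← hc]; ring
    obtain ⟨t, ht, h⟩ := toLoc_eq_zero_iff.mp h0
    refine ⟨t * s, fun h' => (‹𝔭.IsPrime›.mem_or_mem h').elim ht hs, ?_⟩
    have : t * s * b = t * (s * b - a * c) + t * c * a := by ring
    rw [this]
    exact Ideal.add_mem _ (Ideal.mem_sup_left h)
      (Ideal.mem_sup_right (Ideal.mul_mem_left _ _ (Ideal.mem_span_singleton_self a)))
  · rintro ⟨s, hs, h⟩
    obtain ⟨j, hj, y, hy, h⟩ := Submodule.mem_sup.mp h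
    obtain ⟨c, rfl⟩ := Ideal.mem_span_singleton.mp hy
    have h0 : toLoc J 𝔭 j = 0 := toLoc_eq_zero_iff.mpr
      ⟨1, (Ideal.ne_top_iff_one 𝔭).mp (Ideal.IsPrime.ne_top ‹_›), by simpa using hj⟩
    rw [← (isUnit_toLoc (J := J) hs).dvd_mul_left, ← map_mul, ← h, map_add, h0, zero_add, map_mul]
    exact dvd_mul_right _ _

theorem length_quotient_sup_span {T : Type*} [CommRing T] (I : Ideal T) (a : T) :
    Module.length T (T ⧸ I ⊔ Ideal.span {a}) = Ring.ord (T ⧸ I) (Ideal.Quotient.mk I a) := by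
  rw [Ring.ord, ← Module.length_eq_of_surjective (S := T) (R := T ⧸ I)
    Ideal.Quotient.mk_surjective]
  have h1 : (Ideal.span {Ideal.Quotient.mk I a} : Ideal (T ⧸ I)) =
      (Ideal.span {a}).map (Ideal.Quotient.mk I) := by
    rw [Ideal.map_span, Set.image_singleton]
  rw [h1]
  exact (DoubleQuot.quotQuotEquivQuotSupₐ T _ _).toLinearEquiv.length_eq.symm

theorem mult_eq_ord (J 𝔭 : Ideal (MvPolynomial (Fin 4) M)) [𝔭.IsPrime]
    (a : MvPolynomial (Fin 4) M) :
    mult (J ⊔ Ideal.span {a}) 𝔭 = Ring.ord (LocRing J 𝔭) (toLoc J 𝔭 a) := by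
  rw [mult, Ideal.map_sup, Ideal.map_span _ {a}, Set.image_singleton]
  exact length_quotient_sup_span _ _

theorem mult_eq_zero {J 𝔭 : Ideal (MvPolynomial (Fin 4) M)} [𝔭.IsPrime] (h : ¬ J ≤ 𝔭) :
    mult J 𝔭 = 0 := by
  obtain ⟨a, ha, ha'⟩ := SetLike.not_le_iff_exists.mp h
  have h1 : J.map (algebraMap _ (Localization.AtPrime 𝔭)) = ⊤ :=
    Ideal.eq_top_of_isUnit_mem _ (Ideal.mem_map_of_mem _ ha)
      (IsLocalization.map_units (Localization.AtPrime 𝔭) (⟨a, ha'⟩ : 𝔭.primeCompl))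
  rw [mult, Module.length_eq_zero_iff, h1]
  exact Ideal.Quotient.subsingleton_iff.mpr rfl

theorem one_le_mult {J 𝔭 : Ideal (MvPolynomial (Fin 4) M)} [𝔭.IsPrime] (h : J ≤ 𝔭) :
    1 ≤ mult J 𝔭 := by
  rw [Order.one_le_iff_pos, mult, Module.length_pos_iff, Ideal.Quotient.nontrivial_iff]
  intro h1
  have h2 := Ideal.map_mono (f := algebraMap _ (Localization.AtPrime 𝔭)) h
  rw [h1, Localization.AtPrime.map_eq_maximalIdeal] at h2
  exact Ideal.IsPrime.ne_top inferInstance (top_le_iff.mp h2)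

theorem mult_self (𝔭 : Ideal (MvPolynomial (Fin 4) M)) [𝔭.IsPrime] : mult 𝔭 𝔭 = 1 := by
  rw [mult, Module.length_eq_one_iff, Localization.AtPrime.map_eq_maximalIdeal,
    isSimpleModule_iff_isSimpleModule_of_algebraMap_surjective
      (S := Localization.AtPrime 𝔭 ⧸ IsLocalRing.maximalIdeal (Localization.AtPrime 𝔭))
      Ideal.Quotient.mk_surjective]
  let := Ideal.Quotient.field (IsLocalRing.maximalIdeal (Localization.AtPrime 𝔭))
  exact instIsSimpleModule _

theorem toLoc_mem_nonZeroDivisors {J 𝔭 : Ideal (MvPolynomial (Fin 4) M)} [𝔭.IsPrime]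
    {a : MvPolynomial (Fin 4) M} (ha : ∀ y, a * y ∈ J → y ∈ J) :
    toLoc J 𝔭 a ∈ nonZeroDivisors (LocRing J 𝔭) := by
  refine mem_nonZeroDivisors_iff_right.mpr fun x hx => ?_
  rw [mul_comm] at hx
  obtain ⟨c, s, hs, hc⟩ := exists_mul_toLoc J 𝔭 x
  have h0 : toLoc J 𝔭 (a * c) = 0 := by
    rw [map_mul, ← hc, mul_left_comm, hx, mul_zero]
  obtain ⟨t, ht, h⟩ := toLoc_eq_zero_iff.mp h0
  have h1 : toLoc J 𝔭 c = 0 := toLoc_eq_zero_iff.mpr ⟨t, ht, ha _ (by convert h using 1; ring)⟩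
  rw [← hc] at h1
  exact (isUnit_toLoc hs).mul_right_eq_zero.mp h1

/-- Additivity of the multiplicity. -/
theorem mult_sup_mul {J 𝔭 : Ideal (MvPolynomial (Fin 4) M)} [𝔭.IsPrime]
    {a : MvPolynomial (Fin 4) M} (ha : ∀ y, a * y ∈ J → y ∈ J) (b : MvPolynomial (Fin 4) M) :
    mult (J ⊔ Ideal.span {a * b}) 𝔭 =
      mult (J ⊔ Ideal.span {a}) 𝔭 + mult (J ⊔ Ideal.span {b}) 𝔭 := by
  rw [mult_eq_ord, mult_eq_ord, mult_eq_ord, map_mul,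
    Ring.ord_mul' _ (toLoc_mem_nonZeroDivisors ha)]

theorem mult_sup_pow {J 𝔭 : Ideal (MvPolynomial (Fin 4) M)} [𝔭.IsPrime]
    {a : MvPolynomial (Fin 4) M} (ha : ∀ y, a * y ∈ J → y ∈ J) (n : ℕ) :
    mult (J ⊔ Ideal.span {a ^ n}) 𝔭 = n • mult (J ⊔ Ideal.span {a}) 𝔭 := by
  rw [mult_eq_ord, mult_eq_ord, map_pow,
    Ring.ord_pow (R := LocRing J 𝔭) (toLoc_mem_nonZeroDivisors ha) n]

/-- The ideal `𝔭` contains `G` and becomes principal in the local ring at `𝔭` of the subscheme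
defined by `G`. For an integral subscheme, this means that its local ring at `𝔭` is a field or a
discrete valuation ring. -/
def IsLocPrincipal (G 𝔭 : Ideal (MvPolynomial (Fin 4) M)) : Prop :=
  G ≤ 𝔭 ∧ ∃ π ∈ 𝔭, ∀ y ∈ 𝔭, ∃ s, s ∉ 𝔭 ∧ s * y ∈ G ⊔ Ideal.span {π}

theorem isLocalRing_locRing {G 𝔭 : Ideal (MvPolynomial (Fin 4) M)} [𝔭.IsPrime]
    (h : Nontrivial (LocRing G 𝔭)) : IsLocalRing (LocRing G 𝔭) :=
  IsLocalRing.of_surjective' (mkLoc G 𝔭) (mkLoc_surjective G 𝔭)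

theorem isPrincipalIdealRing_locRing {G 𝔭 : Ideal (MvPolynomial (Fin 4) M)} [𝔭.IsPrime]
    [hG : G.IsPrime] (h : IsLocPrincipal G 𝔭) :
    IsDomain (LocRing G 𝔭) ∧ IsPrincipalIdealRing (LocRing G 𝔭) := by
  obtain ⟨hle, π, hπ, h⟩ := h
  have hp : (G.map (algebraMap _ (Localization.AtPrime 𝔭))).IsPrime :=
    IsLocalization.isPrime_of_isPrime_disjoint 𝔭.primeCompl _ G hG
      (Set.disjoint_left.mpr fun x hx hx' => hx (hle hx'))
  have hdom : IsDomain (LocRing G 𝔭) := Ideal.Quotient.isDomain _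
  have hloc := isLocalRing_locRing (G := G) (𝔭 := 𝔭) inferInstance
  suffices hmax : IsLocalRing.maximalIdeal (LocRing G 𝔭) = Ideal.span {toLoc G 𝔭 π} by
    have hpr : (IsLocalRing.maximalIdeal (LocRing G 𝔭)).IsPrincipal := ⟨_, hmax⟩
    have htfae := tfae_of_isNoetherianRing_of_isLocalRing_of_isDomain (LocRing G 𝔭)
    exact ⟨hdom, (htfae.out 4 0).mp hpr⟩
  refine le_antisymm ?_ ?_
  · intro x hx
    obtain ⟨a, s, hs, ha⟩ := exists_mul_toLoc G 𝔭 x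
    have ha' : a ∈ 𝔭 := by
      by_contra hn
      have := isUnit_toLoc (J := G) hn
      rw [← ha] at this
      exact (IsLocalRing.mem_maximalIdeal x).mp hx (isUnit_of_mul_isUnit_right this)
    have := toLoc_dvd_iff.mpr (h a ha')
    rw [← ha, (isUnit_toLoc hs).dvd_mul_left] at this
    exact Ideal.mem_span_singleton.mpr this
  · rw [Ideal.span_singleton_le_iff_mem, IsLocalRing.mem_maximalIdeal, mem_nonunits_iff]
    intro hu
    obtain ⟨s, hs, h⟩ := toLoc_dvd_iff.mp (isUnit_iff_dvd_one.mp hu |>.trans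
      (map_one (toLoc G 𝔭)).symm.dvd)
    rw [mul_one] at h
    exact hs ((sup_le hle ((Ideal.span_singleton_le_iff_mem _).mpr hπ)) h)

theorem mult_ne_top {G 𝔭 : Ideal (MvPolynomial (Fin 4) M)} [𝔭.IsPrime] [hG : G.IsPrime]
    (h : IsLocPrincipal G 𝔭) {a : MvPolynomial (Fin 4) M} (ha : a ∉ G) :
    mult (G ⊔ Ideal.span {a}) 𝔭 ≠ ⊤ := by
  obtain ⟨_, _⟩ := isPrincipalIdealRing_locRing h
  rw [mult_eq_ord]
  exact Ring.ord_ne_top (toLoc_mem_nonZeroDivisors fun y hy => (hG.mem_or_mem hy).resolve_left ha)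

/-- In a discrete valuation ring, divisibility can be read off from lengths. -/
theorem exists_mul_mem_of_mult_le {G 𝔭 : Ideal (MvPolynomial (Fin 4) M)} [𝔭.IsPrime]
    [hG : G.IsPrime] (h : IsLocPrincipal G 𝔭) {a b : MvPolynomial (Fin 4) M} (hb : b ∉ G)
    (hab : mult (G ⊔ Ideal.span {a}) 𝔭 ≤ mult (G ⊔ Ideal.span {b}) 𝔭) :
    ∃ s, s ∉ 𝔭 ∧ s * b ∈ G ⊔ Ideal.span {a} := by
  have hfin := mult_ne_top h hb
  obtain ⟨_, _⟩ := isPrincipalIdealRing_locRing h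
  have hloc := isLocalRing_locRing (G := G) (𝔭 := 𝔭) inferInstance
  have hval : ValuationRing (LocRing G 𝔭) :=
    inferInstance
  rw [← toLoc_dvd_iff]
  rcases ValuationRing.dvd_total (toLoc G 𝔭 a) (toLoc G 𝔭 b) with hd | ⟨y, hy⟩
  · exact hd
  · rw [mult_eq_ord, mult_eq_ord, hy, Ring.ord_mul' _ (toLoc_mem_nonZeroDivisors fun y hy =>
      (hG.mem_or_mem hy).resolve_left hb)] at hab
    rw [mult_eq_ord] at hfin
    have h0 : Ring.ord (LocRing G 𝔭) y = 0 := by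
      have h1 : Ring.ord (LocRing G 𝔭) (toLoc G 𝔭 b) + Ring.ord (LocRing G 𝔭) y ≤
        Ring.ord (LocRing G 𝔭) (toLoc G 𝔭 b) + 0 := by simpa using hab
      exact nonpos_iff_eq_zero.mp ((ENat.add_le_add_iff_left hfin).mp h1)
    have hu : IsUnit y := by
      rw [Ring.ord, Module.length_eq_zero_iff, Ideal.Quotient.subsingleton_iff] at h0
      exact Ideal.span_singleton_eq_top.mp h0
    rw [hy]
    exact hu.mul_right_dvd.mpr dvd_rfl

end Mult

/-! ### Weighted homogeneous polynomials and the ideals of points -/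

section Homogeneity

theorem _root_.MvPolynomial.IsWeightedHomogeneous.sum_weight {σ R : Type*} [Fintype σ]
    [CommSemiring R] {w : σ → ℕ} {A : MvPolynomial σ R} {n : ℕ} (hA : IsWeightedHomogeneous w A n)
    {d : σ →₀ ℕ} (hd : d ∈ A.support) : ∑ i, d i * w i = n := by
  rw [← hA (mem_support_iff.mp hd), Finsupp.weight_apply, Finsupp.sum_fintype _ _ (by simp)]
  simp

theorem _root_.MvPolynomial.IsWeightedHomogeneous.aeval_smul {σ R S : Type*} [Fintype σ]
    [CommSemiring R] [CommSemiring S] [Algebra R S] {w : σ → ℕ} {A : MvPolynomial σ R} {n : ℕ}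
    (hA : IsWeightedHomogeneous w A n) (c : S) (x : σ → S) :
    aeval (fun i => c ^ w i * x i) A = c ^ n * aeval x A := by
  simp only [aeval_def, eval₂_eq', Finset.mul_sum]
  refine Finset.sum_congr rfl fun d hd => ?_
  have h : ∏ i, (c ^ w i * x i) ^ d i = c ^ n * ∏ i, x i ^ d i := by
    simp only [mul_pow, Finset.prod_mul_distrib, ← pow_mul, Finset.prod_pow_eq_pow_sum]
    rw [← hA.sum_weight hd]
    simp only [mul_comm]
  rw [h]; ring

theorem _root_.MvPolynomial.IsHomogeneous.aeval_smul' {σ R S : Type*} [Fintype σ]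
    [CommSemiring R] [CommSemiring S] [Algebra R S] {A : MvPolynomial σ R} {n : ℕ}
    (hA : A.IsHomogeneous n) (c : S) (x : σ → S) :
    aeval (fun i => c * x i) A = c ^ n * aeval x A := by
  simpa using IsWeightedHomogeneous.aeval_smul (w := 1) hA c x

theorem _root_.MvPolynomial.IsWeightedHomogeneous.aeval_weight {σ τ R S : Type*} [Fintype σ]
    [CommRing R] [CommRing S] [Algebra R S] {w : σ → ℕ} {w' : τ → ℕ} {A : MvPolynomial σ R} {n : ℕ}
    (hA : IsWeightedHomogeneous w A n) {r : σ → MvPolynomial τ S}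
    (hr : ∀ i, IsWeightedHomogeneous w' (r i) (w i)) :
    IsWeightedHomogeneous w' (aeval r A) n := by
  simp only [aeval_def, eval₂_eq']
  refine Submodule.sum_mem (weightedHomogeneousSubmodule S w' n) fun d hd => ?_
  rw [mem_weightedHomogeneousSubmodule, IsScalarTower.algebraMap_apply R S (MvPolynomial τ S),
    MvPolynomial.algebraMap_eq]
  refine IsWeightedHomogeneous.C_mul ?_ _
  rw [← hA.sum_weight hd]
  exact IsWeightedHomogeneous.prod _ _ _ fun i _ => by
    simpa using (hr i).pow (d i)

theorem isHomogeneousIdeal_iff {M : Type*} [Field M] {I : Ideal (MvPolynomial (Fin 4) M)} :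
    IsHomogeneousIdeal I ↔ letI := weightedGradedAlgebra M wt
      I.IsHomogeneous (weightedHomogeneousSubmodule M wt) := by
  let := weightedGradedAlgebra M wt
  constructor
  · intro h n A hA
    have := h A hA n
    rwa [← weightedDecomposition.decompose'_apply] at this
  · intro h A hA n
    exact weightedHomogeneousComponent_mem_of_mem M wt h hA n

theorem isHomogeneousIdeal_span {M : Type*} [Field M] {s : Set (MvPolynomial (Fin 4) M)}
    (h : ∀ A ∈ s, ∃ n, IsWeightedHomogeneous wt A n) : IsHomogeneousIdeal (Ideal.span s) := by
  let := weightedGradedAlgebra M wt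
  rw [isHomogeneousIdeal_iff]
  exact Ideal.homogeneous_span _ _ h

/-- To check an inclusion of ideals, the first of them homogeneous, consider homogeneous
elements. -/
theorem IsHomogeneousIdeal.le_of_forall {M : Type*} [Field M]
    {I J : Ideal (MvPolynomial (Fin 4) M)} (hI : IsHomogeneousIdeal I)
    (h : ∀ A ∈ I, ∀ n, IsWeightedHomogeneous wt A n → A ∈ J) : I ≤ J := by
  intro A hA
  rw [← sum_weightedHomogeneousComponent wt A,
    finsum_eq_sum _ (weightedHomogeneousComponent_finsupp A)]
  exact Ideal.sum_mem _ fun n _ => h _ (hI A hA n) n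
    (weightedHomogeneousComponent_isWeightedHomogeneous n A)

theorem weightedHomogeneousComponent_mul_right {σ R : Type*} [CommRing R] {w : σ → ℕ}
    {A : MvPolynomial σ R} {n : ℕ} (hA : IsWeightedHomogeneous w A n) (B : MvPolynomial σ R)
    (m : ℕ) : weightedHomogeneousComponent w (m + n) (B * A) =
      weightedHomogeneousComponent w m B * A := by
  let := weightedGradedAlgebra R w
  have h8 := DirectSum.coe_decompose_mul_add_of_right_mem
    (weightedHomogeneousSubmodule R w) (i := m) (a := B)
    ((mem_weightedHomogeneousSubmodule R w n A).mpr hA)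
  have h9 : ∀ m (B : MvPolynomial σ R), ((DirectSum.decompose
      (weightedHomogeneousSubmodule R w) B m : weightedHomogeneousSubmodule R w m) :
        MvPolynomial σ R) = weightedHomogeneousComponent w m B :=
    fun m B => weightedDecomposition.decompose'_apply R w B m
  rwa [h9, h9] at h8

end Homogeneity

section PointIdeal

variable {M : Type*} [Field M]

/-- A polynomial in `x, y, z`, viewed as a polynomial in `x, y, z, w`. -/
abbrev emb : MvPolynomial (Fin 3) M →ₐ[M] MvPolynomial (Fin 4) M := rename Fin.castSucc

theorem wt_castSucc (i : Fin 3) : wt i.castSucc = 1 := by fin_cases i <;> rfl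

theorem isWeightedHomogeneous_emb {A : MvPolynomial (Fin 3) M} {n : ℕ} (hA : A.IsHomogeneous n) :
    IsWeightedHomogeneous wt (emb A) n := by
  rw [emb, rename_eq_aeval]
  refine IsWeightedHomogeneous.aeval_weight (w := 1) hA fun i => ?_
  have := isWeightedHomogeneous_X M wt i.castSucc
  rwa [wt_castSucc] at this

theorem mem_pointIdeal_of_isWeightedHomogeneous {v : Fin 4 → M} {A : MvPolynomial (Fin 4) M}
    {n : ℕ} (hA : IsWeightedHomogeneous wt A n) : A ∈ pointIdeal v ↔ eval v A = 0 := by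
  have h : aeval (fun i => Polynomial.C (v i) * Polynomial.X ^ wt i : Fin 4 → Polynomial M) A =
      Polynomial.X ^ n * Polynomial.C (eval v A) := by
    simp_rw [mul_comm (Polynomial.C _)]
    rw [hA.aeval_smul]
    congr 1
    have : (fun i => Polynomial.C (v i)) = fun i => algebraMap M (Polynomial M) (v i) := rfl
    rw [this, ← coe_aeval_eq_eval]
    exact aeval_algebraMap_apply _ _ _
  rw [pointIdeal, RingHom.mem_ker]
  change aeval _ A = 0 ↔ _
  rw [h]
  simp

theorem isHomogeneousIdeal_pointIdeal (v : Fin 4 → M) : IsHomogeneousIdeal (pointIdeal v) := by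
  intro A hA n
  rw [mem_pointIdeal_of_isWeightedHomogeneous
    (weightedHomogeneousComponent_isWeightedHomogeneous n A)]
  have h : ∀ B : MvPolynomial (Fin 4) M,
      (aeval (fun i => Polynomial.C (v i) * Polynomial.X ^ wt i : Fin 4 → Polynomial M) B).coeff n =
      eval v (weightedHomogeneousComponent wt n B) := by
    intro B
    induction B using MvPolynomial.induction_on' with
    | monomial d c =>
      rw [aeval_monomial]
      have h1 : (d.prod fun i e => (Polynomial.C (v i) * Polynomial.X ^ wt i : Polynomial M) ^ e) =
          Polynomial.C (d.prod fun i e => v i ^ e) * Polynomial.X ^ Finsupp.weight wt d := by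
        simp only [mul_pow, Finsupp.prod_mul, ← pow_mul]
        congr 1
        · simp [Finsupp.prod]
        · rw [Finsupp.weight_apply, Finsupp.sum, Finsupp.prod, Finset.prod_pow_eq_pow_sum]
          simp [mul_comm]
      rw [h1, Polynomial.algebraMap_eq, ← mul_assoc, ← Polynomial.C_mul,
        Polynomial.coeff_C_mul, Polynomial.coeff_X_pow]
      by_cases hn : Finsupp.weight wt d = n
      · rw [(isWeightedHomogeneous_monomial wt d c hn).weightedHomogeneousComponent_same,
          eval_monomial, if_pos hn.symm, mul_one]
      · rw [(isWeightedHomogeneous_monomial wt d c rfl).weightedHomogeneousComponent_ne n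
          (Ne.symm hn),
          if_neg (Ne.symm hn), mul_zero, map_zero]
    | add p q hp hq => simp only [map_add, Polynomial.coeff_add, hp, hq]
  rw [← h A]
  have : aeval (fun i => Polynomial.C (v i) * Polynomial.X ^ wt i : Fin 4 → Polynomial M) A = 0 :=
    hA
  rw [this, Polynomial.coeff_zero]

theorem le_pointIdeal_iff {I : Ideal (MvPolynomial (Fin 4) M)} (hI : IsHomogeneousIdeal I)
    {v : Fin 4 → M} : I ≤ pointIdeal v ↔ ∀ A ∈ I, eval v A = 0 := by
  constructor
  · intro h A hA
    rw [← sum_weightedHomogeneousComponent wt A,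
      finsum_eq_sum _ (weightedHomogeneousComponent_finsupp A), map_sum]
    exact Finset.sum_eq_zero fun n _ => (mem_pointIdeal_of_isWeightedHomogeneous
      (weightedHomogeneousComponent_isWeightedHomogeneous n A)).mp (h (hI A hA n))
  · intro h
    exact hI.le_of_forall fun A hA n hn =>
      (mem_pointIdeal_of_isWeightedHomogeneous hn).mpr (h A hA)

theorem eval_eq_zero_of_mem_pointIdeal {v : Fin 4 → M} {A : MvPolynomial (Fin 4) M}
    (hA : A ∈ pointIdeal v) : eval v A = 0 :=
  (le_pointIdeal_iff (isHomogeneousIdeal_pointIdeal v)).mp le_rfl A hA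

theorem pointIdeal_smul {c : M} (hc : c ≠ 0) (v : Fin 4 → M) :
    pointIdeal (fun i => c ^ wt i * v i) = pointIdeal v := by
  have h : ∀ {A : MvPolynomial (Fin 4) M} {n : ℕ}, IsWeightedHomogeneous wt A n →
      (A ∈ pointIdeal (fun i => c ^ wt i * v i) ↔ A ∈ pointIdeal v) := by
    intro A n hA
    rw [mem_pointIdeal_of_isWeightedHomogeneous hA, mem_pointIdeal_of_isWeightedHomogeneous hA]
    have : eval (fun i => c ^ wt i * v i) A = c ^ n * eval v A := hA.aeval_smul c v
    rw [this]
    simp [hc]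
  exact le_antisymm
    ((isHomogeneousIdeal_pointIdeal _).le_of_forall fun A hA n hn => (h hn).mp hA)
    ((isHomogeneousIdeal_pointIdeal _).le_of_forall fun A hA n hn => (h hn).mpr hA)

theorem mul_eq_mul_of_pointIdeal_le {v v' : Fin 4 → M} (h : pointIdeal v ≤ pointIdeal v')
    (i j : Fin 3) : v i.castSucc * v' j.castSucc = v j.castSucc * v' i.castSucc := by
  have hw : IsWeightedHomogeneous wt
      (C (v i.castSucc) * X j.castSucc - C (v j.castSucc) * X i.castSucc) 1 := by
    have h1 := isWeightedHomogeneous_X M wt i.castSucc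
    have h2 := isWeightedHomogeneous_X M wt j.castSucc
    rw [wt_castSucc] at h1 h2
    exact (h2.C_mul _).sub (h1.C_mul _)
  have := eval_eq_zero_of_mem_pointIdeal
    (h ((mem_pointIdeal_of_isWeightedHomogeneous hw).mpr (by simp [mul_comm])))
  simpa [sub_eq_zero] using this

theorem mul_sq_eq_of_pointIdeal_le {v v' : Fin 4 → M} (h : pointIdeal v ≤ pointIdeal v')
    (i : Fin 3) : v i.castSucc ^ 2 * v' 3 = v 3 * v' i.castSucc ^ 2 := by
  have hw : IsWeightedHomogeneous wt
      (C (v i.castSucc ^ 2) * X 3 - C (v 3) * X i.castSucc ^ 2) 2 := by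
    have h1 := (isWeightedHomogeneous_X M wt i.castSucc).pow 2
    have h2 := isWeightedHomogeneous_X M wt 3
    rw [wt_castSucc] at h1
    exact (h2.C_mul _).sub (h1.C_mul _)
  have := eval_eq_zero_of_mem_pointIdeal
    (h ((mem_pointIdeal_of_isWeightedHomogeneous hw).mpr (by simp [mul_comm])))
  simpa [sub_eq_zero] using this

theorem X_mem_of_pointIdeal_lt {v : Fin 4 → M} {j : Fin 3} (hj : v j.castSucc ≠ 0)
    {𝔭 : Ideal (MvPolynomial (Fin 4) M)} [𝔭.IsPrime] (h𝔭 : IsHomogeneousIdeal 𝔭)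
    (h : pointIdeal v ≤ 𝔭) (hne : 𝔭 ≠ pointIdeal v) (i : Fin 3) : X i.castSucc ∈ 𝔭 := by
  have h1 : ¬ 𝔭 ≤ pointIdeal v := fun h' => hne (le_antisymm h' h)
  rw [le_pointIdeal_iff h𝔭] at h1
  push Not at h1
  obtain ⟨A, hA, hv⟩ := h1
  obtain ⟨n, hn⟩ : ∃ n, eval v (weightedHomogeneousComponent wt n A) ≠ 0 := by
    by_contra! hc
    apply hv
    rw [← sum_weightedHomogeneousComponent wt A,
      finsum_eq_sum _ (weightedHomogeneousComponent_finsupp A), map_sum]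
    exact Finset.sum_eq_zero fun n _ => hc n
  set B := weightedHomogeneousComponent wt n A
  have hB : B ∈ 𝔭 := h𝔭 A hA n
  have hBw : IsWeightedHomogeneous wt B n :=
    weightedHomogeneousComponent_isWeightedHomogeneous n A
  have hXw : ∀ l : Fin 3, IsWeightedHomogeneous wt (X l.castSucc : MvPolynomial (Fin 4) M) 1 := by
    intro l
    have h1 := isWeightedHomogeneous_X M wt l.castSucc
    rwa [wt_castSucc] at h1
  have h2 : C (v j.castSucc ^ n) * B - C (eval v B) * X j.castSucc ^ n ∈ pointIdeal v := by
    have h3 : IsWeightedHomogeneous wt (C (eval v B) * X j.castSucc ^ n) n := by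
      simpa using ((hXw j).pow n).C_mul (eval v B)
    rw [mem_pointIdeal_of_isWeightedHomogeneous ((hBw.C_mul _).sub h3)]
    simp [mul_comm]
  have h4 : C (eval v B) * X j.castSucc ^ n ∈ 𝔭 := by
    have := 𝔭.sub_mem (𝔭.mul_mem_left (C (v j.castSucc ^ n)) hB) (h h2)
    simpa using this
  have hunit : ∀ {c : M} {Y : MvPolynomial (Fin 4) M}, c ≠ 0 → C c * Y ∈ 𝔭 → Y ∈ 𝔭 := by
    intro c Y hc hY
    have := 𝔭.mul_mem_left (C c⁻¹) hY
    rwa [← mul_assoc, ← C_mul, inv_mul_cancel₀ hc, C_1, one_mul] at this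
  have h5 : X j.castSucc ∈ 𝔭 := Ideal.IsPrime.mem_of_pow_mem ‹_› n (hunit hn h4)
  have h6 : C (v j.castSucc) * X i.castSucc - C (v i.castSucc) * X j.castSucc ∈ pointIdeal v := by
    rw [mem_pointIdeal_of_isWeightedHomogeneous (((hXw i).C_mul _).sub ((hXw j).C_mul _))]
    simp [mul_comm]
  refine hunit hj ?_
  have := 𝔭.add_mem (h h6) (𝔭.mul_mem_left (C (v i.castSucc)) h5)
  simpa using this

theorem mult_pointIdeal_of_isHomogeneousIdeal {v : Fin 4 → M} {j : Fin 3} (hj : v j.castSucc ≠ 0)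
    {𝔭 : Ideal (MvPolynomial (Fin 4) M)} [𝔭.IsPrime] (h𝔭 : IsHomogeneousIdeal 𝔭)
    (hirr : ∃ i : Fin 3, X i.castSucc ∉ 𝔭) : mult (pointIdeal v) 𝔭 = pointDivisor v 𝔭 := by
  unfold pointDivisor
  split_ifs with h
  · subst h
    exact mult_self _
  · refine mult_eq_zero fun hle => ?_
    obtain ⟨i, hi⟩ := hirr
    exact hi (X_mem_of_pointIdeal_lt hj h𝔭 hle h i)

end PointIdeal

/-! ### Lines in the plane and curves above them -/

section Frame

variable {M : Type*} [Field M]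

/-- The linear form with the given coefficients. -/
def lin (a : Fin 3 → M) : MvPolynomial (Fin 3) M := ∑ i, C (a i) * X i

theorem isHomogeneous_lin (a : Fin 3 → M) : (lin a).IsHomogeneous 1 :=
  IsHomogeneous.sum _ _ _ fun _ _ => isHomogeneous_C_mul_X _ _

theorem aeval_lin {S : Type*} [CommRing S] [Algebra M S] (a : Fin 3 → M) (x : Fin 3 → S) :
    aeval x (lin a) = ∑ i, algebraMap M S (a i) * x i := by
  simp [lin]

theorem eval_lin (a x : Fin 3 → M) : eval x (lin a) = ∑ i, a i * x i := by
  simp [lin]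

theorem emb_lin (a : Fin 3 → M) : emb (lin a) = ∑ i : Fin 3, C (a i) * X i.castSucc := by
  simp [lin]

theorem aeval_sub_aeval_mem {σ S : Type*} [CommRing S] [Algebra M S] {J : Ideal S}
    {x y : σ → S} (h : ∀ i, x i - y i ∈ J) (A : MvPolynomial σ M) :
    aeval x A - aeval y A ∈ J := by
  rw [← Ideal.Quotient.mk_eq_mk_iff_sub_mem]
  have : (Ideal.Quotient.mkₐ M J).comp (aeval x) = (Ideal.Quotient.mkₐ M J).comp (aeval y) := by
    ext i
    simpa using (Ideal.Quotient.mk_eq_mk_iff_sub_mem (x i) (y i)).mpr (h i)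
  exact DFunLike.congr_fun this A

theorem aeval_apply_X {σ S : Type*} [CommRing S] [Algebra M S] (θ : MvPolynomial σ M →ₐ[M] S)
    (A : MvPolynomial σ M) : aeval (fun i => θ (X i)) A = θ A :=
  (DFunLike.congr_fun (aeval_unique θ) A).symm

/-- A surjection of rings with a section up to `J` has kernel `J`. -/
theorem ker_eq_of_section {σ S : Type*} [CommRing S] (κ : MvPolynomial σ M →+* S)
    (τ : S →+* MvPolynomial σ M) {J : Ideal (MvPolynomial σ M)} (hJ : J ≤ RingHom.ker κ)
    (hC : ∀ c, τ (κ (C c)) = C c) (hX : ∀ i, X i - τ (κ (X i)) ∈ J) : RingHom.ker κ = J := by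
  refine le_antisymm (fun A hA => ?_) hJ
  have h : (Ideal.Quotient.mk J).comp (τ.comp κ) = Ideal.Quotient.mk J := by
    refine MvPolynomial.ringHom_ext (fun c => by simp [hC]) fun i => ?_
    exact (Ideal.Quotient.mk_eq_mk_iff_sub_mem _ _).mpr (by simpa using J.neg_mem (hX i))
  have h1 := RingHom.congr_fun h A
  rw [RingHom.comp_apply, RingHom.comp_apply, (RingHom.mem_ker).mp hA, map_zero, map_zero] at h1
  exact Ideal.Quotient.eq_zero_iff_mem.mp h1.symm

variable (M) in
/-- A basis `p, s, m` of `M³` together with its dual basis `v, u, l`. It describes a point `p` in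
the plane, the line `l = 0` through `p`, on which `u, v` are homogeneous coordinates such that
`p` is the zero of `u`, and `s` the zero of `v`. -/
structure Frame where
  p : Fin 3 → M
  s : Fin 3 → M
  m : Fin 3 → M
  v : Fin 3 → M
  u : Fin 3 → M
  l : Fin 3 → M
  dual : ∀ i j, p i * v j + s i * u j + m i * l j = if i = j then 1 else 0

namespace Frame

variable (F : Frame M)

theorem matrix_mul_eq_one : (Matrix.of ![F.v, F.u, F.l]) * (Matrix.of ![F.p, F.s, F.m]).transpose =
    1 := by
  rw [mul_eq_one_comm]
  ext i j
  rw [Matrix.one_apply, ← F.dual i j, Matrix.mul_apply, Fin.sum_univ_three]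
  simp

theorem pairing (a b : Fin 3) : ∑ i, (![F.v, F.u, F.l] a i) * (![F.p, F.s, F.m] b i) =
    if a = b then 1 else 0 := by
  have := congrFun (congrFun F.matrix_mul_eq_one a) b
  rwa [Matrix.one_apply, Matrix.mul_apply] at this

theorem v_p : ∑ i, F.v i * F.p i = 1 := F.pairing 0 0
theorem v_s : ∑ i, F.v i * F.s i = 0 := F.pairing 0 1
theorem u_p : ∑ i, F.u i * F.p i = 0 := F.pairing 1 0
theorem u_s : ∑ i, F.u i * F.s i = 1 := F.pairing 1 1
theorem l_p : ∑ i, F.l i * F.p i = 0 := F.pairing 2 0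
theorem l_s : ∑ i, F.l i * F.s i = 0 := F.pairing 2 1

theorem X_eq (i : Fin 3) :
    X i = C (F.p i) * lin F.v + C (F.s i) * lin F.u + C (F.m i) * lin F.l := by
  have h : ∀ j, C (if i = j then (1 : M) else 0) * X j =
      C (F.p i) * (C (F.v j) * X j) + C (F.s i) * (C (F.u j) * X j) +
        C (F.m i) * (C (F.l j) * (X j : MvPolynomial (Fin 3) M)) := by
    intro j
    rw [← F.dual i j]
    simp only [C_add, C_mul]; ring
  rw [lin, lin, lin, Finset.mul_sum, Finset.mul_sum, Finset.mul_sum, ← Finset.sum_add_distrib,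
    ← Finset.sum_add_distrib, ← Finset.sum_congr rfl fun j _ => h j]
  simp

theorem exists_p_ne_zero : ∃ i, F.p i ≠ 0 := by
  by_contra! h
  have := F.v_p
  simp [h] at this

/-- The frame in which the point `c₁ s - c₀ p` replaces `p`. -/
def rot (c₀ c₁ d₀ d₁ : M) (h : d₁ * c₁ - d₀ * c₀ = 1) : Frame M where
  p i := c₁ * F.s i - c₀ * F.p i
  s i := d₁ * F.p i - d₀ * F.s i
  m := F.m
  v i := d₁ * F.u i + d₀ * F.v i
  u i := c₁ * F.v i + c₀ * F.u i
  l := F.l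
  dual i j := by
    rw [← F.dual i j]
    linear_combination (F.s i * F.u j + F.p i * F.v j) * h

theorem exists_rot {c₀ c₁ : M} (h : c₀ ≠ 0 ∨ c₁ ≠ 0) : ∃ d₀ d₁ : M, d₁ * c₁ - d₀ * c₀ = 1 := by
  rcases h with h | h
  · exact ⟨-c₀⁻¹, 0, by field_simp; ring⟩
  · exact ⟨0, c₁⁻¹, by field_simp; ring⟩

/-- Restriction of polynomials to the line, in the coordinates `u = X 0` and `v = X 1`. -/
def res : MvPolynomial (Fin 3) M →ₐ[M] MvPolynomial (Fin 2) M :=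
  aeval fun i => C (F.s i) * X 0 + C (F.p i) * X 1

theorem res_lin (a : Fin 3 → M) :
    F.res (lin a) = C (∑ i, a i * F.s i) * X 0 + C (∑ i, a i * F.p i) * X 1 := by
  simp only [res, aeval_lin, map_sum, Finset.sum_mul, ← Finset.sum_add_distrib, algebraMap_eq,
    C_mul]
  exact Finset.sum_congr rfl fun i _ => by ring

@[simp] theorem res_u : F.res (lin F.u) = X 0 := by simp [res_lin, u_s, u_p]
@[simp] theorem res_v : F.res (lin F.v) = X 1 := by simp [res_lin, v_s, v_p]
@[simp] theorem res_l : F.res (lin F.l) = 0 := by simp [res_lin, l_s, l_p]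

theorem isHomogeneous_res {A : MvPolynomial (Fin 3) M} {n : ℕ} (hA : A.IsHomogeneous n) :
    (F.res A).IsHomogeneous n :=
  IsWeightedHomogeneous.aeval_weight (w := 1) (w' := 1) hA fun i =>
    IsHomogeneous.add (isHomogeneous_C_mul_X (F.s i) 0) (isHomogeneous_C_mul_X (F.p i) 1)

theorem aeval_res {S : Type*} [CommRing S] [Algebra M S] (x : Fin 2 → S)
    (A : MvPolynomial (Fin 3) M) :
    aeval x (F.res A) =
      aeval (fun i => algebraMap M S (F.s i) * x 0 + algebraMap M S (F.p i) * x 1) A := by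
  rw [res, ← AlgHom.comp_apply, comp_aeval]
  simp

/-- Extension of polynomials from the line to the plane. -/
def ext : MvPolynomial (Fin 2) M →ₐ[M] MvPolynomial (Fin 3) M := aeval ![lin F.u, lin F.v]

theorem res_ext (A : MvPolynomial (Fin 2) M) : F.res (F.ext A) = A := by
  have : F.res.comp F.ext = AlgHom.id M _ := by
    ext1 i
    fin_cases i <;> simp [ext]
  exact DFunLike.congr_fun this A

theorem X_sub_ext_res (i : Fin 3) : X i - F.ext (F.res (X i)) = C (F.m i) * lin F.l := by
  rw [F.X_eq i]
  simp only [map_add, map_mul, res_u, res_v, res_l, ← algebraMap_eq, AlgHom.commutes]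
  simp [ext]

theorem sub_ext_res_mem (A : MvPolynomial (Fin 3) M) :
    A - F.ext (F.res A) ∈ Ideal.span {lin F.l} := by
  have h1 := aeval_sub_aeval_mem (J := Ideal.span {lin F.l}) (x := fun i => X i)
    (y := fun i => F.ext (F.res (X i))) (fun i => by
      rw [X_sub_ext_res]
      exact Ideal.mul_mem_left _ _ (Ideal.mem_span_singleton_self _)) A
  have h2 := aeval_apply_X (F.ext.comp F.res) A
  simp only [AlgHom.comp_apply] at h2
  rw [h2] at h1
  simpa using h1

theorem isHomogeneous_ext {A : MvPolynomial (Fin 2) M} {n : ℕ} (hA : A.IsHomogeneous n) :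
    (F.ext A).IsHomogeneous n := by
  refine IsWeightedHomogeneous.aeval_weight (w := 1) (w' := 1) hA fun i => ?_
  fin_cases i
  exacts [isHomogeneous_lin _, isHomogeneous_lin _]

/-- A section of the cone over a line: `w` is given by a polynomial `q`. -/
def cut (q : MvPolynomial (Fin 3) M) : MvPolynomial (Fin 4) M →ₐ[M] MvPolynomial (Fin 2) M :=
  aeval (Fin.snoc (α := fun _ => MvPolynomial (Fin 2) M) (fun i => F.res (X i)) (F.res q))

@[simp] theorem cut_emb (q A : MvPolynomial (Fin 3) M) : F.cut q (emb A) = F.res A := by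
  rw [cut, emb, aeval_rename]
  have : (Fin.snoc (α := fun _ => MvPolynomial (Fin 2) M) (fun i => F.res (X i)) (F.res q)) ∘
      Fin.castSucc = fun i => F.res (X i) := by
    funext i; simp
  rw [this]
  exact aeval_apply_X _ _

@[simp] theorem cut_X (q : MvPolynomial (Fin 3) M) : F.cut q (X 3) = F.res q := by
  rw [cut, aeval_X]; exact Fin.snoc_last _ _

/-- The ideal of the curve `l = 0`, `w = q`. -/
def curveIdeal (q : MvPolynomial (Fin 3) M) : Ideal (MvPolynomial (Fin 4) M) :=
  Ideal.span {emb (lin F.l), X 3 - emb q}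

theorem X_castSucc (i : Fin 3) : (X i.castSucc : MvPolynomial (Fin 4) M) = emb (X i) := by simp

theorem ker_cut (q : MvPolynomial (Fin 3) M) : RingHom.ker (F.cut q) = F.curveIdeal q := by
  have hl : emb (lin F.l) ∈ F.curveIdeal q := Ideal.subset_span (by simp)
  have hw : X 3 - emb q ∈ F.curveIdeal q := Ideal.subset_span (by simp)
  have hi : ∀ i, emb (X i) - emb (F.ext (F.res (X i))) ∈ F.curveIdeal q := by
    intro i
    rw [← map_sub, X_sub_ext_res, map_mul]
    exact Ideal.mul_mem_left _ _ hl
  refine ker_eq_of_section (F.cut q : MvPolynomial (Fin 4) M →+* _)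
    (emb.comp F.ext : MvPolynomial (Fin 2) M →ₐ[M] MvPolynomial (Fin 4) M).toRingHom ?_ ?_ ?_
  · rw [curveIdeal, Ideal.span_le]
    rintro A (rfl | rfl)
    · simp [RingHom.mem_ker]
    · simp [RingHom.mem_ker]
  · intro c
    change (emb.comp F.ext) (F.cut q (C c)) = C c
    rw [← algebraMap_eq, AlgHom.commutes, AlgHom.commutes]
  · intro i
    change X i - emb (F.ext (F.cut q (X i))) ∈ _
    induction i using Fin.lastCases with
    | last =>
      change X 3 - emb (F.ext (F.cut q (X 3))) ∈ _
      have h1 : emb q - emb (F.ext (F.res q)) ∈ F.curveIdeal q := by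
        have h2 : aeval (fun i => emb (X i) : Fin 3 → MvPolynomial (Fin 4) M) q -
            aeval (fun i => emb (F.ext (F.res (X i))) : Fin 3 → MvPolynomial (Fin 4) M) q ∈
              F.curveIdeal q := aeval_sub_aeval_mem hi q
        have h3 := aeval_apply_X (emb.comp (F.ext.comp F.res)) q
        simp only [AlgHom.comp_apply] at h3
        rwa [aeval_apply_X emb, h3] at h2
      rw [cut_X]
      convert Ideal.add_mem _ hw h1 using 1
      ring
    | cast i =>
      rw [X_castSucc, cut_emb]
      exact hi i

instance curveIdeal_isPrime (q : MvPolynomial (Fin 3) M) : (F.curveIdeal q).IsPrime := by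
  rw [← ker_cut]; exact RingHom.ker_isPrime _

theorem mem_curveIdeal {q : MvPolynomial (Fin 3) M} {A : MvPolynomial (Fin 4) M} :
    A ∈ F.curveIdeal q ↔ F.cut q A = 0 := by
  rw [← ker_cut, RingHom.mem_ker]

theorem isHomogeneousIdeal_curveIdeal {q : MvPolynomial (Fin 3) M} (hq : q.IsHomogeneous 2) :
    IsHomogeneousIdeal (F.curveIdeal q) := by
  refine isHomogeneousIdeal_span ?_
  rintro A (rfl | rfl)
  · exact ⟨1, isWeightedHomogeneous_emb (isHomogeneous_lin _)⟩
  · exact ⟨2, (isWeightedHomogeneous_X M wt 3).sub (isWeightedHomogeneous_emb hq)⟩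

/-- The point `(p, q(p))`. -/
def pt (q : MvPolynomial (Fin 3) M) : Fin 4 → M :=
  Fin.snoc (α := fun _ => M) F.p (eval F.p q)

@[simp] theorem pt_castSucc (q : MvPolynomial (Fin 3) M) (i : Fin 3) :
    F.pt q i.castSucc = F.p i := by simp [pt]

@[simp] theorem pt_three (q : MvPolynomial (Fin 3) M) : F.pt q 3 = eval F.p q :=
  Fin.snoc_last (α := fun _ => M) _ _

theorem eval_pt_emb (q A : MvPolynomial (Fin 3) M) : eval (F.pt q) (emb A) = eval F.p A := by
  rw [emb, eval_rename]
  congr 2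
  funext i; simp

theorem exists_pt_ne_zero (q : MvPolynomial (Fin 3) M) : ∃ i : Fin 3, F.pt q i.castSucc ≠ 0 := by
  simpa using F.exists_p_ne_zero

theorem eval_pt_eq (q : MvPolynomial (Fin 3) M) (A : MvPolynomial (Fin 4) M) :
    eval (F.pt q) A = eval ![0, 1] (F.cut q A) := by
  have : aeval (F.pt q) = (aeval (![0, 1] : Fin 2 → M)).comp (F.cut q) := by
    ext i
    induction i using Fin.lastCases with
    | last =>
      change aeval (F.pt q) (X 3) = aeval ![0, 1] (F.cut q (X 3))
      rw [cut_X, aeval_res, aeval_X, pt_three]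
      simp [aeval_eq_eval]
    | cast i =>
      rw [AlgHom.comp_apply, X_castSucc, cut_emb, aeval_res]
      simp
  exact DFunLike.congr_fun this A

theorem curveIdeal_le_pointIdeal {q : MvPolynomial (Fin 3) M} (hq : q.IsHomogeneous 2) :
    F.curveIdeal q ≤ pointIdeal (F.pt q) := by
  rw [le_pointIdeal_iff (F.isHomogeneousIdeal_curveIdeal hq)]
  intro A hA
  rw [eval_pt_eq, F.mem_curveIdeal.mp hA, map_zero]

theorem pointIdeal_pt {q : MvPolynomial (Fin 3) M} (hq : q.IsHomogeneous 2) :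
    pointIdeal (F.pt q) = F.curveIdeal q ⊔ Ideal.span {emb (lin F.u)} := by
  set J := F.curveIdeal q ⊔ Ideal.span {emb (lin F.u)}
  have hl : emb (lin F.l) ∈ J := Ideal.mem_sup_left (Ideal.subset_span (by simp))
  have hw : X 3 - emb q ∈ J := Ideal.mem_sup_left (Ideal.subset_span (by simp))
  have hu : emb (lin F.u) ∈ J := Ideal.mem_sup_right (Ideal.mem_span_singleton_self _)
  have hle : J ≤ pointIdeal (F.pt q) := by
    refine sup_le (F.curveIdeal_le_pointIdeal hq) ?_
    rw [Ideal.span_singleton_le_iff_mem, mem_pointIdeal_of_isWeightedHomogeneous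
      (isWeightedHomogeneous_emb (isHomogeneous_lin _)), eval_pt_emb, eval_lin, u_p]
  have hi : ∀ i, emb (X i) - algebraMap M _ (F.p i) * emb (lin F.v) ∈ J := by
    intro i
    have : emb (X i) - algebraMap M _ (F.p i) * emb (lin F.v) =
        C (F.s i) * emb (lin F.u) + C (F.m i) * emb (lin F.l) := by
      rw [F.X_eq i, map_add, map_add, map_mul, map_mul, map_mul, algebraMap_eq]
      simp only [emb, rename_C]
      ring
    rw [this]
    exact J.add_mem (J.mul_mem_left _ hu) (J.mul_mem_left _ hl)
  have hq' : emb q - algebraMap M _ (eval F.p q) * emb (lin F.v) ^ 2 ∈ J := by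
    have h2 := aeval_sub_aeval_mem hi q
    rw [aeval_apply_X emb] at h2
    convert h2 using 2
    simp_rw [mul_comm _ (emb (lin F.v))]
    rw [hq.aeval_smul', mul_comm]
    congr 1
    exact (aeval_algebraMap_apply (MvPolynomial (Fin 4) M) F.p q).symm
  refine ker_eq_of_section
    (aeval (fun i => Polynomial.C (F.pt q i) * Polynomial.X ^ wt i) :
      MvPolynomial (Fin 4) M →ₐ[M] Polynomial M).toRingHom
    (Polynomial.aeval (emb (lin F.v)) : Polynomial M →ₐ[M] _).toRingHom hle ?_ ?_
  · intro c
    change Polynomial.aeval _ (aeval _ (C c)) = C c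
    rw [← algebraMap_eq, AlgHom.commutes, AlgHom.commutes]
  · intro i
    change X i - Polynomial.aeval _ (aeval _ (X i)) ∈ J
    rw [aeval_X, map_mul, map_pow, Polynomial.aeval_X, Polynomial.aeval_C]
    induction i using Fin.lastCases with
    | last =>
      change X 3 - algebraMap M _ (F.pt q 3) * emb (lin F.v) ^ 2 ∈ J
      rw [pt_three]
      convert J.add_mem hw hq' using 1
      ring
    | cast i =>
      rw [wt_castSucc, pt_castSucc, X_castSucc, pow_one]
      exact hi i

end Frame

end Frame

/-! ### The curve of genus one above a line -/

section Fibre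

variable {M : Type*} [Field M]

theorem surfacePoly_eq (f g q : MvPolynomial (Fin 3) M) :
    surfacePoly f g = (X 3 - emb q) * (X 3 + emb f + emb q) + emb (q ^ 2 + f * q - g) := by
  simp only [surfacePoly, map_add, map_sub, map_mul, map_pow]
  ring

theorem isWeightedHomogeneous_surfacePoly {f g : MvPolynomial (Fin 3) M} (hf : f.IsHomogeneous 2)
    (hg : g.IsHomogeneous 4) : IsWeightedHomogeneous wt (surfacePoly f g) 4 := by
  have h3 : IsWeightedHomogeneous wt (X 3 : MvPolynomial (Fin 4) M) 2 :=
    isWeightedHomogeneous_X M wt 3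
  exact ((h3.pow 2).add ((isWeightedHomogeneous_emb hf).mul h3)).sub (isWeightedHomogeneous_emb hg)

namespace Frame

variable (F : Frame M)

/-- The homogeneous ideal of the part of the surface `w² + f w = g` above the line. -/
def fibre (f g : MvPolynomial (Fin 3) M) : Ideal (MvPolynomial (Fin 4) M) :=
  Ideal.span {surfacePoly f g, emb (lin F.l)}

theorem surfacePoly_mem_fibre (f g : MvPolynomial (Fin 3) M) : surfacePoly f g ∈ F.fibre f g :=
  Ideal.subset_span (by simp)

theorem l_mem_fibre (f g : MvPolynomial (Fin 3) M) : emb (lin F.l) ∈ F.fibre f g :=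
  Ideal.subset_span (by simp)

theorem isHomogeneousIdeal_fibre {f g : MvPolynomial (Fin 3) M} (hf : f.IsHomogeneous 2)
    (hg : g.IsHomogeneous 4) : IsHomogeneousIdeal (F.fibre f g) := by
  refine isHomogeneousIdeal_span ?_
  rintro A (rfl | rfl)
  · exact ⟨4, isWeightedHomogeneous_surfacePoly hf hg⟩
  · exact ⟨1, isWeightedHomogeneous_emb (isHomogeneous_lin _)⟩

/-- Restriction to the preimage of the line in `P(1,1,1,2)`; the result is regarded as a polynomial
in `w` whose coefficients are polynomials on the line. -/
def toPoly : MvPolynomial (Fin 4) M →ₐ[M] Polynomial (MvPolynomial (Fin 2) M) :=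
  aeval (Fin.snoc (α := fun _ => Polynomial (MvPolynomial (Fin 2) M))
    (fun i => Polynomial.C (F.res (X i))) Polynomial.X)

@[simp] theorem toPoly_X : F.toPoly (X 3) = Polynomial.X := by
  rw [toPoly, aeval_X]; exact Fin.snoc_last _ _

@[simp] theorem toPoly_emb (A : MvPolynomial (Fin 3) M) :
    F.toPoly (emb A) = Polynomial.C (F.res A) := by
  have h := aeval_apply_X (F.toPoly.comp emb) A
  rw [AlgHom.comp_apply] at h
  rw [← h]
  have h2 := aeval_apply_X ((IsScalarTower.toAlgHom M (MvPolynomial (Fin 2) M)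
    (Polynomial (MvPolynomial (Fin 2) M))).comp F.res) A
  refine Eq.trans ?_ h2
  congr 2
  funext i
  rw [AlgHom.comp_apply, emb, rename_X, toPoly, aeval_X]
  exact Fin.snoc_castSucc (α := fun _ => Polynomial (MvPolynomial (Fin 2) M)) _ _ _

theorem toPoly_surjective : Function.Surjective F.toPoly := by
  intro A
  induction A using Polynomial.induction_on' with
  | add p r hp hr =>
    obtain ⟨a, rfl⟩ := hp
    obtain ⟨b, rfl⟩ := hr
    exact ⟨a + b, map_add _ _ _⟩
  | monomial n a =>
    refine ⟨emb (F.ext a) * X 3 ^ n, ?_⟩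
    rw [map_mul, map_pow, toPoly_emb, toPoly_X, res_ext, Polynomial.C_mul_X_pow_eq_monomial]

theorem ker_toPoly : RingHom.ker F.toPoly = Ideal.span {emb (lin F.l)} := by
  refine ker_eq_of_section F.toPoly.toRingHom
    (Polynomial.eval₂RingHom (emb.comp F.ext : _ →ₐ[M] MvPolynomial (Fin 4) M).toRingHom (X 3))
    ?_ ?_ ?_
  · rw [Ideal.span_singleton_le_iff_mem, RingHom.mem_ker]
    change F.toPoly _ = 0
    simp
  · intro c
    have h : F.toPoly (C c) = Polynomial.C (C c) := by
      rw [← algebraMap_eq, AlgHom.commutes]; rfl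
    change Polynomial.eval₂ _ _ (F.toPoly (C c)) = _
    rw [h, Polynomial.eval₂_C]
    change (emb.comp F.ext) (C c) = _
    rw [← algebraMap_eq, AlgHom.commutes]; rfl
  · intro i
    induction i using Fin.lastCases with
    | last =>
      change X 3 - Polynomial.eval₂ _ _ (F.toPoly (X 3)) ∈ _
      rw [toPoly_X, Polynomial.eval₂_X, sub_self]
      exact Ideal.zero_mem _
    | cast i =>
      change X i.castSucc - Polynomial.eval₂ _ _ (F.toPoly (X i.castSucc)) ∈ _
      rw [X_castSucc, toPoly_emb, Polynomial.eval₂_C]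
      change emb (X i) - emb (F.ext (F.res (X i))) ∈ _
      rw [← map_sub, X_sub_ext_res, map_mul]
      exact Ideal.mul_mem_left _ _ (Ideal.mem_span_singleton_self _)

/-- The equation of the curve above the line. -/
def fibrePoly (f g : MvPolynomial (Fin 3) M) : Polynomial (MvPolynomial (Fin 2) M) :=
  Polynomial.X ^ 2 + Polynomial.C (F.res f) * Polynomial.X - Polynomial.C (F.res g)

theorem toPoly_surfacePoly (f g : MvPolynomial (Fin 3) M) :
    F.toPoly (surfacePoly f g) = F.fibrePoly f g := by
  rw [surfacePoly, fibrePoly, map_sub, map_add, map_mul, map_pow, toPoly_emb, toPoly_X]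
  congr 1
  exact F.toPoly_emb g

theorem fibrePoly_eq (f g : MvPolynomial (Fin 3) M) : F.fibrePoly f g =
    Polynomial.X ^ 2 + (Polynomial.C (F.res f) * Polynomial.X + Polynomial.C (-F.res g)) := by
  rw [fibrePoly, Polynomial.C_neg]; ring

theorem degree_fibrePoly_tail (f g : MvPolynomial (Fin 3) M) :
    (Polynomial.C (F.res f) * Polynomial.X + Polynomial.C (-F.res g)).degree <
      ((2 : ℕ) : WithBot ℕ) :=
  lt_of_le_of_lt Polynomial.degree_linear_le (by norm_num)

theorem monic_fibrePoly (f g : MvPolynomial (Fin 3) M) : (F.fibrePoly f g).Monic := by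
  rw [fibrePoly_eq]
  exact Polynomial.monic_X_pow_add (F.degree_fibrePoly_tail f g)

theorem natDegree_fibrePoly (f g : MvPolynomial (Fin 3) M) : (F.fibrePoly f g).natDegree = 2 := by
  rw [fibrePoly_eq]
  rw [Polynomial.natDegree_add_eq_left_of_degree_lt, Polynomial.natDegree_X_pow]
  rw [Polynomial.degree_X_pow]
  exact F.degree_fibrePoly_tail f g

theorem mem_fibre {f g : MvPolynomial (Fin 3) M} {A : MvPolynomial (Fin 4) M} :
    A ∈ F.fibre f g ↔ F.fibrePoly f g ∣ F.toPoly A := by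
  constructor
  · intro h
    rw [fibre, Ideal.mem_span_pair] at h
    obtain ⟨a, b, rfl⟩ := h
    rw [map_add, map_mul, map_mul, toPoly_surfacePoly, toPoly_emb, res_l, Polynomial.C_0, mul_zero,
      add_zero]
    exact dvd_mul_left _ _
  · rintro ⟨c, hc⟩
    obtain ⟨a, rfl⟩ := F.toPoly_surjective c
    have h : A - surfacePoly f g * a ∈ Ideal.span {emb (lin F.l)} := by
      rw [← ker_toPoly, RingHom.mem_ker, map_sub, map_mul, toPoly_surfacePoly, hc, sub_self]
    have h2 := Ideal.add_mem _
      ((Ideal.span_singleton_le_iff_mem _).mpr (F.l_mem_fibre f g) h)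
      (Ideal.mul_mem_right a _ (F.surfacePoly_mem_fibre f g))
    simpa using h2

/-! ### Quadratic sections which osculate the curve -/

/-- The section `w = q` meets the curve `w² + f w = g` above the line with multiplicity at least `3`
at the point `(p, q(p))`, at which the curve is unramified over the line. -/
structure Osculates (f g q : MvPolynomial (Fin 3) M) : Prop where
  hf : f.IsHomogeneous 2
  hg : g.IsHomogeneous 4
  hq : q.IsHomogeneous 2
  ne : eval F.p (f + 2 * q) ≠ 0
  dvd : X 0 ^ 3 ∣ F.res (q ^ 2 + f * q - g)

variable {F} {f g q : MvPolynomial (Fin 3) M}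

theorem prime_X (i : Fin 2) : Prime (X i : MvPolynomial (Fin 2) M) :=
  MvPolynomial.X_prime

theorem eval_res_zero_one (A : MvPolynomial (Fin 3) M) : eval ![0, 1] (F.res A) = eval F.p A := by
  have := F.aeval_res (![0, 1] : Fin 2 → M) A
  simpa using this

theorem eq_zero_of_X_pow_dvd {A : MvPolynomial (Fin 2) M} {n m : ℕ} (h : X 0 ^ n ∣ A)
    (hA : A.totalDegree ≤ m) (hm : m < n) : A = 0 := by
  obtain ⟨b, rfl⟩ := h
  by_contra h0
  rw [totalDegree_mul_of_isDomain (left_ne_zero_of_mul h0) (right_ne_zero_of_mul h0),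
    totalDegree_X_pow] at hA
  omega

namespace Osculates

theorem X_not_dvd (h : F.Osculates f g q) : ¬ X 0 ∣ F.res (f + 2 * q) := by
  rintro ⟨b, hb⟩
  apply h.ne
  rw [← eval_res_zero_one, hb]
  simp

theorem totalDegree_root_le (h : F.Osculates f g q) {r : MvPolynomial (Fin 2) M}
    (hr : r ^ 2 + F.res f * r - F.res g = 0) : r.totalDegree ≤ 2 := by
  by_contra! hlt
  have hf := (F.isHomogeneous_res h.hf).totalDegree_le
  have hg := (F.isHomogeneous_res h.hg).totalDegree_le
  have h1 : (r + F.res f).totalDegree = r.totalDegree :=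
    totalDegree_add_eq_left_of_totalDegree_lt (by omega)
  have hr0 : r ≠ 0 := by rintro rfl; simp at hlt
  have hr1 : r + F.res f ≠ 0 := by intro h0; rw [h0] at h1; simp at h1; omega
  have h2 : r * (r + F.res f) = F.res g := by linear_combination hr
  have h3 := totalDegree_mul_of_isDomain hr0 hr1
  rw [h2, h1] at h3
  omega

theorem root_eq_of_dvd (h : F.Osculates f g q) {r : MvPolynomial (Fin 2) M}
    (hr : r ^ 2 + F.res f * r - F.res g = 0) (hd : X 0 ∣ r - F.res q) : r = F.res q := by
  have h2 : X 0 ^ 3 ∣ (r - F.res q) * (r + F.res q + F.res f) := by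
    have h3 : (r - F.res q) * (r + F.res q + F.res f) = -F.res (q ^ 2 + f * q - g) := by
      simp only [map_sub, map_add, map_mul, map_pow]
      linear_combination hr
    rw [h3]
    exact h.dvd.neg_right
  have h4 : ¬ X 0 ∣ r + F.res q + F.res f := by
    intro h5
    apply h.X_not_dvd
    have := h5.sub hd
    rw [map_add, map_mul, map_ofNat]
    convert this using 1
    ring
  have h5 := (prime_X 0).pow_dvd_of_dvd_mul_right 3 h4 h2
  refine sub_eq_zero.mp (eq_zero_of_X_pow_dvd h5 (m := 2) ?_ (by norm_num))
  refine (totalDegree_sub _ _).trans (max_le (h.totalDegree_root_le hr) ?_)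
  exact (F.isHomogeneous_res h.hq).totalDegree_le

theorem root_eq (h : F.Osculates f g q) {r : MvPolynomial (Fin 2) M}
    (hr : r ^ 2 + F.res f * r - F.res g = 0) : r = F.res q ∨ r = - F.res f - F.res q := by
  have h2 : X 0 ∣ (r - F.res q) * (r + F.res q + F.res f) := by
    have h3 : (r - F.res q) * (r + F.res q + F.res f) = -F.res (q ^ 2 + f * q - g) := by
      simp only [map_sub, map_add, map_mul, map_pow]
      linear_combination hr
    rw [h3]
    exact ((dvd_pow_self _ (by norm_num)).trans h.dvd).neg_right
  rcases (prime_X 0).dvd_or_dvd h2 with hd | hd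
  · exact Or.inl (h.root_eq_of_dvd hr hd)
  · right
    have h4 := h.root_eq_of_dvd (r := - F.res f - r) (by linear_combination hr) (by
      rw [← dvd_neg]; convert hd using 1; ring)
    linear_combination -h4

theorem res_eq_zero_of_root (h : F.Osculates f g q) {r : MvPolynomial (Fin 2) M}
    (hr : r ^ 2 + F.res f * r - F.res g = 0) : F.res (q ^ 2 + f * q - g) = 0 := by
  simp only [map_sub, map_add, map_mul, map_pow]
  rcases h.root_eq hr with rfl | rfl <;> linear_combination hr

/-- The curve above the line is irreducible, unless it contains the section `w = q`. -/
theorem irreducible_fibrePoly (h : F.Osculates f g q) (h0 : F.res (q ^ 2 + f * q - g) ≠ 0) :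
    Irreducible (F.fibrePoly f g) := by
  rw [(F.monic_fibrePoly f g).irreducible_iff_roots_eq_zero_of_degree_le_three
    (F.natDegree_fibrePoly f g).ge (by rw [F.natDegree_fibrePoly f g]; norm_num)]
  by_contra hne
  obtain ⟨r, hr⟩ := Multiset.exists_mem_of_ne_zero hne
  have := (Polynomial.mem_roots'.mp hr).2
  rw [Polynomial.IsRoot.def, fibrePoly] at this
  exact h0 (h.res_eq_zero_of_root (r := r) (by simpa using this))

theorem fibre_isPrime (h : F.Osculates f g q) (h0 : F.res (q ^ 2 + f * q - g) ≠ 0) :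
    (F.fibre f g).IsPrime := by
  have hp : Prime (F.fibrePoly f g) := (h.irreducible_fibrePoly h0).prime
  have h1 : F.fibre f g = (Ideal.span {F.fibrePoly f g}).comap F.toPoly := by
    ext A
    rw [mem_fibre, Ideal.mem_comap, Ideal.mem_span_singleton]
  have := (Ideal.span_singleton_prime hp.ne_zero).mpr hp
  rw [h1]
  exact Ideal.comap_isPrime _ _

end Osculates

theorem emb_notMem_fibre {A : MvPolynomial (Fin 3) M} (hA : F.res A ≠ 0) :
    emb A ∉ F.fibre f g := by
  rw [mem_fibre, toPoly_emb]
  intro hd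
  have := Polynomial.natDegree_le_of_dvd hd (by simpa using hA)
  rw [natDegree_fibrePoly, Polynomial.natDegree_C] at this
  omega

theorem X_sub_notMem_fibre (a : MvPolynomial (Fin 3) M) : X 3 - emb a ∉ F.fibre f g := by
  rw [mem_fibre, map_sub, toPoly_emb, toPoly_X]
  intro hd
  have := Polynomial.natDegree_le_of_dvd hd (Polynomial.X_sub_C_ne_zero _)
  rw [natDegree_fibrePoly, Polynomial.natDegree_X_sub_C] at this
  omega

/-! ### Divisors on the curve -/

theorem sup_span_eq_of_sub_mem {R : Type*} [CommRing R] {J : Ideal R} {a b : R} (h : a - b ∈ J) :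
    J ⊔ Ideal.span {a} = J ⊔ Ideal.span {b} := by
  have hle : ∀ {a b : R}, a - b ∈ J → J ⊔ Ideal.span {a} ≤ J ⊔ Ideal.span {b} := by
    intro a b h
    refine sup_le le_sup_left ?_
    rw [Ideal.span_singleton_le_iff_mem, ← sub_add_cancel a b]
    exact Ideal.add_mem _ (le_sup_left (a := J) h)
      (le_sup_right (a := J) (Ideal.mem_span_singleton_self b))
  exact le_antisymm (hle h) (hle (by rw [← neg_sub]; exact J.neg_mem h))

theorem fibre_sup_cut (F : Frame M) (f g q : MvPolynomial (Fin 3) M) :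
    F.fibre f g ⊔ Ideal.span {X 3 - emb q} =
      F.curveIdeal q ⊔ Ideal.span {emb (q ^ 2 + f * q - g)} := by
  have h1 : F.fibre f g = Ideal.span {emb (lin F.l)} ⊔ Ideal.span {surfacePoly f g} := by
    rw [fibre, Ideal.span_insert, sup_comm]
  rw [h1, sup_right_comm, ← Ideal.span_insert]
  refine sup_span_eq_of_sub_mem ?_
  rw [surfacePoly_eq f g q, add_sub_cancel_right]
  exact Ideal.mul_mem_right _ _ (Ideal.subset_span (by simp))

/-- The divisor of `w - q` on the curve above the line. -/
theorem mult_fibre_cut (hq : q.IsHomogeneous 2) {c₀ c₁ d₀ d₁ : M} (hd : d₁ * c₁ - d₀ * c₀ = 1)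
    (hΦ : F.res (q ^ 2 + f * q - g) = X 0 ^ 3 * (C c₁ * X 1 + C c₀ * X 0))
    (𝔭 : Ideal (MvPolynomial (Fin 4) M)) [𝔭.IsPrime] (h𝔭 : IsHomogeneousIdeal 𝔭)
    (hirr : ∃ i : Fin 3, X i.castSucc ∉ 𝔭) :
    mult (F.fibre f g ⊔ Ideal.span {X 3 - emb q}) 𝔭 =
      3 • pointDivisor (F.pt q) 𝔭 + pointDivisor ((F.rot c₀ c₁ d₀ d₁ hd).pt q) 𝔭 := by
  set F' := F.rot c₀ c₁ d₀ d₁ hd with hF'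
  have hu' : lin F'.u = C c₁ * lin F.v + C c₀ * lin F.u := by
    simp only [hF', rot, lin, Finset.mul_sum, ← Finset.sum_add_distrib, C_add, C_mul]
    exact Finset.sum_congr rfl fun i _ => by ring
  have hI : F'.curveIdeal q = F.curveIdeal q := rfl
  have h1 : emb (q ^ 2 + f * q - g) - emb (lin F.u) ^ 3 * emb (lin F'.u) ∈ F.curveIdeal q := by
    rw [mem_curveIdeal, map_sub, map_mul, map_pow, cut_emb, cut_emb, cut_emb, hΦ, hu', map_add,
      map_mul, map_mul, res_u, res_v, algHom_C, algHom_C]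
    simp [algebraMap_eq]
  have hnz : ∀ n y, emb (lin F.u) ^ n * y ∈ F.curveIdeal q → y ∈ F.curveIdeal q := by
    intro n y hy
    refine ((curveIdeal_isPrime F q).mem_or_mem hy).resolve_left fun h => ?_
    have h2 := (curveIdeal_isPrime F q).mem_of_pow_mem n h
    rw [mem_curveIdeal, cut_emb, res_u] at h2
    exact X_ne_zero _ h2
  rw [fibre_sup_cut, sup_span_eq_of_sub_mem h1, mult_sup_mul (hnz 3),
    mult_sup_pow (fun y hy => hnz 1 y (by simpa using hy)), ← pointIdeal_pt F hq, ← hI,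
    ← pointIdeal_pt F' hq]
  obtain ⟨i, hi⟩ := F.exists_pt_ne_zero q
  obtain ⟨j, hj⟩ := F'.exists_pt_ne_zero q
  rw [mult_pointIdeal_of_isHomogeneousIdeal hi h𝔭 hirr,
    mult_pointIdeal_of_isHomogeneousIdeal hj h𝔭 hirr]

/-- The ideal of the cone over the preimage of the point `p` is prime, as the kernel of a
parametrisation. -/
theorem ker_eq_span_l_u (F : Frame M) :
    RingHom.ker (aeval (Fin.snoc (α := fun _ => MvPolynomial (Fin 2) M)
      (fun i => C (F.p i) * X 0) (X 1)) : MvPolynomial (Fin 4) M →ₐ[M] MvPolynomial (Fin 2) M) =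
    Ideal.span {emb (lin F.l), emb (lin F.u)} := by
  set κ : MvPolynomial (Fin 4) M →ₐ[M] MvPolynomial (Fin 2) M :=
    aeval (Fin.snoc (α := fun _ => MvPolynomial (Fin 2) M) (fun i => C (F.p i) * X 0) (X 1))
  have hκ : ∀ i : Fin 3, κ (X i.castSucc) = C (F.p i) * X 0 := by
    intro i
    rw [aeval_X]
    exact Fin.snoc_castSucc (α := fun _ => MvPolynomial (Fin 2) M) _ _ _
  have hκl : ∀ a : Fin 3 → M, κ (emb (lin a)) = C (∑ i, a i * F.p i) * X 0 := by
    intro a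
    rw [emb_lin, map_sum, map_sum, Finset.sum_mul]
    refine Finset.sum_congr rfl fun i _ => ?_
    rw [map_mul, hκ, ← algebraMap_eq, AlgHom.commutes, C_mul, mul_assoc]; rfl
  refine ker_eq_of_section κ.toRingHom
    (aeval ![emb (lin F.v), X 3] : MvPolynomial (Fin 2) M →ₐ[M] MvPolynomial (Fin 4) M).toRingHom
    ?_ ?_ ?_
  · rw [Ideal.span_le]
    rintro A (rfl | rfl)
    · exact (hκl _).trans (by rw [l_p]; simp)
    · exact (hκl _).trans (by rw [u_p]; simp)
  · intro c
    change aeval _ (κ (C c)) = C c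
    rw [← algebraMap_eq, AlgHom.commutes, AlgHom.commutes]
  · intro i
    change X i - aeval _ (κ (X i)) ∈ _
    induction i using Fin.lastCases with
    | last =>
      have : κ (X (Fin.last 3)) = X 1 := by
        rw [aeval_X]; exact Fin.snoc_last (α := fun _ => MvPolynomial (Fin 2) M) _ _
      rw [this, aeval_X]
      change X 3 - X 3 ∈ _
      rw [sub_self]
      exact Ideal.zero_mem _
    | cast i =>
      rw [hκ, X_castSucc, F.X_eq i]
      simp only [map_add, map_mul, aeval_X, Matrix.cons_val_zero, emb, rename_C]
      rw [algHom_C, add_assoc, algebraMap_eq, add_sub_cancel_left]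
      exact Ideal.add_mem _ (Ideal.mul_mem_left _ _ (Ideal.subset_span (by simp)))
        (Ideal.mul_mem_left _ _ (Ideal.subset_span (by simp)))

theorem span_sup_X_sub (F : Frame M) (hq : q.IsHomogeneous 2) :
    Ideal.span {emb (lin F.l), emb (lin F.u)} ⊔ Ideal.span {X 3 - emb q} = pointIdeal (F.pt q) := by
  rw [pointIdeal_pt F hq, curveIdeal, Ideal.span_insert, Ideal.span_insert, sup_right_comm]

theorem emb_mem_span (F : Frame M) {A : MvPolynomial (Fin 3) M} (hA : X 0 ∣ F.res A) :
    emb A ∈ Ideal.span {emb (lin F.l), emb (lin F.u)} := by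
  obtain ⟨b, hb⟩ := hA
  rw [← ker_eq_span_l_u, RingHom.mem_ker]
  have h := aeval_apply_X ((aeval (Fin.snoc (α := fun _ => MvPolynomial (Fin 2) M)
      (fun i => C (F.p i) * X 0) (X 1)) : MvPolynomial (Fin 4) M →ₐ[M] _).comp emb) A
  rw [AlgHom.comp_apply] at h
  rw [← h]
  have h2 := F.aeval_res (![0, X 0] : Fin 2 → MvPolynomial (Fin 2) M) A
  rw [hb] at h2
  simp only [map_mul, aeval_X, Matrix.cons_val_zero, zero_mul] at h2
  rw [h2]
  congr 2
  funext i
  rw [AlgHom.comp_apply, emb, rename_X, aeval_X]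
  refine (Fin.snoc_castSucc (α := fun _ => MvPolynomial (Fin 2) M) _ _ _).trans ?_
  simp [algebraMap_eq]

theorem fibre_sup_u (F : Frame M) (hd : X 0 ∣ F.res (q ^ 2 + f * q - g)) :
    F.fibre f g ⊔ Ideal.span {emb (lin F.u)} = Ideal.span {emb (lin F.l), emb (lin F.u)} ⊔
      Ideal.span {(X 3 - emb q) * (X 3 - emb (-f - q))} := by
  have h1 : F.fibre f g = Ideal.span {emb (lin F.l)} ⊔ Ideal.span {surfacePoly f g} := by
    rw [fibre, Ideal.span_insert, sup_comm]
  rw [h1, sup_right_comm, ← Ideal.span_insert]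
  refine sup_span_eq_of_sub_mem ?_
  have : surfacePoly f g - (X 3 - emb q) * (X 3 - emb (-f - q)) = emb (q ^ 2 + f * q - g) := by
    rw [surfacePoly_eq f g q, map_sub emb (-f), map_neg]; ring
  rw [this]
  exact F.emb_mem_span hd

/-- The divisor of the linear form `u` on the curve above the line. -/
theorem Osculates.mult_fibre_u (h : F.Osculates f g q)
    (𝔭 : Ideal (MvPolynomial (Fin 4) M)) [𝔭.IsPrime] (h𝔭 : IsHomogeneousIdeal 𝔭)
    (hirr : ∃ i : Fin 3, X i.castSucc ∉ 𝔭) :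
    mult (F.fibre f g ⊔ Ideal.span {emb (lin F.u)}) 𝔭 =
      pointDivisor (F.pt q) 𝔭 + pointDivisor (F.pt (-f - q)) 𝔭 := by
  have hq' : (-f - q).IsHomogeneous 2 := h.hf.neg.sub h.hq
  rw [F.fibre_sup_u ((dvd_pow_self _ (by norm_num)).trans h.dvd), mult_sup_mul,
    F.span_sup_X_sub h.hq, F.span_sup_X_sub hq']
  · obtain ⟨i, hi⟩ := F.exists_pt_ne_zero q
    obtain ⟨j, hj⟩ := F.exists_pt_ne_zero (-f - q)
    rw [mult_pointIdeal_of_isHomogeneousIdeal hi h𝔭 hirr,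
      mult_pointIdeal_of_isHomogeneousIdeal hj h𝔭 hirr]
  · intro y hy
    have hpr : (Ideal.span {emb (lin F.l), emb (lin F.u)}).IsPrime := by
      rw [← ker_eq_span_l_u]; exact RingHom.ker_isPrime _
    refine (hpr.mem_or_mem hy).resolve_left fun hmem => ?_
    rw [← ker_eq_span_l_u, RingHom.mem_ker, map_sub] at hmem
    have h2 := congrArg (eval ![0, 1]) hmem
    have h3 : (aeval (Fin.snoc (α := fun _ => MvPolynomial (Fin 2) M)
      (fun i => C (F.p i) * X 0) (X 1)) : MvPolynomial (Fin 4) M →ₐ[M] _) (X 3) = X 1 := by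
        rw [aeval_X]; exact Fin.snoc_last (α := fun _ => MvPolynomial (Fin 2) M) _ _
    have h4 : eval ![0, 1] ((aeval (Fin.snoc (α := fun _ => MvPolynomial (Fin 2) M)
      (fun i => C (F.p i) * X 0) (X 1)) : MvPolynomial (Fin 4) M →ₐ[M] MvPolynomial (Fin 2) M)
        (emb q)) = 0 := by
      rw [emb, aeval_rename]
      have : (Fin.snoc (α := fun _ => MvPolynomial (Fin 2) M) (fun i => C (F.p i) * X 0) (X 1)) ∘
        Fin.castSucc = fun i => X 0 * C (F.p i) := by
          funext i; simp [mul_comm]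
      rw [this, h.hq.aeval_smul']
      simp
    rw [map_sub, h3, h4] at h2
    simp at h2

end Frame

end Fibre

/-! ### Ideals generated by one element on the cone over the curve -/

section QuadraticExtension

variable {P : Type*} [CommRing P] [IsDomain P]

theorem dvd_of_dvd_pow_mul {x y n e : P} (hx : Prime x) (hxy : ¬ x ∣ y) {N : ℕ}
    (h1 : n ∣ x ^ N * e) (h2 : n ∣ y ^ N * e) : n ∣ e := by
  by_cases hn : n = 0
  · subst hn
    rw [zero_dvd_iff] at h1 ⊢
    exact (mul_eq_zero.mp h1).resolve_left (pow_ne_zero _ hx.ne_zero)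
  obtain ⟨c, hc⟩ := h1
  obtain ⟨c', hc'⟩ := h2
  have h3 : x ^ N ∣ y ^ N * c := by
    refine ⟨c', mul_left_cancel₀ hn ?_⟩
    linear_combination x ^ N * hc' - y ^ N * hc
  have h4 : ¬ x ∣ y ^ N := fun h => hxy (hx.dvd_of_dvd_pow h)
  obtain ⟨c'', hc''⟩ := hx.pow_dvd_of_dvd_mul_left N h4 h3
  refine ⟨c'', mul_left_cancel₀ (pow_ne_zero N hx.ne_zero) ?_⟩
  rw [hc, hc'']; ring

open Polynomial in
/-- Let `D = P[W] / (W² + c W + d)` be a domain. The `P`-module `D / B D` has depth at least `1`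
with respect to two coprime elements of `P`, because `D` is free over `P`; multiplication with the
conjugate of `B` replaces `B` by its norm, an element of `P`. -/
theorem mem_span_pair_of_pow_mul_mem {c d : P}
    (hF : Prime (Polynomial.X ^ 2 + Polynomial.C c * Polynomial.X + Polynomial.C d))
    {B E : Polynomial P}
    (hB : ¬ (Polynomial.X ^ 2 + Polynomial.C c * Polynomial.X + Polynomial.C d) ∣ B) {x y : P}
    (hx : Prime x) (hxy : ¬ x ∣ y) {N : ℕ}
    (h1 : Polynomial.C (x ^ N) * E ∈ Ideal.span
      {B, Polynomial.X ^ 2 + Polynomial.C c * Polynomial.X + Polynomial.C d})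
    (h2 : Polynomial.C (y ^ N) * E ∈ Ideal.span
      {B, Polynomial.X ^ 2 + Polynomial.C c * Polynomial.X + Polynomial.C d}) :
    E ∈ Ideal.span {B, Polynomial.X ^ 2 + Polynomial.C c * Polynomial.X + Polynomial.C d} := by
  set F : Polynomial P := Polynomial.X ^ 2 + Polynomial.C c * Polynomial.X + Polynomial.C d with hFd
  have hFe : F = Polynomial.X ^ 2 + (Polynomial.C c * Polynomial.X + Polynomial.C d) := by
    rw [hFd]; ring
  have hdeg : (Polynomial.C c * Polynomial.X + Polynomial.C d).degree < ((2 : ℕ) : WithBot ℕ) :=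
    lt_of_le_of_lt Polynomial.degree_linear_le (by norm_num)
  have hmon : F.Monic := by rw [hFe]; exact Polynomial.monic_X_pow_add hdeg
  have hFdeg : F.natDegree = 2 := by
    rw [hFe, Polynomial.natDegree_add_eq_left_of_degree_lt, Polynomial.natDegree_X_pow]
    rw [Polynomial.degree_X_pow]
    exact hdeg
  have hlin : ∀ A : Polynomial P, ∃ a b : P,
      F ∣ A - (Polynomial.C a + Polynomial.C b * Polynomial.X) := by
    intro A
    have hlt : (A %ₘ F).natDegree ≤ 1 := by
      have := Polynomial.natDegree_modByMonic_lt A hmon (by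
        intro h; rw [h] at hFdeg; simp at hFdeg)
      omega
    refine ⟨(A %ₘ F).coeff 0, (A %ₘ F).coeff 1, A /ₘ F, ?_⟩
    have h1 := Polynomial.modByMonic_add_div A F
    have h2 := Polynomial.eq_X_add_C_of_natDegree_le_one hlt
    linear_combination h2 - h1
  have hzero : ∀ a b : P, F ∣ Polynomial.C a + Polynomial.C b * Polynomial.X → a = 0 ∧ b = 0 := by
    intro a b h
    have h0 : Polynomial.C a + Polynomial.C b * Polynomial.X = 0 := by
      by_contra hne
      have h3 := Polynomial.natDegree_le_of_dvd h hne
      have h4 : (Polynomial.C a + Polynomial.C b * Polynomial.X).natDegree ≤ 1 := by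
        rw [add_comm]; exact Polynomial.natDegree_linear_le
      omega
    have ha := congrArg (Polynomial.coeff · 0) h0
    have hb := congrArg (Polynomial.coeff · 1) h0
    simp at ha hb
    exact ⟨ha, hb⟩
  obtain ⟨b0, b1, hb⟩ := hlin B
  -- the conjugate and the norm of `B`
  set B' : Polynomial P := Polynomial.C (b0 - b1 * c) + Polynomial.C (-b1) * Polynomial.X with hB'
  set n : P := b0 ^ 2 - b0 * b1 * c + b1 ^ 2 * d with hn
  have hBB' : F ∣ B * B' - Polynomial.C n := by
    have h3 : B * B' - Polynomial.C n =
        (B - (Polynomial.C b0 + Polynomial.C b1 * Polynomial.X)) * B' -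
          Polynomial.C (b1 ^ 2) * F := by
      rw [hB', hn, hFd]
      simp only [map_add, map_sub, map_mul, map_pow, map_neg]
      ring
    rw [h3]
    exact (hb.mul_right _).sub (dvd_mul_left _ _)
  have hB'0 : ¬ F ∣ B' := by
    intro h
    obtain ⟨h3, h4⟩ := hzero _ _ h
    have hb1 : b1 = 0 := neg_eq_zero.mp h4
    have hb0 : b0 = 0 := by simpa [hb1] using h3
    rw [hb0, hb1] at hb
    simp at hb
    exact hB hb
  have hn0 : n ≠ 0 := by
    intro h
    rw [h, map_zero, sub_zero] at hBB'
    exact (hF.dvd_or_dvd hBB').elim hB hB'0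
  obtain ⟨e0, e1, he⟩ := hlin (E * B')
  have key : ∀ z : P, Polynomial.C z * E ∈ Ideal.span {B, F} → n ∣ z * e0 ∧ n ∣ z * e1 := by
    intro z hz
    obtain ⟨p, r, hpr⟩ := Ideal.mem_span_pair.mp hz
    obtain ⟨p0, p1, hp⟩ := hlin p
    have h3 : F ∣
        Polynomial.C (z * e0 - n * p0) + Polynomial.C (z * e1 - n * p1) * Polynomial.X := by
      have h4 : Polynomial.C (z * e0 - n * p0) + Polynomial.C (z * e1 - n * p1) * Polynomial.X =
          p * (B * B' - Polynomial.C n) +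
          Polynomial.C n * (p - (Polynomial.C p0 + Polynomial.C p1 * Polynomial.X)) + r * B' * F -
          Polynomial.C z * (E * B' - (Polynomial.C e0 + Polynomial.C e1 * Polynomial.X)) := by
        simp only [map_sub, map_mul]
        linear_combination (-B') * hpr
      rw [h4]
      exact (((hBB'.mul_left _).add (hp.mul_left _)).add (dvd_mul_left _ _)).sub (he.mul_left _)
    obtain ⟨h5, h6⟩ := hzero _ _ h3
    exact ⟨⟨p0, sub_eq_zero.mp h5⟩, ⟨p1, sub_eq_zero.mp h6⟩⟩
  obtain ⟨a0, ha0⟩ := dvd_of_dvd_pow_mul hx hxy (key _ h1).1 (key _ h2).1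
  obtain ⟨a1, ha1⟩ := dvd_of_dvd_pow_mul hx hxy (key _ h1).2 (key _ h2).2
  have h3 : F ∣ B' * (E - B * (Polynomial.C a0 + Polynomial.C a1 * Polynomial.X)) := by
    have h4 : B' * (E - B * (Polynomial.C a0 + Polynomial.C a1 * Polynomial.X)) =
        (E * B' - (Polynomial.C e0 + Polynomial.C e1 * Polynomial.X)) -
        (B * B' - Polynomial.C n) * (Polynomial.C a0 + Polynomial.C a1 * Polynomial.X) := by
      rw [ha0, ha1]
      simp only [map_mul]
      ring
    rw [h4]
    exact he.sub (hBB'.mul_right _)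
  obtain ⟨t, ht⟩ := (hF.dvd_or_dvd h3).resolve_left hB'0
  exact Ideal.mem_span_pair.mpr ⟨Polynomial.C a0 + Polynomial.C a1 * Polynomial.X, t, by
    linear_combination -ht⟩

end QuadraticExtension

section Global

variable {M : Type*} [Field M]

theorem mul_component_mem {I : Ideal (MvPolynomial (Fin 4) M)} (hI : IsHomogeneousIdeal I)
    {A E : MvPolynomial (Fin 4) M} {e : ℕ} (hE : IsWeightedHomogeneous wt E e) (h : A * E ∈ I)
    (n : ℕ) : weightedHomogeneousComponent wt n A * E ∈ I := by
  have h1 := hI _ h (n + e)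
  rwa [weightedHomogeneousComponent_mul_right hE] at h1

/-- If `E ∈ I` holds locally on the weighted projective space away from `Ω`, then `E` is multiplied
into `I` by powers of linear forms. -/
theorem exists_pow_mul_mem {I : Ideal (MvPolynomial (Fin 4) M)} (hI : IsHomogeneousIdeal I)
    {E : MvPolynomial (Fin 4) M} {e : ℕ} (hE : IsWeightedHomogeneous wt E e)
    (hloc : ∀ (𝔭 : Ideal (MvPolynomial (Fin 4) M)) [𝔭.IsPrime], IsHomogeneousIdeal 𝔭 → I ≤ 𝔭 →
      (∃ i : Fin 3, X i.castSucc ∉ 𝔭) → ∃ s, s ∉ 𝔭 ∧ s * E ∈ I) (a b : Fin 3 → M) :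
    ∃ N, emb (lin a) ^ N * E ∈ I ∧ emb (lin b) ^ N * E ∈ I := by
  let 𝔠 : Ideal (MvPolynomial (Fin 4) M) :=
    Submodule.comap (LinearMap.mulRight (MvPolynomial (Fin 4) M) E) I
  have h𝔠 : ∀ y, y ∈ 𝔠 ↔ y * E ∈ I := fun y => Iff.rfl
  have hI𝔠 : I ≤ 𝔠 := fun y hy => (h𝔠 y).mpr (I.mul_mem_right _ hy)
  have hhom : IsHomogeneousIdeal 𝔠 := fun A hA n => mul_component_mem hI hE hA n
  have hX : ∀ i : Fin 3, X i.castSucc ∈ 𝔠.radical := by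
    intro i
    by_contra hi
    rw [Ideal.radical_eq_sInf, Submodule.mem_sInf] at hi
    push Not at hi
    obtain ⟨𝔮, ⟨h1, h2⟩, h3⟩ := hi
    let := weightedGradedAlgebra M wt
    let 𝔭 := (Ideal.homogeneousCore (weightedHomogeneousSubmodule M wt) 𝔮).toIdeal
    have hp : 𝔭.IsPrime := Ideal.IsPrime.homogeneousCore h2
    have hph : IsHomogeneousIdeal 𝔭 :=
      isHomogeneousIdeal_iff.mpr (HomogeneousIdeal.isHomogeneous _)
    have hle : 𝔭 ≤ 𝔮 := Ideal.toIdeal_homogeneousCore_le _ _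
    have hc : 𝔠 ≤ 𝔭 := hhom.le_of_forall fun A hA n hn =>
      Ideal.mem_homogeneousCore_of_homogeneous_of_mem ⟨n, hn⟩ (h1 hA)
    obtain ⟨s, hs, hsE⟩ := hloc 𝔭 hph (hI𝔠.trans hc) ⟨i, fun h => h3 (hle h)⟩
    exact hs (hc ((h𝔠 s).mpr hsE))
  have hlin : ∀ c : Fin 3 → M, emb (lin c) ∈ 𝔠.radical := by
    intro c
    rw [emb_lin]
    exact Ideal.sum_mem _ fun i _ => Ideal.mul_mem_left _ _ (hX i)
  obtain ⟨n, hn⟩ := hlin a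
  obtain ⟨m, hm⟩ := hlin b
  refine ⟨n + m, (h𝔠 _).mp ?_, (h𝔠 _).mp ?_⟩
  · rw [pow_add]; exact Ideal.mul_mem_right _ _ hn
  · rw [pow_add]; exact Ideal.mul_mem_left _ _ hm

namespace Frame

variable {F : Frame M} {f g q : MvPolynomial (Fin 3) M}

/-- On the curve above the line, local divisibility implies divisibility. -/
theorem Osculates.mem_of_locally_mem (h : F.Osculates f g q)
    (h0 : F.res (q ^ 2 + f * q - g) ≠ 0) {B E : MvPolynomial (Fin 4) M} {n e : ℕ}
    (hBw : IsWeightedHomogeneous wt B n) (hE : IsWeightedHomogeneous wt E e)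
    (hB : B ∉ F.fibre f g)
    (hloc : ∀ (𝔭 : Ideal (MvPolynomial (Fin 4) M)) [𝔭.IsPrime], IsHomogeneousIdeal 𝔭 →
      F.fibre f g ≤ 𝔭 → (∃ i : Fin 3, X i.castSucc ∉ 𝔭) →
      ∃ s, s ∉ 𝔭 ∧ s * E ∈ F.fibre f g ⊔ Ideal.span {B}) :
    E ∈ F.fibre f g ⊔ Ideal.span {B} := by
  have hsup : F.fibre f g ⊔ Ideal.span {B} =
      Ideal.span {B, surfacePoly f g} ⊔ RingHom.ker F.toPoly := by
    rw [ker_toPoly, fibre, Ideal.span_insert, Ideal.span_insert, sup_comm, ← sup_assoc]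
  have hI : IsHomogeneousIdeal (F.fibre f g ⊔ Ideal.span {B}) := by
    rw [fibre, ← Ideal.span_union]
    refine isHomogeneousIdeal_span ?_
    rintro A ((rfl | rfl) | rfl)
    · exact ⟨4, isWeightedHomogeneous_surfacePoly h.hf h.hg⟩
    · exact ⟨1, isWeightedHomogeneous_emb (isHomogeneous_lin _)⟩
    · exact ⟨n, hBw⟩
  obtain ⟨N, h1, h2⟩ := exists_pow_mul_mem hI hE
    (fun 𝔭 _ h𝔭 hle hirr => hloc 𝔭 h𝔭 (le_sup_left.trans hle) hirr) F.u F.v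
  have hmem : ∀ A, A ∈ F.fibre f g ⊔ Ideal.span {B} ↔
      F.toPoly A ∈ Ideal.span {F.toPoly B, F.fibrePoly f g} := by
    intro A
    have h3 : Ideal.span {F.toPoly B, F.fibrePoly f g} =
        (Ideal.span {B, surfacePoly f g}).map F.toPoly := by
      rw [Ideal.map_span, Set.image_pair, toPoly_surfacePoly]
    rw [hsup, h3, ← Ideal.mem_comap, Ideal.comap_map_of_surjective' _ F.toPoly_surjective]
  have hF : F.fibrePoly f g = Polynomial.X ^ 2 + Polynomial.C (F.res f) * Polynomial.X +
      Polynomial.C (-F.res g) := by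
    rw [fibrePoly, Polynomial.C_neg, sub_eq_add_neg]
  have hp : Prime (F.fibrePoly f g) := (h.irreducible_fibrePoly h0).prime
  rw [hmem, hF]
  rw [hmem, hF, map_mul, map_pow, toPoly_emb, res_u, ← Polynomial.C_pow] at h1
  rw [hmem, hF, map_mul, map_pow, toPoly_emb, res_v, ← Polynomial.C_pow] at h2
  rw [mem_fibre, hF] at hB
  rw [hF] at hp
  refine mem_span_pair_of_pow_mul_mem hp hB (prime_X 0) ?_ h1 h2
  rintro ⟨a, ha⟩
  have := congrArg (eval ![0, 1]) ha
  simp at this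

end Frame

end Global

/-! ### The residual point is determined by its linear equivalence class -/

section Rigidity

variable {M : Type*} [Field M]

theorem pointDivisor_congr {v v' : Fin 4 → M} (h : pointIdeal v = pointIdeal v')
    (𝔭 : Ideal (MvPolynomial (Fin 4) M)) : pointDivisor v 𝔭 = pointDivisor v' 𝔭 := by
  rw [pointDivisor, pointDivisor, h]

theorem pointDivisor_self (v : Fin 4 → M) : pointDivisor v (pointIdeal v) = 1 := if_pos rfl

theorem X_notMem_pointIdeal {v : Fin 4 → M} {i : Fin 3} (hi : v i.castSucc ≠ 0) :
    X i.castSucc ∉ pointIdeal v := fun h => hi (by simpa using eval_eq_zero_of_mem_pointIdeal h)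

namespace Frame

variable {F : Frame M} {f g q : MvPolynomial (Fin 3) M}

theorem isWeightedHomogeneous_cut (F : Frame M) (hq : q.IsHomogeneous 2)
    {A : MvPolynomial (Fin 4) M} {n : ℕ} (hA : IsWeightedHomogeneous wt A n) :
    (F.cut q A).IsHomogeneous n := by
  refine IsWeightedHomogeneous.aeval_weight (w' := 1) hA fun i => ?_
  induction i using Fin.lastCases with
  | last =>
    rw [Fin.snoc_last]
    exact F.isHomogeneous_res hq
  | cast i =>
    rw [Fin.snoc_castSucc, wt_castSucc]
    exact F.isHomogeneous_res (isHomogeneous_X _ _)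

theorem cut_surfacePoly (F : Frame M) (f g q : MvPolynomial (Fin 3) M) :
    F.cut q (surfacePoly f g) = F.res (q ^ 2 + f * q - g) := by
  rw [surfacePoly_eq f g q, map_add, map_mul, map_sub, cut_X, cut_emb, sub_self, zero_mul, zero_add,
    cut_emb]

theorem mem_pointIdeal_pt (F : Frame M) (hq : q.IsHomogeneous 2) {A : MvPolynomial (Fin 4) M} :
    A ∈ pointIdeal (F.pt q) ↔ X 0 ∣ F.cut q A := by
  rw [pointIdeal_pt F hq]
  constructor
  · intro h
    obtain ⟨y, hy, z, hz, rfl⟩ := Submodule.mem_sup.mp h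
    obtain ⟨c, rfl⟩ := Ideal.mem_span_singleton.mp hz
    rw [map_add, F.mem_curveIdeal.mp hy, zero_add, map_mul, cut_emb, res_u]
    exact dvd_mul_right _ _
  · rintro ⟨b, hb⟩
    have h1 : A - emb (lin F.u) * emb (F.ext b) ∈ F.curveIdeal q := by
      rw [mem_curveIdeal, map_sub, map_mul, cut_emb, cut_emb, res_u, res_ext, hb, sub_self]
    have := Ideal.add_mem _ (Ideal.mem_sup_left h1)
      (Ideal.mem_sup_right (Ideal.mul_mem_right (emb (F.ext b)) _
        (Ideal.mem_span_singleton_self (emb (lin F.u)))))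
    rwa [sub_add_cancel] at this

theorem fibre_le_pointIdeal_pt (F : Frame M) (hq : q.IsHomogeneous 2)
    (hd : X 0 ∣ F.res (q ^ 2 + f * q - g)) : F.fibre f g ≤ pointIdeal (F.pt q) := by
  rw [fibre, Ideal.span_le]
  rintro A (rfl | rfl)
  · exact (F.mem_pointIdeal_pt hq).mpr (by rwa [cut_surfacePoly])
  · exact (F.mem_pointIdeal_pt hq).mpr (by simp)

namespace Osculates

theorem pointIdeal_conj_ne (h : F.Osculates f g q) :
    pointIdeal (F.pt q) ≠ pointIdeal (F.pt (-f - q)) := by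
  intro heq
  obtain ⟨i, hi⟩ := F.exists_p_ne_zero
  have := mul_sq_eq_of_pointIdeal_le heq.le i
  simp only [pt_castSucc, pt_three, map_sub, map_neg] at this
  apply h.ne
  have h2 : F.p i ^ 2 * eval F.p (f + 2 * q) = 0 := by
    simp only [map_add, map_mul, map_ofNat]
    linear_combination -this
  exact (mul_eq_zero.mp h2).resolve_left (pow_ne_zero _ hi)

/-- On the curve above the line, let `R` be the residual point, so that `w - q` has the divisor
`3 P + R`. If `P + y` is linearly equivalent to `2 ι(P)`, then `y = R`. -/
theorem pointIdeal_eq_of_linearlyEquivalent (h : F.Osculates f g q)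
    {c₀ c₁ d₀ d₁ : M} (hd : d₁ * c₁ - d₀ * c₀ = 1)
    (hΦ : F.res (q ^ 2 + f * q - g) = X 0 ^ 3 * (C c₁ * X 1 + C c₀ * X 0))
    (h0 : F.res (q ^ 2 + f * q - g) ≠ 0)
    (hreg : ∀ (𝔭 : Ideal (MvPolynomial (Fin 4) M)) [𝔭.IsPrime], IsHomogeneousIdeal 𝔭 →
      F.fibre f g ≤ 𝔭 → (∃ i : Fin 3, X i.castSucc ∉ 𝔭) → IsLocPrincipal (F.fibre f g) 𝔭)
    {v₁ v₂ v₃ v₄ : Fin 4 → M} (h1 : pointIdeal v₁ = pointIdeal (F.pt q))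
    (h3 : pointIdeal v₃ = pointIdeal (F.pt (-f - q)))
    (h4 : pointIdeal v₄ = pointIdeal (F.pt (-f - q)))
    (hlin : LinearlyEquivalent (F.fibre f g) v₁ v₂ v₃ v₄) :
    pointIdeal v₂ = pointIdeal ((F.rot c₀ c₁ d₀ d₁ hd).pt q) := by
  obtain ⟨n, A, B, hAw, hBw, hA, hB, hdiv⟩ := hlin
  have hprime := h.fibre_isPrime h0
  have huw : IsWeightedHomogeneous wt (emb (lin F.u)) 1 :=
    isWeightedHomogeneous_emb (isHomogeneous_lin _)
  have hu : emb (lin F.u) ∉ F.fibre f g := emb_notMem_fibre (by rw [res_u]; exact X_ne_zero _)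
  have hnz : ∀ {y : MvPolynomial (Fin 4) M}, y ∉ F.fibre f g →
      ∀ z, y * z ∈ F.fibre f g → z ∈ F.fibre f g :=
    fun hy z hz => (hprime.mem_or_mem hz).resolve_left hy
  set E := A * emb (lin F.u) ^ 2 with hEd
  have hE : E ∉ F.fibre f g := fun hmem => hu (hprime.mem_of_pow_mem 2 (hnz hA _ hmem))
  have hEw : IsWeightedHomogeneous wt E (n + 2) := by simpa using hAw.mul (huw.pow 2)
  -- the divisor of `A u²`
  have hdivE : ∀ (𝔭 : Ideal (MvPolynomial (Fin 4) M)) [𝔭.IsPrime], IsHomogeneousIdeal 𝔭 →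
      F.fibre f g ≤ 𝔭 → (∃ i : Fin 3, X i.castSucc ∉ 𝔭) →
      mult (F.fibre f g ⊔ Ideal.span {E}) 𝔭 = mult (F.fibre f g ⊔ Ideal.span {B}) 𝔭 +
        (3 * pointDivisor (F.pt q) 𝔭 + pointDivisor v₂ 𝔭) := by
    intro 𝔭 _ h𝔭 hle hirr
    rw [mult_sup_mul (hnz hA), mult_sup_pow (hnz hu), h.mult_fibre_u 𝔭 h𝔭 hirr]
    have := hdiv 𝔭 h𝔭 hle hirr
    rw [pointDivisor_congr h1, pointDivisor_congr h3, pointDivisor_congr h4] at this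
    calc _ = mult (F.fibre f g ⊔ Ideal.span {A}) 𝔭 + pointDivisor (F.pt (-f - q)) 𝔭 +
          pointDivisor (F.pt (-f - q)) 𝔭 + 2 * pointDivisor (F.pt q) 𝔭 := by
            rw [two_nsmul]; ring
      _ = _ := by rw [this]; ring
  -- `A u²` is divisible by `B`
  have hEB : E ∈ F.fibre f g ⊔ Ideal.span {B} := by
    refine h.mem_of_locally_mem h0 hBw hEw hB fun 𝔭 _ h𝔭 hle hirr => ?_
    refine exists_mul_mem_of_mult_le (hreg 𝔭 h𝔭 hle hirr) hE ?_
    rw [hdivE 𝔭 h𝔭 hle hirr]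
    exact le_self_add
  obtain ⟨y, hy, z, hz, hyz⟩ := Submodule.mem_sup.mp hEB
  obtain ⟨C', rfl⟩ := Ideal.mem_span_singleton.mp hz
  set C₂ := weightedHomogeneousComponent wt 2 C'
  have hC₂w : IsWeightedHomogeneous wt C₂ 2 :=
    weightedHomogeneousComponent_isWeightedHomogeneous 2 C'
  have hEC : E - B * C₂ ∈ F.fibre f g := by
    have h5 : E - C' * B ∈ F.fibre f g := by
      rw [← hyz]; convert hy using 1; ring
    have h6 := F.isHomogeneousIdeal_fibre h.hf h.hg _ h5 (2 + n)
    rw [map_sub] at h6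
    rw [weightedHomogeneousComponent_mul_right hBw, add_comm 2 n,
      hEw.weightedHomogeneousComponent_same, mul_comm] at h6
    exact h6
  have hC₂ : C₂ ∉ F.fibre f g := by
    intro hmem
    apply hE
    have := Ideal.add_mem _ hEC (Ideal.mul_mem_left _ B hmem)
    rwa [sub_add_cancel] at this
  have hdivC : ∀ (𝔭 : Ideal (MvPolynomial (Fin 4) M)) [𝔭.IsPrime], IsHomogeneousIdeal 𝔭 →
      F.fibre f g ≤ 𝔭 → (∃ i : Fin 3, X i.castSucc ∉ 𝔭) →
      mult (F.fibre f g ⊔ Ideal.span {C₂}) 𝔭 =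
        3 * pointDivisor (F.pt q) 𝔭 + pointDivisor v₂ 𝔭 := by
    intro 𝔭 _ h𝔭 hle hirr
    have h5 := hdivE 𝔭 h𝔭 hle hirr
    rw [sup_span_eq_of_sub_mem hEC, mult_sup_mul (hnz hB)] at h5
    exact ENat.add_right_injective_of_ne_top (mult_ne_top (hreg 𝔭 h𝔭 hle hirr) hB) h5
  -- `C₂` vanishes to order at least `3` at `P`, so it vanishes on the curve `w = q`
  have hPle : F.fibre f g ≤ pointIdeal (F.pt q) :=
    F.fibre_le_pointIdeal_pt h.hq ((dvd_pow_self _ (by norm_num)).trans h.dvd)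
  have hPirr : ∃ i : Fin 3, X i.castSucc ∉ pointIdeal (F.pt q) := by
    obtain ⟨i, hi⟩ := F.exists_pt_ne_zero q
    exact ⟨i, X_notMem_pointIdeal hi⟩
  have hPhom := isHomogeneousIdeal_pointIdeal (F.pt q)
  obtain ⟨s, hs, hsC⟩ := exists_mul_mem_of_mult_le (a := emb (lin F.u) ^ 3)
    (hreg _ hPhom hPle hPirr) hC₂ (by
      rw [mult_sup_pow (hnz hu), h.mult_fibre_u _ hPhom hPirr, hdivC _ hPhom hPle hPirr,
        pointDivisor_self, pointDivisor, if_neg h.pointIdeal_conj_ne]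
      simp)
  have hcut : F.cut q C₂ = 0 := by
    have h5 : X 0 ^ 3 ∣ F.cut q s * F.cut q C₂ := by
      obtain ⟨y, hy, z, hz, hyz⟩ := Submodule.mem_sup.mp hsC
      obtain ⟨c, rfl⟩ := Ideal.mem_span_singleton.mp hz
      rw [← map_mul, ← hyz, map_add, map_mul, map_pow, cut_emb, res_u]
      refine dvd_add ?_ (dvd_mul_right _ _)
      rw [fibre, Ideal.mem_span_pair] at hy
      obtain ⟨a, b, rfl⟩ := hy
      rw [map_add, map_mul, map_mul, cut_surfacePoly, cut_emb, res_l, mul_zero, add_zero]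
      exact h.dvd.mul_left _
    have h6 : ¬ X 0 ∣ F.cut q s := fun h7 => hs ((F.mem_pointIdeal_pt h.hq).mpr h7)
    exact eq_zero_of_X_pow_dvd ((prime_X 0).pow_dvd_of_dvd_mul_left 3 h6 h5)
      (F.isWeightedHomogeneous_cut h.hq hC₂w).totalDegree_le (by norm_num)
  -- hence it is a multiple of `w - q` on the curve above the line
  obtain ⟨t, b, hb⟩ := Ideal.mem_span_pair.mp (F.mem_curveIdeal.mpr hcut)
  have hsup : F.fibre f g ⊔ Ideal.span {C₂} = F.fibre f g ⊔ Ideal.span {(X 3 - emb q) * b} := by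
    refine sup_span_eq_of_sub_mem ?_
    rw [← hb]
    convert Ideal.mul_mem_left _ t (F.l_mem_fibre f g) using 1
    ring
  set R := (F.rot c₀ c₁ d₀ d₁ hd).pt q
  have hRirr : ∃ i : Fin 3, X i.castSucc ∉ pointIdeal R := by
    obtain ⟨i, hi⟩ := (F.rot c₀ c₁ d₀ d₁ hd).exists_pt_ne_zero q
    exact ⟨i, X_notMem_pointIdeal hi⟩
  have hRhom := isHomogeneousIdeal_pointIdeal R
  have hcutR : mult (F.fibre f g ⊔ Ideal.span {X 3 - emb q}) (pointIdeal R) =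
      3 * pointDivisor (F.pt q) (pointIdeal R) + 1 := by
    rw [mult_fibre_cut h.hq hd hΦ _ hRhom hRirr, pointDivisor_self]
    simp
  have hRle : F.fibre f g ≤ pointIdeal R := by
    by_contra hle
    have h5 := mult_eq_zero (J := F.fibre f g ⊔ Ideal.span {X 3 - emb q}) (𝔭 := pointIdeal R)
      fun h6 => hle (le_sup_left.trans h6)
    rw [hcutR] at h5
    simp at h5
  have h5 := hdivC _ hRhom hRle hRirr
  rw [hsup, mult_sup_mul (hnz (X_sub_notMem_fibre q)), hcutR] at h5
  by_contra hne
  have h6 : pointDivisor v₂ (pointIdeal R) = 0 := if_neg fun h7 => hne h7.symm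
  rw [h6, add_assoc] at h5
  have h7 : 3 * pointDivisor (F.pt q) (pointIdeal R) ≠ ⊤ := by
    unfold pointDivisor
    split_ifs <;> simp
  have h8 := ENat.add_right_injective_of_ne_top h7 h5
  simp at h8

end Osculates

/-- `P + R` is linearly equivalent to `2 ι(P)`. -/
theorem Osculates.linearlyEquivalent (h : F.Osculates f g q)
    {c₀ c₁ d₀ d₁ : M} (hd : d₁ * c₁ - d₀ * c₀ = 1)
    (hΦ : F.res (q ^ 2 + f * q - g) = X 0 ^ 3 * (C c₁ * X 1 + C c₀ * X 0))
    (h0 : F.res (q ^ 2 + f * q - g) ≠ 0) {v₁ v₂ v₃ v₄ : Fin 4 → M}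
    (h1 : pointIdeal v₁ = pointIdeal (F.pt q))
    (h2 : pointIdeal v₂ = pointIdeal ((F.rot c₀ c₁ d₀ d₁ hd).pt q))
    (h3 : pointIdeal v₃ = pointIdeal (F.pt (-f - q)))
    (h4 : pointIdeal v₄ = pointIdeal (F.pt (-f - q))) :
    LinearlyEquivalent (F.fibre f g) v₁ v₂ v₃ v₄ := by
  have hprime := h.fibre_isPrime h0
  have huw : IsWeightedHomogeneous wt (emb (lin F.u)) 1 :=
    isWeightedHomogeneous_emb (isHomogeneous_lin _)
  have hu : emb (lin F.u) ∉ F.fibre f g := emb_notMem_fibre (by rw [res_u]; exact X_ne_zero _)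
  refine ⟨2, X 3 - emb q, emb (lin F.u) ^ 2,
    (isWeightedHomogeneous_X M wt 3).sub (isWeightedHomogeneous_emb h.hq), huw.pow 2,
    X_sub_notMem_fibre q, fun hm => hu (hprime.mem_of_pow_mem 2 hm), fun 𝔭 _ h𝔭 _ hirr => ?_⟩
  rw [mult_fibre_cut h.hq hd hΦ 𝔭 h𝔭 hirr,
    mult_sup_pow (fun z hz => (hprime.mem_or_mem hz).resolve_left hu), h.mult_fibre_u 𝔭 h𝔭 hirr,
    pointDivisor_congr h1, pointDivisor_congr h2, pointDivisor_congr h3, pointDivisor_congr h4]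
  simp only [nsmul_eq_mul]
  push_cast
  ring

end Frame

end Rigidity

/-! ### Regularity of the generic fibre -/

section TwoGenerators

/-- The elements that lie in `J` locally at `𝔮`. -/
def saturation {R : Type*} [CommRing R] (J 𝔮 : Ideal R) [h𝔮 : 𝔮.IsPrime] : Ideal R where
  carrier := {y | ∃ s, s ∉ 𝔮 ∧ s * y ∈ J}
  add_mem' := by
    rintro x y ⟨s, hs, hx⟩ ⟨t, ht, hy⟩
    refine ⟨s * t, fun h => (h𝔮.mem_or_mem h).elim hs ht, ?_⟩
    have : s * t * (x + y) = t * (s * x) + s * (t * y) := by ring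
    rw [this]
    exact J.add_mem (J.mul_mem_left _ hx) (J.mul_mem_left _ hy)
  zero_mem' := ⟨1, 𝔮.ne_top_iff_one.mp h𝔮.ne_top, by simp⟩
  smul_mem' := by
    rintro c x ⟨s, hs, hx⟩
    refine ⟨s, hs, ?_⟩
    rw [smul_eq_mul, mul_left_comm]
    exact J.mul_mem_left _ hx

theorem le_saturation {R : Type*} [CommRing R] (J 𝔮 : Ideal R) [h𝔮 : 𝔮.IsPrime] :
    J ≤ saturation J 𝔮 :=
  fun x hx => ⟨1, 𝔮.ne_top_iff_one.mp h𝔮.ne_top, by rwa [one_mul]⟩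

theorem mem_saturation_of_mul {R : Type*} [CommRing R] {J 𝔮 : Ideal R} [h𝔮 : 𝔮.IsPrime] {s y : R}
    (hs : s ∉ 𝔮) (h : s * y ∈ saturation J 𝔮) : y ∈ saturation J 𝔮 := by
  obtain ⟨t, ht, h⟩ := h
  exact ⟨t * s, fun h' => (h𝔮.mem_or_mem h').elim ht hs, by rwa [mul_assoc]⟩

/-- A prime ideal of a polynomial ring is locally generated by its contraction and one polynomial:
a polynomial in it of least degree among those with leading coefficient outside the contraction. -/
theorem exists_locally_generates {A : Type*} [CommRing A] [IsDomain A] (𝔮 : Ideal (Polynomial A))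
    [h𝔮 : 𝔮.IsPrime] : ∃ r ∈ 𝔮, 𝔮 ≤ saturation
      ((𝔮.comap Polynomial.C).map Polynomial.C ⊔ Ideal.span {r}) 𝔮 := by
  classical
  have key : ∀ r ∈ 𝔮, (∀ y ∈ 𝔮, Polynomial.C y.leadingCoeff ∉ 𝔮 →
      Polynomial.C r.leadingCoeff ∉ 𝔮 ∧ r.natDegree ≤ y.natDegree) → 𝔮 ≤ saturation
      ((𝔮.comap Polynomial.C).map Polynomial.C ⊔ Ideal.span {r}) 𝔮 := by
    intro r hr hmin
    set J := (𝔮.comap Polynomial.C).map Polynomial.C ⊔ Ideal.span {r}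
    suffices h : ∀ n : ℕ, ∀ y ∈ 𝔮, y.degree < n → y ∈ saturation J 𝔮 from
      fun y hy => h (y.natDegree + 1) y hy
        (lt_of_le_of_lt Polynomial.degree_le_natDegree (by exact_mod_cast Nat.lt_succ_self _))
    intro n
    induction n with
    | zero =>
      intro y _ hdeg
      have : y = 0 := by simpa [Nat.WithBot.lt_zero_iff] using hdeg
      rw [this]; exact Ideal.zero_mem _
    | succ n ih =>
      intro y hy hdeg
      by_cases h0 : y = 0
      · rw [h0]; exact Ideal.zero_mem _
      have hlt : ∀ z : Polynomial A, z.degree < y.degree → z.degree < n := fun z hz => by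
        rw [Polynomial.degree_eq_natDegree h0] at hz hdeg
        refine lt_of_lt_of_le hz ?_
        have := Nat.cast_lt.mp hdeg
        exact_mod_cast Nat.le_of_lt_succ this
      by_cases hlc : Polynomial.C y.leadingCoeff ∈ 𝔮
      · have h1 : Polynomial.C y.leadingCoeff * Polynomial.X ^ y.natDegree ∈
            (𝔮.comap Polynomial.C).map Polynomial.C :=
          Ideal.mul_mem_right _ _ (Ideal.mem_map_of_mem _ (Ideal.mem_comap.mpr hlc))
        rw [← Polynomial.eraseLead_add_C_mul_X_pow y]
        refine Ideal.add_mem _ (ih _ ?_ (hlt _ (Polynomial.degree_eraseLead_lt h0)))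
          (le_saturation _ _ (Ideal.mem_sup_left h1))
        rw [← Polynomial.self_sub_C_mul_X_pow]
        exact 𝔮.sub_mem hy (𝔮.mul_mem_right _ hlc)
      · obtain ⟨hrc, hle⟩ := hmin y hy hlc
        have hr0 : r ≠ 0 := by rintro rfl; simp at hrc
        refine mem_saturation_of_mul hrc ?_
        set z := Polynomial.C r.leadingCoeff * y -
          Polynomial.C y.leadingCoeff * Polynomial.X ^ (y.natDegree - r.natDegree) * r
        have hz : z.degree < y.degree := by
          have hl1 : r.leadingCoeff ≠ 0 := Polynomial.leadingCoeff_ne_zero.mpr hr0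
          have hl2 : y.leadingCoeff ≠ 0 := Polynomial.leadingCoeff_ne_zero.mpr h0
          have hd1 : (Polynomial.C r.leadingCoeff * y).degree = y.degree := by
            rw [Polynomial.degree_mul, Polynomial.degree_C hl1, zero_add]
          rw [← hd1]
          have hne : Polynomial.C r.leadingCoeff * y ≠ 0 :=
            mul_ne_zero (Polynomial.C_ne_zero.mpr hl1) h0
          refine Polynomial.degree_sub_lt_left ?_ hne ?_
          · rw [hd1, Polynomial.degree_mul, Polynomial.degree_mul, Polynomial.degree_C hl2,
              Polynomial.degree_X_pow, zero_add, Polynomial.degree_eq_natDegree hr0,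
              Polynomial.degree_eq_natDegree h0]
            exact_mod_cast (Nat.sub_add_cancel hle).symm
          · rw [Polynomial.leadingCoeff_mul, Polynomial.leadingCoeff_mul,
              Polynomial.leadingCoeff_mul,
              Polynomial.leadingCoeff_C, Polynomial.leadingCoeff_C, Polynomial.leadingCoeff_X_pow,
              mul_one, mul_comm]
        have hzmem : z ∈ 𝔮 := 𝔮.sub_mem (𝔮.mul_mem_left _ hy) (𝔮.mul_mem_left _ hr)
        have h1 := Ideal.add_mem _ (ih z hzmem (hlt _ hz)) (le_saturation J 𝔮
          (Ideal.mem_sup_right (Ideal.mul_mem_left _ (Polynomial.C y.leadingCoeff *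
            Polynomial.X ^ (y.natDegree - r.natDegree)) (Ideal.mem_span_singleton_self r))))
        rwa [sub_add_cancel] at h1
  by_cases hex : ∃ n, ∃ y ∈ 𝔮, Polynomial.C y.leadingCoeff ∉ 𝔮 ∧ y.natDegree = n
  · obtain ⟨r, hr, hlc, hdeg⟩ := Nat.find_spec hex
    exact ⟨r, hr, key r hr fun y hy hy' => ⟨hlc, hdeg ▸ Nat.find_min' hex ⟨y, hy, hy', rfl⟩⟩⟩
  · refine ⟨0, 𝔮.zero_mem, key 0 𝔮.zero_mem fun y hy hy' => (hex ⟨_, y, hy, hy', rfl⟩).elim⟩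

/-- A prime ideal of `A[Z][W]` that contains no nonzero constants is locally generated by two
elements. -/
theorem exists_locally_generates_two {A R : Type*} [CommRing A] [IsDomain A] [CommRing R]
    (θ : Polynomial (Polynomial A) →+* R) (hθ : Function.Surjective θ) (𝔮 : Ideal R)
    [h𝔮 : 𝔮.IsPrime] (h0 : ∀ a, θ (Polynomial.C (Polynomial.C a)) ∈ 𝔮 → a = 0) :
    ∃ r₁ ∈ 𝔮, ∃ r₂ ∈ 𝔮, 𝔮 ≤ saturation (Ideal.span {r₁, r₂}) 𝔮 := by
  obtain ⟨r₂, hr₂, h2⟩ := exists_locally_generates (𝔮.comap θ)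
  obtain ⟨r₁, hr₁, h1⟩ := exists_locally_generates ((𝔮.comap θ).comap Polynomial.C)
  have h3 : (((𝔮.comap θ).comap Polynomial.C).comap Polynomial.C) = (⊥ : Ideal A) :=
    le_bot_iff.mp fun a ha => h0 a ha
  rw [h3, Ideal.map_bot, bot_sup_eq] at h1
  refine ⟨θ (Polynomial.C r₁), hr₁, θ r₂, hr₂, fun y hy => ?_⟩
  set J := Ideal.span {θ (Polynomial.C r₁), θ r₂}
  obtain ⟨y, rfl⟩ := hθ y
  obtain ⟨s, hs, hsy⟩ := h2 (Ideal.mem_comap.mpr hy)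
  have h4 : Ideal.map Polynomial.C (Ideal.comap Polynomial.C (𝔮.comap θ)) ⊔ Ideal.span {r₂} ≤
      (saturation J 𝔮).comap θ := by
    refine sup_le (Ideal.map_le_iff_le_comap.mpr fun z hz => ?_) ?_
    · obtain ⟨t, ht, htz⟩ := h1 hz
      obtain ⟨c, hc⟩ := Ideal.mem_span_singleton.mp htz
      refine ⟨θ (Polynomial.C t), ht, ?_⟩
      rw [← map_mul, ← map_mul, hc, map_mul, map_mul]
      exact J.mul_mem_right _ (Ideal.subset_span (by simp))
    · rw [Ideal.span_singleton_le_iff_mem]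
      exact le_saturation J 𝔮 (Ideal.subset_span (by simp))
  refine mem_saturation_of_mul (s := θ s) hs ?_
  rw [← map_mul]
  exact h4 hsy

end TwoGenerators

section Jacobian

variable {k K : Type*} [Field k] [Field K] [Algebra k K] [IsAlgClosed K]

/-- A prime ideal of the cone over a smooth surface that is not contained in the vertex locus and is
locally generated by two elements is locally generated by the equation of the surface and one
element: by the Jacobian criterion, the equation lies outside the second symbolic power. -/
theorem IsSmoothSurface.exists_generator {f g : MvPolynomial (Fin 3) k}
    (hX : IsSmoothSurface K f g) (𝔮 : Ideal (MvPolynomial (Fin 4) k)) [h𝔮 : 𝔮.IsPrime]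
    (hF : surfacePoly f g ∈ 𝔮) {j : Fin 4} (hj : X j ∉ 𝔮)
    (hgen : ∃ r₁ ∈ 𝔮, ∃ r₂ ∈ 𝔮, 𝔮 ≤ saturation (Ideal.span {r₁, r₂}) 𝔮) :
    ∃ r ∈ 𝔮, 𝔮 ≤ saturation (Ideal.span {surfacePoly f g} ⊔ Ideal.span {r}) 𝔮 := by
  obtain ⟨r₁, hr₁, r₂, hr₂, hgen⟩ := hgen
  obtain ⟨s, hs, hsF⟩ := hgen hF
  obtain ⟨c₁, c₂, hc⟩ := Ideal.mem_span_pair.mp hsF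
  have aux : ∀ {c₁ c₂ r₁ r₂ : MvPolynomial (Fin 4) k}, r₂ ∈ 𝔮 →
      c₁ * r₁ + c₂ * r₂ = s * surfacePoly f g → c₁ ∉ 𝔮 →
      𝔮 ≤ saturation (Ideal.span {r₁, r₂}) 𝔮 →
      ∃ r ∈ 𝔮, 𝔮 ≤ saturation (Ideal.span {surfacePoly f g} ⊔ Ideal.span {r}) 𝔮 := by
    intro c₁ c₂ r₁ r₂ hr₂ hc hc₁ hgen
    refine ⟨r₂, hr₂, fun y hy => ?_⟩
    obtain ⟨t, ht, hy⟩ := hgen hy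
    refine mem_saturation_of_mul ht ?_
    refine (Ideal.span_le (I := saturation _ 𝔮)).mpr ?_ hy
    rintro _ (rfl | rfl)
    · refine ⟨c₁, hc₁, ?_⟩
      rw [eq_sub_of_add_eq hc]
      exact Ideal.sub_mem _
        (Ideal.mem_sup_left (Ideal.mul_mem_left _ _ (Ideal.mem_span_singleton_self _)))
        (Ideal.mem_sup_right (Ideal.mul_mem_left _ _ (Ideal.mem_span_singleton_self _)))
    · exact le_saturation _ _ (Ideal.mem_sup_right (Ideal.mem_span_singleton_self _))
  by_cases h1 : c₁ ∈ 𝔮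
  swap
  · exact aux hr₂ hc h1 hgen
  by_cases h2 : c₂ ∈ 𝔮
  swap
  · exact aux hr₁ (by rw [add_comm]; exact hc) h2 (by rwa [Set.pair_comm])
  exfalso
  have hd : ∀ i, pderiv i (surfacePoly f g) ∈ 𝔮 := by
    intro i
    have h3 := congrArg (pderiv i) hc
    simp only [map_add, Derivation.leibniz, smul_eq_mul] at h3
    refine (h𝔮.mem_or_mem (x := s) ?_).resolve_left hs
    rw [eq_sub_of_add_eq h3.symm]
    refine 𝔮.sub_mem (𝔮.add_mem (𝔮.add_mem ?_ ?_) (𝔮.add_mem ?_ ?_)) ?_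
    · exact 𝔮.mul_mem_right _ h1
    · exact 𝔮.mul_mem_right _ hr₁
    · exact 𝔮.mul_mem_right _ h2
    · exact 𝔮.mul_mem_right _ hr₂
    · exact 𝔮.mul_mem_right _ hF
  have h3 : X j ∉ MvPolynomial.vanishingIdeal k (MvPolynomial.zeroLocus K 𝔮) := by
    rw [MvPolynomial.vanishingIdeal_zeroLocus_eq_radical, h𝔮.radical]
    exact hj
  rw [MvPolynomial.mem_vanishingIdeal_iff] at h3
  push Not at h3
  obtain ⟨v, hv, hvj⟩ := h3
  rw [MvPolynomial.mem_zeroLocus_iff] at hv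
  obtain ⟨i, hi⟩ := hX v (fun h => hvj (by simp [h])) (hv _ hF)
  exact hi (hv _ (hd i))

end Jacobian

section GenericFibre

variable {k K : Type*} [Field k] [Field K] [Algebra k K] [IsAlgClosed K]

theorem map_surfacePoly {k M : Type*} [Field k] [Field M] (φ : k →+* M)
    (f g : MvPolynomial (Fin 3) k) : MvPolynomial.map φ (surfacePoly f g) =
      surfacePoly (MvPolynomial.map φ f) (MvPolynomial.map φ g) := by
  simp [surfacePoly, map_rename]

theorem map_lin {k M : Type*} [Field k] [Field M] (φ : k →+* M) (a : Fin 3 → k) :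
    MvPolynomial.map φ (lin a) = lin (fun i => φ (a i)) := by
  simp [lin]

theorem isWeightedHomogeneous_map {σ R S : Type*} [CommSemiring R] [CommSemiring S] (φ : R →+* S)
    {w : σ → ℕ} {A : MvPolynomial σ R} {n : ℕ} (hA : IsWeightedHomogeneous w A n) :
    IsWeightedHomogeneous w (MvPolynomial.map φ A) n := by
  intro d hd
  rw [coeff_map] at hd
  exact hA fun h => hd (by rw [h, map_zero])

/-- The generic line `a + t b`, as a form on the cone. -/
theorem emb_lin_genericLine (a b : Fin 3 → k) : emb (lin (genericLine a b)) =
    MvPolynomial.map (algebraMap k (RatFunc k)) (emb (lin a)) +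
      C RatFunc.X * MvPolynomial.map (algebraMap k (RatFunc k)) (emb (lin b)) := by
  rw [map_rename, map_rename, map_lin, map_lin]
  simp only [← RatFunc.algebraMap_eq_C, genericLine, lin, map_sum, Finset.mul_sum,
    ← Finset.sum_add_distrib, map_mul, map_add, rename_X, algHom_C, algebraMap_eq]
  exact Finset.sum_congr rfl fun i _ => by ring

/-- Substitution of the linear forms `-a`, `b` in a binary form. On the generic line `a + t b = 0`
of the pencil, their quotient is `t`. -/
def pencil (a b : Fin 3 → k) : MvPolynomial (Fin 2) k →ₐ[k] MvPolynomial (Fin 4) k :=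
  aeval ![-emb (lin a), emb (lin b)]

theorem isWeightedHomogeneous_pencil (a b : Fin 3 → k) {P : MvPolynomial (Fin 2) k} {n : ℕ}
    (hP : P.IsHomogeneous n) : IsWeightedHomogeneous wt (pencil a b P) n := by
  refine IsWeightedHomogeneous.aeval_weight (w := 1) hP fun i => ?_
  fin_cases i
  · exact (isWeightedHomogeneous_emb (isHomogeneous_lin a)).neg
  · exact isWeightedHomogeneous_emb (isHomogeneous_lin b)

theorem map_pencil_sub_mem (a b : Fin 3 → k) {P : MvPolynomial (Fin 2) k} {n : ℕ}
    (hP : P.IsHomogeneous n) :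
    MvPolynomial.map (algebraMap k (RatFunc k)) (pencil a b P) -
      MvPolynomial.map (algebraMap k (RatFunc k)) (emb (lin b)) ^ n *
        C (aeval ![RatFunc.X, 1] P) ∈ Ideal.span {emb (lin (genericLine a b))} := by
  set A' := MvPolynomial.map (algebraMap k (RatFunc k)) (emb (lin a))
  set B' := MvPolynomial.map (algebraMap k (RatFunc k)) (emb (lin b))
  have h1 : MvPolynomial.map (algebraMap k (RatFunc k)) (pencil a b P) =
      aeval (![-A', B'] : Fin 2 → MvPolynomial (Fin 4) (RatFunc k)) P := by
    have : (mapAlgHom (Algebra.ofId k (RatFunc k))).comp (pencil a b) =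
        aeval (![-A', B'] : Fin 2 → MvPolynomial (Fin 4) (RatFunc k)) := by
      ext1 i
      fin_cases i
      · simp [pencil, A', Algebra.ofId]
      · simp [pencil, B', Algebra.ofId]
    exact DFunLike.congr_fun this P
  have h2 : B' ^ n * C (aeval ![RatFunc.X, 1] P) =
      aeval (fun i => B' * (![C RatFunc.X, 1] : Fin 2 → MvPolynomial (Fin 4) (RatFunc k)) i) P := by
    rw [hP.aeval_smul']
    congr 1
    have h3 : (![C RatFunc.X, 1] : Fin 2 → MvPolynomial (Fin 4) (RatFunc k)) =
        fun i => algebraMap (RatFunc k) (MvPolynomial (Fin 4) (RatFunc k))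
          ((![RatFunc.X, 1] : Fin 2 → RatFunc k) i) := by
      funext i; fin_cases i <;> simp [algebraMap_eq]
    rw [h3]
    exact (aeval_algebraMap_apply _ _ _).symm
  rw [h1, h2]
  refine aeval_sub_aeval_mem (fun i => ?_) P
  fin_cases i
  · refine Ideal.mem_span_singleton.mpr ⟨-1, ?_⟩
    rw [emb_lin_genericLine]
    simp [A', B']; ring
  · simp

variable {a b : Fin 3 → k} {𝔭 : Ideal (MvPolynomial (Fin 4) (RatFunc k))} [h𝔭 : 𝔭.IsPrime]

/-- The parameter `t` of the pencil is transcendental at a point of the generic line. -/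
theorem eq_zero_of_map_pencil_mem (hhom : IsHomogeneousIdeal 𝔭)
    (hl : emb (lin (genericLine a b)) ∈ 𝔭)
    (hb : MvPolynomial.map (algebraMap k (RatFunc k)) (emb (lin b)) ∉ 𝔭)
    {P : MvPolynomial (Fin 2) k}
    (hP : MvPolynomial.map (algebraMap k (RatFunc k)) (pencil a b P) ∈ 𝔭) : P = 0 := by
  have key : ∀ n, homogeneousComponent n P = 0 := by
    intro n
    have hn := homogeneousComponent_isHomogeneous n P
    have h1 : MvPolynomial.map (algebraMap k (RatFunc k)) (pencil a b (homogeneousComponent n P)) =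
        weightedHomogeneousComponent wt n
          (MvPolynomial.map (algebraMap k (RatFunc k)) (pencil a b P)) := by
      conv_rhs => rw [← sum_homogeneousComponent P]
      rw [map_sum, map_sum, map_sum]
      have hw : ∀ m, IsWeightedHomogeneous wt (MvPolynomial.map (algebraMap k (RatFunc k))
          (pencil a b (homogeneousComponent m P))) m := fun m =>
        isWeightedHomogeneous_map _
          (isWeightedHomogeneous_pencil a b (homogeneousComponent_isHomogeneous m P))
      by_cases hlt : n ∈ Finset.range (P.totalDegree + 1)
      · rw [Finset.sum_eq_single_of_mem n hlt fun m _ hm =>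
          (hw m).weightedHomogeneousComponent_ne n (Ne.symm hm),
          (hw n).weightedHomogeneousComponent_same]
      · rw [Finset.sum_eq_zero fun m hm => (hw m).weightedHomogeneousComponent_ne n (by
          rintro rfl; exact hlt hm), homogeneousComponent_eq_zero, map_zero, map_zero]
        simpa using hlt
    have h2 := hhom _ hP n
    rw [← h1] at h2
    have h3 : MvPolynomial.map (algebraMap k (RatFunc k)) (emb (lin b)) ^ n *
        C (aeval ![RatFunc.X, 1] (homogeneousComponent n P)) ∈ 𝔭 := by
      have h4 := map_pencil_sub_mem a b hn
      have h5 := 𝔭.sub_mem h2 ((Ideal.span_singleton_le_iff_mem _).mpr hl h4)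
      rwa [sub_sub_cancel] at h5
    have h4 := (h𝔭.mem_or_mem h3).resolve_left fun h => hb (h𝔭.mem_of_pow_mem n h)
    have h5 : aeval ![RatFunc.X, 1] (homogeneousComponent n P) = (0 : RatFunc k) := by
      by_contra h0
      exact h𝔭.ne_top (Ideal.eq_top_of_isUnit_mem _ h4 ((isUnit_iff_ne_zero.mpr h0).map C))
    have h6 : aeval ![Polynomial.X, 1] (homogeneousComponent n P) = (0 : Polynomial k) := by
      apply RatFunc.algebraMap_injective k
      rw [map_zero, ← h5, ← aeval_algebraMap_apply]
      congr 2
      funext i; fin_cases i <;> simp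
    rw [← Polynomial.homogenize_eq_of_isHomogeneous hn h6, Polynomial.homogenize_zero]
  rw [← sum_homogeneousComponent P]
  exact Finset.sum_eq_zero fun n _ => key n

/-- Functions on the cone over the generic line come from the cone over `k`, after clearing
denominators. -/
theorem exists_mul_sub_map_mem (a b : Fin 3 → k) (y : MvPolynomial (Fin 4) (RatFunc k)) :
    ∃ (D : MvPolynomial (Fin 2) k) (y' : MvPolynomial (Fin 4) k), D ≠ 0 ∧
      MvPolynomial.map (algebraMap k (RatFunc k)) (pencil a b D) * y -
        MvPolynomial.map (algebraMap k (RatFunc k)) y' ∈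
          Ideal.span {emb (lin (genericLine a b))} := by
  set J := Ideal.span {emb (lin (genericLine a b))}
  induction y using MvPolynomial.induction_on with
  | C c =>
    set N := max c.num.natDegree c.denom.natDegree
    have h2 : ∀ P : Polynomial k, P.natDegree ≤ N →
        aeval (![RatFunc.X, 1] : Fin 2 → RatFunc k) (P.homogenize N) =
          algebraMap (Polynomial k) (RatFunc k) P := by
      intro P hP
      rw [Polynomial.aeval_homogenize_of_eq_one hP _ (by simp)]
      exact RatFunc.aeval_X_left_eq_algebraMap _
    have h3 := map_pencil_sub_mem a b (Polynomial.isHomogeneous_homogenize (n := N) c.num)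
    have h4 := map_pencil_sub_mem a b (Polynomial.isHomogeneous_homogenize (n := N) c.denom)
    rw [h2 _ (le_max_left _ _)] at h3
    rw [h2 _ (le_max_right _ _)] at h4
    refine ⟨c.denom.homogenize N, pencil a b (c.num.homogenize N), fun h0 => c.denom_ne_zero
      (Polynomial.eq_zero_of_homogenize_eq_zero (le_max_right _ _) h0), ?_⟩
    have h5 : algebraMap (Polynomial k) (RatFunc k) c.num =
        algebraMap (Polynomial k) (RatFunc k) c.denom * c := by
      conv_rhs => rw [← RatFunc.num_div_denom c]
      rw [RatFunc.num_div_denom c]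
      nth_rewrite 3 [← RatFunc.num_div_denom c]
      rw [mul_div_cancel₀ _ (RatFunc.algebraMap_ne_zero c.denom_ne_zero)]
    rw [h5, C_mul] at h3
    have := J.sub_mem (J.mul_mem_right (C c) h4) h3
    convert this using 1
    ring
  | add y z hy hz =>
    obtain ⟨D, y', hD, hy⟩ := hy
    obtain ⟨E, z', hE, hz⟩ := hz
    refine ⟨D * E, pencil a b E * y' + pencil a b D * z', mul_ne_zero hD hE, ?_⟩
    have := J.add_mem
      (J.mul_mem_left (MvPolynomial.map (algebraMap k (RatFunc k)) (pencil a b E)) hy)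
      (J.mul_mem_left (MvPolynomial.map (algebraMap k (RatFunc k)) (pencil a b D)) hz)
    convert this using 1
    simp only [map_mul, map_add]
    ring
  | mul_X y i hy =>
    obtain ⟨D, y', hD, hy⟩ := hy
    refine ⟨D, y' * X i, hD, ?_⟩
    rw [map_mul, map_X, ← mul_assoc, ← sub_mul]
    exact J.mul_mem_right _ hy

/-- A generic line in the pencil is not proportional to a line over `k`. -/
theorem eq_zero_of_eq_mul_genericLine (hab : LinearIndependent k ![a, b]) {μ : RatFunc k}
    (h : ∀ i, algebraMap k (RatFunc k) (b i) = μ * genericLine a b i) : False := by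
  rw [LinearIndependent.pair_iff] at hab
  have hb : ∃ i, b i ≠ 0 := by
    by_contra! hb
    have := hab 0 1 (by funext i; simp [hb])
    simp at this
  obtain ⟨j, hj⟩ := hb
  have h1 : ∀ i, a i * b j = a j * b i := by
    intro i
    have hμ : μ ≠ 0 := by
      rintro rfl
      have := h j
      rw [zero_mul, map_eq_zero] at this
      exact hj this
    have h2 : genericLine a b i * algebraMap k (RatFunc k) (b j) =
        genericLine a b j * algebraMap k (RatFunc k) (b i) := by
      rw [h i, h j]; ring
    apply (algebraMap k (RatFunc k)).injective
    simp only [genericLine, ← RatFunc.algebraMap_eq_C] at h2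
    simp only [map_mul]
    linear_combination h2
  have := hab (b j) (-a j) (by funext i; simp; linear_combination h1 i)
  exact hj this.1

/-- The generic fibre of the elliptic fibration is regular away from the base points of the pencil:
its local rings are local rings of the surface over `k`. -/
theorem isLocPrincipal_fibre_of_notMem {f g : MvPolynomial (Fin 3) k}
    (hX : IsSmoothSurface K f g) {c : Fin 3 → k}
    (hc : ∀ i, ∃ x y z : k, X i = C x * lin a + C y * lin b + C z * lin c)
    {F : Frame (RatFunc k)} (hl : F.l = genericLine a b) (hhom : IsHomogeneousIdeal 𝔭)
    (hle : F.fibre (MvPolynomial.map (algebraMap k (RatFunc k)) f)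
      (MvPolynomial.map (algebraMap k (RatFunc k)) g) ≤ 𝔭)
    (hirr : ∃ i : Fin 3, X i.castSucc ∉ 𝔭)
    (hb : MvPolynomial.map (algebraMap k (RatFunc k)) (emb (lin b)) ∉ 𝔭) :
    IsLocPrincipal (F.fibre (MvPolynomial.map (algebraMap k (RatFunc k)) f)
      (MvPolynomial.map (algebraMap k (RatFunc k)) g)) 𝔭 := by
  set φ : MvPolynomial (Fin 4) k →+* MvPolynomial (Fin 4) (RatFunc k) :=
    MvPolynomial.map (algebraMap k (RatFunc k)) with hφ
  set G := F.fibre (MvPolynomial.map (algebraMap k (RatFunc k)) f)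
      (MvPolynomial.map (algebraMap k (RatFunc k)) g) with hG
  have hlG : emb (lin (genericLine a b)) ∈ G := hl ▸ F.l_mem_fibre _ _
  have hFG : φ (surfacePoly f g) ∈ G := by
    rw [hφ, map_surfacePoly]; exact F.surfacePoly_mem_fibre _ _
  have hpen : ∀ P : MvPolynomial (Fin 2) k, pencil a b P ∈ 𝔭.comap φ → P = 0 := fun P hP =>
    eq_zero_of_map_pencil_mem hhom (hle hlG) hb hP
  obtain ⟨j, hj⟩ := hirr
  set θ : Polynomial (Polynomial (MvPolynomial (Fin 2) k)) →+* MvPolynomial (Fin 4) k :=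
    Polynomial.eval₂RingHom (Polynomial.eval₂RingHom (pencil a b).toRingHom (emb (lin c))) (X 3)
    with hθ
  have hθC : ∀ P, θ (Polynomial.C (Polynomial.C P)) = pencil a b P := fun P => by simp [θ]
  have hsurj : Function.Surjective θ := by
    have hC : θ (Polynomial.C Polynomial.X) = emb (lin c) := by simp [θ]
    intro y
    induction y using MvPolynomial.induction_on with
    | C x => exact ⟨_, (hθC (C x)).trans (algHom_C _ _)⟩
    | add y z hy hz =>
      obtain ⟨y, rfl⟩ := hy
      obtain ⟨z, rfl⟩ := hz
      exact ⟨y + z, map_add θ y z⟩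
    | mul_X y i hy =>
      obtain ⟨y, rfl⟩ := hy
      suffices h : ∃ z, θ z = X i by
        obtain ⟨z, hz⟩ := h
        exact ⟨y * z, by rw [map_mul, hz]⟩
      induction i using Fin.lastCases with
      | last => exact ⟨Polynomial.X, by simp [θ]⟩
      | cast i =>
        obtain ⟨x, y, z, h⟩ := hc i
        refine ⟨Polynomial.C (Polynomial.C (-(C x * X 0) + C y * X 1)) +
          Polynomial.C (Polynomial.C (C z)) * Polynomial.C Polynomial.X, ?_⟩
        rw [map_add, map_mul, hθC, hθC, hC, Frame.X_castSucc, h]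
        simp [pencil]
  obtain ⟨r, hr, hgen⟩ := hX.exists_generator (𝔭.comap φ) (hle hFG) (j := j.castSucc)
    (by rw [Ideal.mem_comap, hφ, map_X]; exact hj)
    (exists_locally_generates_two θ hsurj _ fun P hP => hpen P (by rwa [hθC] at hP))
  refine ⟨hle, φ r, hr, fun y hy => ?_⟩
  obtain ⟨D, y', hD, hy'⟩ := exists_mul_sub_map_mem a b y
  have hDp : φ (pencil a b D) ∉ 𝔭 := fun h => hD (hpen D h)
  have hlJ := (Ideal.span_singleton_le_iff_mem _).mpr hlG hy'
  have hy'p : y' ∈ 𝔭.comap φ := by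
    rw [Ideal.mem_comap]
    have := 𝔭.sub_mem (𝔭.mul_mem_left (φ (pencil a b D)) hy) (hle hlJ)
    rwa [sub_sub_cancel] at this
  obtain ⟨s, hs, hsy⟩ := hgen hy'p
  refine ⟨φ s * φ (pencil a b D), fun h => (h𝔭.mem_or_mem h).elim hs hDp, ?_⟩
  have h1 : φ (s * y') ∈ G ⊔ Ideal.span {φ r} := by
    have h2 := Ideal.mem_map_of_mem φ hsy
    rw [Ideal.map_sup, Ideal.map_span, Ideal.map_span, Set.image_singleton,
      Set.image_singleton] at h2
    exact sup_le_sup_right ((Ideal.span_singleton_le_iff_mem _).mpr hFG) _ h2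
  have h3 := Ideal.add_mem _ (Ideal.mem_sup_left (Ideal.mul_mem_left _ (φ s) hlJ)) h1
  convert h3 using 1
  rw [map_mul]
  ring

/-- The generic fibre of the elliptic fibration is regular at the base points of the pencil, which
are unramified over the plane. -/
theorem Frame.Osculates.isLocPrincipal_of_mem {M : Type*} [Field M] {F : Frame M}
    {f g q : MvPolynomial (Fin 3) M} (h : F.Osculates f g q)
    {𝔭 : Ideal (MvPolynomial (Fin 4) M)} [h𝔭 : 𝔭.IsPrime] (hhom : IsHomogeneousIdeal 𝔭)
    (hle : F.fibre f g ≤ 𝔭) (hirr : ∃ i : Fin 3, X i.castSucc ∉ 𝔭) (hu : emb (lin F.u) ∈ 𝔭) :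
    IsLocPrincipal (F.fibre f g) 𝔭 := by
  have key : ∀ {q : MvPolynomial (Fin 3) M}, F.Osculates f g q → X 3 - emb q ∈ 𝔭 →
      IsLocPrincipal (F.fibre f g) 𝔭 := by
    intro q h hq
    obtain ⟨i, hi⟩ := F.exists_pt_ne_zero q
    have h1 := F.span_sup_X_sub h.hq
    have h2 : pointIdeal (F.pt q) ≤ 𝔭 := by
      rw [← h1, Ideal.span_insert]
      refine sup_le (sup_le ?_ ?_) ?_ <;> rw [Ideal.span_singleton_le_iff_mem]
      exacts [hle (F.l_mem_fibre f g), hu, hq]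
    have h3 : 𝔭 = pointIdeal (F.pt q) := by
      by_contra hne
      obtain ⟨j, hj⟩ := hirr
      exact hj (X_mem_of_pointIdeal_lt hi hhom h2 hne j)
    refine ⟨hle, emb (lin F.u), hu, fun y hy => ⟨X 3 - emb (-f - q), fun hs => ?_, ?_⟩⟩
    · have h4 := 𝔭.sub_mem hs hq
      rw [h3] at h4
      have h5 := eval_eq_zero_of_mem_pointIdeal h4
      simp only [map_sub, map_neg, F.eval_pt_emb] at h5
      apply h.ne
      simp only [map_add, map_mul, map_ofNat]
      linear_combination h5
    · rw [F.fibre_sup_u ((dvd_pow_self _ (by norm_num)).trans h.dvd)]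
      rw [h3, ← h1] at hy
      obtain ⟨z, hz, e, he, rfl⟩ := Submodule.mem_sup.mp hy
      obtain ⟨d, rfl⟩ := Ideal.mem_span_singleton.mp he
      rw [mul_add]
      refine Ideal.add_mem _ (Ideal.mem_sup_left (Ideal.mul_mem_left _ _ hz))
        (Ideal.mem_sup_right (Ideal.mem_span_singleton.mpr ⟨d, by ring⟩))
  have h1 : (X 3 - emb q) * (X 3 - emb (-f - q)) ∈ 𝔭 := by
    have h2 := F.fibre_sup_u ((dvd_pow_self _ (by norm_num)).trans h.dvd)
    have h3 : F.fibre f g ⊔ Ideal.span {emb (lin F.u)} ≤ 𝔭 :=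
      sup_le hle ((Ideal.span_singleton_le_iff_mem _).mpr hu)
    rw [h2] at h3
    exact h3 (Ideal.mem_sup_right (Ideal.mem_span_singleton_self _))
  rcases h𝔭.mem_or_mem h1 with h2 | h2
  · exact key h h2
  · refine key ⟨h.hf, h.hg, h.hf.neg.sub h.hq, fun h0 => h.ne ?_, ?_⟩ h2
    · simp only [map_add, map_mul, map_ofNat, map_sub, map_neg] at h0 ⊢
      linear_combination -h0
    · convert h.dvd using 2
      ring

/-- The generic fibre of the elliptic fibration is regular. -/
theorem isLocPrincipal_fibre {f g : MvPolynomial (Fin 3) k}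
    (hX : IsSmoothSurface K f g) (hab : LinearIndependent k ![a, b]) {c : Fin 3 → k}
    (hc : ∀ i, ∃ x y z : k, X i = C x * lin a + C y * lin b + C z * lin c)
    {F : Frame (RatFunc k)} (hl : F.l = genericLine a b)
    (hbp : ∑ i, algebraMap k (RatFunc k) (b i) * F.p i = 0)
    {q : MvPolynomial (Fin 3) (RatFunc k)}
    (h : F.Osculates (MvPolynomial.map (algebraMap k (RatFunc k)) f)
      (MvPolynomial.map (algebraMap k (RatFunc k)) g) q)
    (𝔭 : Ideal (MvPolynomial (Fin 4) (RatFunc k))) [h𝔭 : 𝔭.IsPrime] (hhom : IsHomogeneousIdeal 𝔭)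
    (hle : F.fibre (MvPolynomial.map (algebraMap k (RatFunc k)) f)
      (MvPolynomial.map (algebraMap k (RatFunc k)) g) ≤ 𝔭)
    (hirr : ∃ i : Fin 3, X i.castSucc ∉ 𝔭) :
    IsLocPrincipal (F.fibre (MvPolynomial.map (algebraMap k (RatFunc k)) f)
      (MvPolynomial.map (algebraMap k (RatFunc k)) g)) 𝔭 := by
  by_cases hu : emb (lin F.u) ∈ 𝔭
  · exact h.isLocPrincipal_of_mem hhom hle hirr hu
  refine isLocPrincipal_fibre_of_notMem hX hc hl hhom hle hirr fun hb => ?_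
  set b' : Fin 3 → RatFunc k := fun i => algebraMap k (RatFunc k) (b i) with hb'
  -- `b` is a combination of `u` and `l`
  have h1 : ∀ i, b' i = (∑ j, b' j * F.s j) * F.u i + (∑ j, b' j * F.m j) * F.l i := by
    intro i
    have h2 : ∑ j, b' j * (F.p j * F.v i + F.s j * F.u i + F.m j * F.l i) = b' i := by
      simp only [F.dual]
      simp
    rw [← h2]
    have h3 : ∑ j, b' j * F.p j * F.v i = 0 := by
      rw [← Finset.sum_mul, hbp, zero_mul]
    rw [Finset.sum_mul, Finset.sum_mul, ← add_zero (_ + _), ← h3, ← Finset.sum_add_distrib,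
      ← Finset.sum_add_distrib]
    exact Finset.sum_congr rfl fun j _ => by ring
  have h2 : emb (lin b') = C (∑ j, b' j * F.s j) * emb (lin F.u) +
      C (∑ j, b' j * F.m j) * emb (lin F.l) := by
    rw [emb_lin, emb_lin, emb_lin, Finset.mul_sum, Finset.mul_sum, ← Finset.sum_add_distrib]
    refine Finset.sum_congr rfl fun i _ => ?_
    rw [h1 i]
    simp only [C_add, C_mul]
    ring
  have h3 : emb (lin b') ∈ 𝔭 := by
    rw [emb, map_rename, map_lin] at hb
    exact hb
  have h4 : C (∑ j, b' j * F.s j) * emb (lin F.u) ∈ 𝔭 := by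
    have := 𝔭.sub_mem h3 (𝔭.mul_mem_left (C (∑ j, b' j * F.m j)) (hle (F.l_mem_fibre _ _)))
    rwa [h2, add_sub_cancel_right] at this
  have h5 : ∑ j, b' j * F.s j = 0 := by
    by_contra h0
    exact (h𝔭.mem_or_mem h4).elim (fun h6 => h𝔭.ne_top
      (Ideal.eq_top_of_isUnit_mem _ h6 ((isUnit_iff_ne_zero.mpr h0).map C))) hu
  refine eq_zero_of_eq_mul_genericLine hab (μ := ∑ j, b' j * F.m j) fun i => ?_
  have := h1 i
  rwa [h5, zero_mul, zero_add, hl] at this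

end GenericFibre

/-! ### The osculating section -/

section Osculating

theorem exists_frame {k : Type*} [Field k] {p : Fin 3 → k} (hp : p ≠ 0) :
    ∃ T : Frame k, T.m = p := by
  obtain ⟨j, hj⟩ := Function.ne_iff.mp hp
  simp only [Pi.zero_apply] at hj
  fin_cases j
  · refine ⟨⟨![0, 1, 0], ![0, 0, 1], p, ![-(p 1 / p 0), 1, 0], ![-(p 2 / p 0), 0, 1],
      ![(p 0)⁻¹, 0, 0], fun i j => ?_⟩, rfl⟩
    simp only [Fin.zero_eta] at hj
    fin_cases i <;> fin_cases j <;> simp <;> field_simp <;> simp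
  · refine ⟨⟨![1, 0, 0], ![0, 0, 1], p, ![1, -(p 0 / p 1), 0], ![0, -(p 2 / p 1), 1],
      ![0, (p 1)⁻¹, 0], fun i j => ?_⟩, rfl⟩
    simp only [Fin.mk_one] at hj
    fin_cases i <;> fin_cases j <;> simp <;> field_simp <;> simp
  · refine ⟨⟨![1, 0, 0], ![0, 1, 0], p, ![1, 0, -(p 0 / p 2)], ![0, 1, -(p 1 / p 2)],
      ![0, 0, (p 2)⁻¹], fun i j => ?_⟩, rfl⟩
    simp only [Fin.reduceFinMk] at hj
    fin_cases i <;> fin_cases j <;> simp <;> field_simp <;> simp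

namespace Frame

variable {M : Type*} [Field M] (T : Frame M)

theorem v_m : ∑ i, T.v i * T.m i = 0 := T.pairing 0 2
theorem u_m : ∑ i, T.u i * T.m i = 0 := T.pairing 1 2
theorem l_m : ∑ i, T.l i * T.m i = 1 := T.pairing 2 2

/-- Base change of a frame. -/
def map {N : Type*} [Field N] (φ : M →+* N) : Frame N where
  p i := φ (T.p i)
  s i := φ (T.s i)
  m i := φ (T.m i)
  v i := φ (T.v i)
  u i := φ (T.u i)
  l i := φ (T.l i)
  dual i j := by
    rw [← map_mul, ← map_mul, ← map_mul, ← map_add, ← map_add, T.dual]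
    split_ifs <;> simp

theorem map_ext {N : Type*} [Field N] (φ : M →+* N) (P : MvPolynomial (Fin 2) M) :
    MvPolynomial.map φ (T.ext P) = (T.map φ).ext (MvPolynomial.map φ P) := by
  induction P using MvPolynomial.induction_on with
  | C c => simp [ext]
  | add P Q hP hQ => rw [map_add, map_add, map_add, map_add, hP, hQ]
  | mul_X P i hP =>
    rw [map_mul, map_mul, map_mul, map_mul, hP, map_X]
    congr 1
    fin_cases i <;> simp [ext, map_lin, map]

/-- The frame of the line `α u + β v = 0` through the point `m`. -/
def ofPencil (α β γ δ : M) (h : γ * α + δ * β = 1) : Frame M where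
  p := T.m
  s i := β * T.s i - α * T.p i
  m i := γ * T.s i + δ * T.p i
  v := T.l
  u i := δ * T.u i - γ * T.v i
  l i := α * T.u i + β * T.v i
  dual i j := by
    rw [← T.dual i j]
    linear_combination (T.s i * T.u j + T.p i * T.v j) * h

variable {α β γ δ : M} (h : γ * α + δ * β = 1)

theorem res_ofPencil_u : (T.ofPencil α β γ δ h).res (lin T.u) = X 0 * C β := by
  rw [res_lin]
  have h1 : ∑ i, T.u i * (T.ofPencil α β γ δ h).s i = β := by
    have : ∀ i, T.u i * (T.ofPencil α β γ δ h).s i = β * (T.u i * T.s i) - α * (T.u i * T.p i) :=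
      fun i => by simp only [ofPencil]; ring
    simp only [this, Finset.sum_sub_distrib, ← Finset.mul_sum, T.u_s, T.u_p]
    simp
  have h2 : ∑ i, T.u i * (T.ofPencil α β γ δ h).p i = 0 := T.u_m
  rw [h1, h2]
  simp [mul_comm]

theorem res_ofPencil_v : (T.ofPencil α β γ δ h).res (lin T.v) = X 0 * C (-α) := by
  rw [res_lin]
  have h1 : ∑ i, T.v i * (T.ofPencil α β γ δ h).s i = -α := by
    have : ∀ i, T.v i * (T.ofPencil α β γ δ h).s i = β * (T.v i * T.s i) - α * (T.v i * T.p i) :=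
      fun i => by simp only [ofPencil]; ring
    simp only [this, Finset.sum_sub_distrib, ← Finset.mul_sum, T.v_s, T.v_p]
    simp
  have h2 : ∑ i, T.v i * (T.ofPencil α β γ δ h).p i = 0 := T.v_m
  rw [h1, h2]
  simp [mul_comm]

/-- On the line `α u + β v = 0`, a binary form in `u`, `v` is determined by its value at
`(β, -α)`. -/
theorem res_ofPencil_ext {P : MvPolynomial (Fin 2) M} {n : ℕ} (hP : P.IsHomogeneous n) :
    (T.ofPencil α β γ δ h).res (T.ext P) = X 0 ^ n * C (eval ![β, -α] P) := by
  have h1 : (T.ofPencil α β γ δ h).res.comp T.ext =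
      aeval (fun i => X 0 * (fun i => C ((![β, -α] : Fin 2 → M) i)) i :
        Fin 2 → MvPolynomial (Fin 2) M) := by
    ext1 i
    fin_cases i
    · simp [ext, res_ofPencil_u]
    · simp [ext, res_ofPencil_v]
  have h2 := DFunLike.congr_fun h1 P
  rw [AlgHom.comp_apply] at h2
  rw [h2, hP.aeval_smul']
  congr 1
  exact aeval_algebraMap_apply (MvPolynomial (Fin 2) M) (![β, -α] : Fin 2 → M) P

theorem res_ofPencil_l : (T.ofPencil α β γ δ h).res (lin T.l) = X 1 :=
  (T.ofPencil α β γ δ h).res_v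

theorem eval_m_ext {P : MvPolynomial (Fin 2) M} {n : ℕ} (hP : P.IsHomogeneous n) (hn : n ≠ 0) :
    eval T.m (T.ext P) = 0 := by
  have h1 : (aeval T.m).comp T.ext = aeval (fun i => (0 : M) * (0 : Fin 2 → M) i) := by
    ext1 i
    fin_cases i
    · simpa [ext, eval_lin] using T.u_m
    · simpa [ext, eval_lin] using T.v_m
  have h2 := DFunLike.congr_fun h1 P
  rw [AlgHom.comp_apply, hP.aeval_smul', zero_pow hn, zero_mul] at h2
  rwa [aeval_eq_eval] at h2

/-- Division of a form by the linear form `l`. -/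
theorem exists_eq_mul_add {A : MvPolynomial (Fin 3) M} {n : ℕ} (hA : A.IsHomogeneous (n + 1)) :
    ∃ A' P, A'.IsHomogeneous n ∧ P.IsHomogeneous (n + 1) ∧ A = lin T.l * A' + T.ext P := by
  obtain ⟨c, hc⟩ := Ideal.mem_span_singleton.mp (T.sub_ext_res_mem A)
  refine ⟨homogeneousComponent n c, T.res A, homogeneousComponent_isHomogeneous n c,
    T.isHomogeneous_res hA, ?_⟩
  have hh : (A - T.ext (T.res A)).IsHomogeneous (n + 1) :=
    hA.sub (T.isHomogeneous_ext (T.isHomogeneous_res hA))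
  have h2 : homogeneousComponent (n + 1) (A - T.ext (T.res A)) = A - T.ext (T.res A) :=
    homogeneousComponent_of_mem hh |>.trans (if_pos rfl)
  have h3 : homogeneousComponent (n + 1) (lin T.l * c) = lin T.l * homogeneousComponent n c := by
    rw [mul_comm, mul_comm (lin T.l)]
    exact weightedHomogeneousComponent_mul_right (w := 1) (isHomogeneous_lin T.l) c n
  rw [← h3, ← hc, h2]
  ring

end Frame

end Osculating

section OsculatingSection

variable {k : Type*} [Field k]

theorem exists_eq_C_of_isHomogeneous_zero {σ : Type*} {A : MvPolynomial σ k}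
    (hA : A.IsHomogeneous 0) : ∃ c, A = C c :=
  ⟨_, totalDegree_eq_zero_iff_eq_C.mp (Nat.le_zero.mp hA.totalDegree_le)⟩

/-- Near the point `m` of the plane, the surface `w² + f w = g` is a graph over the plane, as
`f + 2 w` does not vanish there. The Taylor expansion of order two of this graph is the unique
quadratic form `q` for which `q² + f q - g` vanishes to order three at `m`. -/
theorem exists_osculating_section (T : Frame k) {f g : MvPolynomial (Fin 3) k}
    (hf : f.IsHomogeneous 2) (hg : g.IsHomogeneous 4) {w : k}
    (hw : w ^ 2 + eval T.m f * w - eval T.m g = 0) (hne : eval T.m f + 2 * w ≠ 0) :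
    ∃ (q : MvPolynomial (Fin 3) k) (P₃ P₄ : MvPolynomial (Fin 2) k), q.IsHomogeneous 2 ∧
      eval T.m q = w ∧ P₃.IsHomogeneous 3 ∧ P₄.IsHomogeneous 4 ∧
      q ^ 2 + f * q - g = lin T.l * T.ext P₃ + T.ext P₄ := by
  obtain ⟨f', f₂, hf', hf₂, rfl⟩ := T.exists_eq_mul_add hf
  obtain ⟨f'', f₁, hf'', hf₁, rfl⟩ := T.exists_eq_mul_add hf'
  obtain ⟨f₀, rfl⟩ := exists_eq_C_of_isHomogeneous_zero hf''
  obtain ⟨g', g₄, hg', hg₄, rfl⟩ := T.exists_eq_mul_add hg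
  obtain ⟨g'', g₃, hg'', hg₃, rfl⟩ := T.exists_eq_mul_add hg'
  obtain ⟨g₃', g₂, hg₃', hg₂, rfl⟩ := T.exists_eq_mul_add hg''
  obtain ⟨g₄', g₁, hg₄', hg₁, rfl⟩ := T.exists_eq_mul_add hg₃'
  obtain ⟨g₀, rfl⟩ := exists_eq_C_of_isHomogeneous_zero hg₄'
  have hl : eval T.m (lin T.l) = 1 := by rw [eval_lin]; exact T.l_m
  simp only [map_add, map_mul, hl, T.eval_m_ext hf₂ (by norm_num), T.eval_m_ext hf₁ (by norm_num),
    T.eval_m_ext hg₁ (by norm_num), T.eval_m_ext hg₂ (by norm_num),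
    T.eval_m_ext hg₃ (by norm_num), T.eval_m_ext hg₄ (by norm_num), eval_C, one_mul, add_zero]
    at hw hne
  set e := (f₀ + 2 * w)⁻¹ with he
  have he' : (f₀ + 2 * w) * e = 1 := mul_inv_cancel₀ hne
  set q₁ := C e * (g₁ - C w * f₁) with hq₁
  set q₂ := C e * (g₂ - q₁ ^ 2 - f₁ * q₁ - C w * f₂) with hq₂
  have hh₁ : q₁.IsHomogeneous 1 := (hg₁.sub (hf₁.C_mul w)).C_mul e
  have hh₂ : q₂.IsHomogeneous 2 :=
    (((hg₂.sub (hh₁.pow 2)).sub (hf₁.mul hh₁)).sub (hf₂.C_mul w)).C_mul e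
  have hlin := isHomogeneous_lin T.l
  refine ⟨C w * lin T.l ^ 2 + T.ext q₁ * lin T.l + T.ext q₂,
    2 * q₁ * q₂ + f₁ * q₂ + f₂ * q₁ - g₃, q₂ ^ 2 + f₂ * q₂ - g₄,
    (((hlin.pow 2).C_mul w).add ((T.isHomogeneous_ext hh₁).mul hlin)).add (T.isHomogeneous_ext hh₂),
    ?_, ?_, ?_, ?_⟩
  · simp [hl, T.eval_m_ext hh₁, T.eval_m_ext hh₂]
  · have h2 : (2 * q₁ * q₂).IsHomogeneous 3 := by
      have : (2 * q₁ * q₂) = C 2 * (q₁ * q₂) := by rw [map_ofNat]; ring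
      rw [this]
      exact (hh₁.mul hh₂).C_mul 2
    exact ((h2.add (hf₁.mul hh₂)).add (hf₂.mul hh₁)).sub hg₃
  · exact ((hh₂.pow 2).add (hf₂.mul hh₂)).sub hg₄
  · have e1 : C (f₀ + 2 * w) * T.ext q₁ = T.ext g₁ - C w * T.ext f₁ := by
      rw [hq₁, map_mul, map_sub, map_mul, algHom_C, algHom_C, algebraMap_eq, ← mul_assoc, ← C_mul,
        he', C_1, one_mul]
    have e2 : C (f₀ + 2 * w) * T.ext q₂ =
        T.ext g₂ - T.ext q₁ ^ 2 - T.ext f₁ * T.ext q₁ - C w * T.ext f₂ := by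
      rw [hq₂, map_mul, algHom_C, algebraMap_eq, ← mul_assoc, ← C_mul, he', C_1, one_mul]
      simp only [map_sub, map_mul, map_pow, algHom_C, algebraMap_eq]
    have e0 : (C (w ^ 2 + f₀ * w - g₀) : MvPolynomial (Fin 3) k) = 0 := by rw [hw, C_0]
    simp only [map_add, map_sub, map_mul, map_pow, map_ofNat] at e1 e2 e0 ⊢
    linear_combination lin T.l ^ 4 * e0 + lin T.l ^ 3 * e1 + lin T.l ^ 2 * e2

/-- Along the lines through the point, the osculating section meets the surface to order three. -/
theorem osculates_ofPencil (T : Frame k) {f g q : MvPolynomial (Fin 3) k}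
    {P₃ P₄ : MvPolynomial (Fin 2) k} (hf : f.IsHomogeneous 2) (hg : g.IsHomogeneous 4)
    (hq : q.IsHomogeneous 2) (hne : eval T.m (f + 2 * q) ≠ 0) (hP₃ : P₃.IsHomogeneous 3)
    (hP₄ : P₄.IsHomogeneous 4) (hΦ : q ^ 2 + f * q - g = lin T.l * T.ext P₃ + T.ext P₄)
    {α β γ δ : k} (h : γ * α + δ * β = 1) :
    (T.ofPencil α β γ δ h).res (q ^ 2 + f * q - g) =
      X 0 ^ 3 * (C (eval ![β, -α] P₃) * X 1 + C (eval ![β, -α] P₄) * X 0) ∧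
    (T.ofPencil α β γ δ h).Osculates f g q := by
  have h1 : (T.ofPencil α β γ δ h).res (q ^ 2 + f * q - g) =
      X 0 ^ 3 * (C (eval ![β, -α] P₃) * X 1 + C (eval ![β, -α] P₄) * X 0) := by
    rw [hΦ, map_add, map_mul, T.res_ofPencil_l, T.res_ofPencil_ext h hP₃, T.res_ofPencil_ext h hP₄]
    ring
  exact ⟨h1, hf, hg, hq, hne, h1 ▸ dvd_mul_right _ _⟩

end OsculatingSection

section BinaryForms

variable {k K : Type*} [Field k] [Field K] [Algebra k K]

/-- The polynomial `P(X, 1)`. -/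
abbrev dehomog (P : MvPolynomial (Fin 2) k) : Polynomial k := aeval ![Polynomial.X, 1] P

theorem aeval_pair_one {R : Type*} [CommRing R] [Algebra k R] (P : MvPolynomial (Fin 2) k) (r : R) :
    aeval ![r, 1] P = Polynomial.aeval r (dehomog P) := by
  have h : (Polynomial.aeval r).comp (aeval ![Polynomial.X, 1]) =
      (aeval ![r, 1] : MvPolynomial (Fin 2) k →ₐ[k] R) := by
    ext1 i
    fin_cases i <;> simp
  exact (DFunLike.congr_fun h P).symm

theorem eq_zero_of_dehomog_eq_zero {P : MvPolynomial (Fin 2) k} {n : ℕ} (hP : P.IsHomogeneous n)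
    (h : dehomog P = 0) : P = 0 := by
  rw [← Polynomial.homogenize_eq_of_isHomogeneous hP h, Polynomial.homogenize_zero]

theorem natDegree_dehomog_le {P : MvPolynomial (Fin 2) k} {n : ℕ} (hP : P.IsHomogeneous n) :
    (dehomog P).natDegree ≤ n := by
  refine (aeval_natDegree_le (n := 1) P hP.totalDegree_le _ fun i => ?_).trans (by simp)
  fin_cases i <;> simp

theorem aeval_one_zero {p : Polynomial k} {n : ℕ} (hp : p.natDegree ≤ n) :
    aeval (![1, 0] : Fin 2 → K) (p.homogenize n) = algebraMap k K (p.coeff n) := by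
  refine Polynomial.induction_with_natDegree_le (fun p =>
    aeval (![1, 0] : Fin 2 → K) (p.homogenize n) = algebraMap k K (p.coeff n)) n ?_ ?_ ?_ p hp
  · simp
  · intro m r _ hm
    rw [Polynomial.homogenize_C_mul, Polynomial.homogenize_X_pow hm, Polynomial.coeff_C_mul_X_pow]
    rcases hm.lt_or_eq with h | rfl
    · have : n - m ≠ 0 := by omega
      simp [this, h.ne']
    · simp
  · intro p r _ _ hp hr
    simp [hp, hr]

/-- The zeros of a binary form in terms of its dehomogenization. -/
theorem aeval_binary_form_eq_zero {P : MvPolynomial (Fin 2) k} {n : ℕ} (hP : P.IsHomogeneous n)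
    {c : Fin 2 → K} (hc : c ≠ 0) (h : aeval c P = 0) :
    (c 1 ≠ 0 ∧ Polynomial.aeval (c 0 / c 1) (dehomog P) = 0) ∨
      (c 1 = 0 ∧ (dehomog P).coeff n = 0) := by
  by_cases h1 : c 1 = 0
  · refine Or.inr ⟨h1, ?_⟩
    have h0 : c 0 ≠ 0 := by
      intro h0
      apply hc
      funext i; fin_cases i <;> simp [h0, h1]
    have h2 : c = fun i => c 0 * (![1, 0] : Fin 2 → K) i := by
      funext i; fin_cases i <;> simp [h1]
    rw [h2, hP.aeval_smul', ← Polynomial.homogenize_eq_of_isHomogeneous hP rfl,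
      aeval_one_zero (natDegree_dehomog_le hP)] at h
    simpa using (mul_eq_zero.mp h).resolve_left (pow_ne_zero n h0)
  · refine Or.inl ⟨h1, ?_⟩
    have h2 : c = fun i => c 1 * (![c 0 / c 1, 1] : Fin 2 → K) i := by
      funext i; fin_cases i
      · simp; field_simp
      · simp
    rw [h2, hP.aeval_smul', aeval_pair_one] at h
    exact (mul_eq_zero.mp h).resolve_left (pow_ne_zero n h1)

theorem exists_zero_of_binary_form [IsAlgClosed K] {P : MvPolynomial (Fin 2) k} {n : ℕ}
    (hP : P.IsHomogeneous n) (hn : n ≠ 0) : ∃ c : Fin 2 → K, c ≠ 0 ∧ aeval c P = 0 := by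
  by_cases hd : (dehomog P).degree = 0
  · refine ⟨![1, 0], fun h => one_ne_zero (congrFun h 0), ?_⟩
    rw [← Polynomial.homogenize_eq_of_isHomogeneous hP rfl,
      aeval_one_zero (natDegree_dehomog_le hP), Polynomial.eq_C_of_degree_eq_zero hd,
      Polynomial.coeff_C_of_ne_zero hn, map_zero]
  · obtain ⟨x, hx⟩ := IsAlgClosed.exists_aeval_eq_zero K (dehomog P) hd
    exact ⟨![x, 1], fun h => one_ne_zero (congrFun h 1), by rwa [aeval_pair_one]⟩

/-- The greatest common divisor of two binary forms. The degree of a cofactor is a difference of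
natural numbers; it vanishes if this difference is truncated. -/
theorem exists_gcd_binary_forms (K : Type*) [Field K] [Algebra k K] {P Q : MvPolynomial (Fin 2) k}
    {m n : ℕ} (hP : P.IsHomogeneous m) (hQ : Q.IsHomogeneous n) (hne : P ≠ 0 ∨ Q ≠ 0) :
    ∃ (d : ℕ) (A B D : MvPolynomial (Fin 2) k), d ≤ max m n ∧ A.IsHomogeneous (m - d) ∧
      (m < d → A = 0) ∧ B.IsHomogeneous (n - d) ∧ (n < d → B = 0) ∧
      D.IsHomogeneous d ∧ D ≠ 0 ∧ P = D * A ∧ Q = D * B ∧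
      ∀ c : Fin 2 → K, c ≠ 0 → aeval c A = 0 → aeval c B ≠ 0 := by
  classical
  have hne' : dehomog P ≠ 0 ∨ dehomog Q ≠ 0 :=
    hne.imp (mt (eq_zero_of_dehomog_eq_zero hP)) (mt (eq_zero_of_dehomog_eq_zero hQ))
  obtain ⟨r, a, b, hr, ha, hb, hab⟩ : ∃ r a b : Polynomial k, r ≠ 0 ∧ dehomog P = r * a ∧
      dehomog Q = r * b ∧ IsCoprime a b := by
    have hr : EuclideanDomain.gcd (dehomog P) (dehomog Q) ≠ 0 := by
      rw [Ne, EuclideanDomain.gcd_eq_zero_iff]; tauto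
    obtain ⟨a, ha⟩ := EuclideanDomain.gcd_dvd_left (dehomog P) (dehomog Q)
    obtain ⟨b, hb⟩ := EuclideanDomain.gcd_dvd_right (dehomog P) (dehomog Q)
    refine ⟨_, a, b, hr, ha, hb, ?_⟩
    refine ⟨EuclideanDomain.gcdA (dehomog P) (dehomog Q),
      EuclideanDomain.gcdB (dehomog P) (dehomog Q), mul_left_cancel₀ hr ?_⟩
    linear_combination -EuclideanDomain.gcdA (dehomog P) (dehomog Q) * ha -
      EuclideanDomain.gcdB (dehomog P) (dehomog Q) * hb -
      EuclideanDomain.gcd_eq_gcd_ab (dehomog P) (dehomog Q)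
  have h3 := natDegree_dehomog_le hP
  have h4 := natDegree_dehomog_le hQ
  -- the degree `d` is chosen such that `A` and `B` do not both vanish at infinity
  obtain ⟨d, hd, hdr, hda, ham, hdb, hbn, hlead⟩ : ∃ d : ℕ, d ≤ max m n ∧ r.natDegree ≤ d ∧
      a.natDegree ≤ m - d ∧ (m < d → a = 0) ∧ b.natDegree ≤ n - d ∧ (n < d → b = 0) ∧
      ¬ (a.coeff (m - d) = 0 ∧ b.coeff (n - d) = 0) := by
    rw [ha] at h3
    rw [hb] at h4
    by_cases ha0 : a = 0
    · have hb0 : b ≠ 0 := by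
        rintro rfl
        rw [ha0] at hab
        exact not_isCoprime_zero_zero hab
      rw [Polynomial.natDegree_mul hr hb0] at h4
      refine ⟨n - b.natDegree, by omega, by omega, by simp [ha0], fun _ => ha0, by omega, by omega,
        fun h => hb0 (Polynomial.leadingCoeff_eq_zero.mp ?_)⟩
      rw [Polynomial.leadingCoeff, ← h.2]
      congr 1; omega
    rw [Polynomial.natDegree_mul hr ha0] at h3
    have hla := mt Polynomial.leadingCoeff_eq_zero.mp ha0
    by_cases hb0 : b = 0
    · refine ⟨m - a.natDegree, by omega, by omega, by omega, by omega, by simp [hb0],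
        fun _ => hb0, fun h => hla ?_⟩
      rw [Polynomial.leadingCoeff, ← h.1]
      congr 1; omega
    rw [Polynomial.natDegree_mul hr hb0] at h4
    have hlb := mt Polynomial.leadingCoeff_eq_zero.mp hb0
    rcases le_total (m - a.natDegree) (n - b.natDegree) with hle | hle
    · refine ⟨m - a.natDegree, by omega, by omega, by omega, by omega, by omega, by omega,
        fun h => hla ?_⟩
      rw [Polynomial.leadingCoeff, ← h.1]
      congr 1; omega
    · refine ⟨n - b.natDegree, by omega, by omega, by omega, by omega, by omega, by omega,
        fun h => hlb ?_⟩
      rw [Polynomial.leadingCoeff, ← h.2]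
      congr 1; omega
  have hA := Polynomial.isHomogeneous_homogenize (n := m - d) a
  have hB := Polynomial.isHomogeneous_homogenize (n := n - d) b
  have hdA : dehomog (a.homogenize (m - d)) = a := Polynomial.aeval_homogenize_X_one a hda
  have hdB : dehomog (b.homogenize (n - d)) = b := Polynomial.aeval_homogenize_X_one b hdb
  have hmul : ∀ {P : MvPolynomial (Fin 2) k} {a : Polynomial k} {m : ℕ}, P.IsHomogeneous m →
      dehomog P = r * a → a.natDegree ≤ m - d → (m < d → a = 0) →
      P = r.homogenize d * a.homogenize (m - d) := by
    intro P a m hP ha hda ham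
    rw [← Polynomial.homogenize_eq_of_isHomogeneous hP rfl, ← Polynomial.homogenize_mul _ _ hdr hda,
      show aeval ![Polynomial.X, 1] P = r * a from ha]
    rcases lt_or_ge m d with h0 | h0
    · rw [ham h0, mul_zero, Polynomial.homogenize_zero, Polynomial.homogenize_zero]
    · congr 1; omega
  refine ⟨d, a.homogenize (m - d), b.homogenize (n - d), r.homogenize d, hd, hA,
    fun h0 => by rw [ham h0, Polynomial.homogenize_zero], hB,
    fun h0 => by rw [hbn h0, Polynomial.homogenize_zero], Polynomial.isHomogeneous_homogenize r,
    fun h0 => hr (Polynomial.eq_zero_of_homogenize_eq_zero hdr h0), hmul hP ha hda ham,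
    hmul hQ hb hdb hbn, fun c hc h1 h2 => ?_⟩
  have h1' := aeval_binary_form_eq_zero hA hc h1
  have h2' := aeval_binary_form_eq_zero hB hc h2
  rw [hdA] at h1'
  rw [hdB] at h2'
  rcases h1' with ⟨hc1, h1⟩ | ⟨hc1, h1⟩ <;> rcases h2' with ⟨hc2, h2⟩ | ⟨hc2, h2⟩
  · obtain ⟨x, y, hxy⟩ := hab
    have := congrArg (Polynomial.aeval (c 0 / c 1)) hxy
    simp [h1, h2] at this
  · exact hc1 hc2
  · exact hc2 hc1
  · exact hlead ⟨h1, h2⟩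

/-- A nonzero binary form does not vanish identically on an affine line that does not pass through
the origin. -/
theorem eq_zero_of_aeval_affine {P : MvPolynomial (Fin 2) k} {n : ℕ} (hP : P.IsHomogeneous n)
    {a₁ a₂ b₁ b₂ : k} (hdet : a₁ * b₂ - a₂ * b₁ ≠ 0)
    (h : aeval ![Polynomial.C a₁ + Polynomial.X * Polynomial.C a₂,
      Polynomial.C b₁ + Polynomial.X * Polynomial.C b₂] P = 0) : P = 0 := by
  set P' : MvPolynomial (Fin 2) k :=
    aeval ![C a₁ * X 1 + C a₂ * X 0, C b₁ * X 1 + C b₂ * X 0] P with hP'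
  have hP'h : P'.IsHomogeneous n := by
    refine IsWeightedHomogeneous.aeval_weight (w := 1) (w' := 1) hP fun i => ?_
    fin_cases i
    · exact IsHomogeneous.add (isHomogeneous_C_mul_X a₁ 1) (isHomogeneous_C_mul_X a₂ 0)
    · exact IsHomogeneous.add (isHomogeneous_C_mul_X b₁ 1) (isHomogeneous_C_mul_X b₂ 0)
  have h2 : P' = 0 := by
    refine eq_zero_of_dehomog_eq_zero hP'h ?_
    rw [← h, dehomog, hP', ← AlgHom.comp_apply, comp_aeval]
    congr 2
    funext i
    fin_cases i <;> simp
  have h3 : aeval (![C a₁ * X 1 - C b₁ * X 0, C b₂ * X 0 - C a₂ * X 1] :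
      Fin 2 → MvPolynomial (Fin 2) k) P' = C (a₁ * b₂ - a₂ * b₁) ^ n * P := by
    rw [hP', ← AlgHom.comp_apply, comp_aeval]
    have h4 := hP.aeval_smul' (C (a₁ * b₂ - a₂ * b₁)) (X : Fin 2 → MvPolynomial (Fin 2) k)
    rw [aeval_X_left_apply] at h4
    rw [← h4]
    congr 2
    funext i
    fin_cases i
    · simp [algebraMap_eq]; ring
    · simp [algebraMap_eq]; ring
  rw [h2, map_zero, eq_comm, mul_eq_zero] at h3
  exact h3.resolve_left (pow_ne_zero n (C_ne_zero.mpr hdet))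

/-- A nonzero binary form does not vanish at a generic point of the projective line. -/
theorem aeval_generic_ne_zero {P : MvPolynomial (Fin 2) k} {n : ℕ} (hP : P.IsHomogeneous n)
    (h0 : P ≠ 0) {a₁ a₂ b₁ b₂ : k} (hdet : a₁ * b₂ - a₂ * b₁ ≠ 0) :
    aeval ![RatFunc.C a₁ + RatFunc.X * RatFunc.C a₂, RatFunc.C b₁ + RatFunc.X * RatFunc.C b₂] P ≠
      0 := by
  intro h
  refine h0 (eq_zero_of_aeval_affine hP hdet (RatFunc.algebraMap_injective k ?_))
  rw [map_zero, ← h, ← aeval_algebraMap_apply]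
  congr 2
  funext i
  fin_cases i
  · simp; ring
  · simp; ring

end BinaryForms

/-! ### Points and maps in coordinates -/

section Coordinates

variable {k K : Type*} [Field k] [Field K] [Algebra k K]

/-- The vector `(v₀, v₁, v₂, w)`. -/
abbrev cvec {R : Type*} (v : Fin 3 → R) (w : R) : Fin 4 → R := Fin.snoc (α := fun _ => R) v w

@[simp] theorem cvec_castSucc {R : Type*} (v : Fin 3 → R) (w : R) (i : Fin 3) :
    cvec v w i.castSucc = v i := Fin.snoc_castSucc (α := fun _ => R) _ _ _

@[simp] theorem cvec_three {R : Type*} (v : Fin 3 → R) (w : R) : cvec v w 3 = w :=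
  Fin.snoc_last (α := fun _ => R) _ _

theorem cvec_eta {R : Type*} (v : Fin 4 → R) : cvec (fun i => v i.castSucc) (v 3) = v := by
  funext i
  induction i using Fin.lastCases with
  | last => exact cvec_three _ _
  | cast i => simp

theorem aeval_cvec_emb {R : Type*} [CommRing R] [Algebra k R] (v : Fin 3 → R) (w : R)
    (A : MvPolynomial (Fin 3) k) : aeval (cvec v w) (emb A) = aeval v A := by
  rw [emb, aeval_rename]
  congr 2
  funext i; simp

theorem aeval_cvec_surfacePoly {R : Type*} [CommRing R] [Algebra k R] (v : Fin 3 → R) (w : R)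
    (f g : MvPolynomial (Fin 3) k) :
    aeval (cvec v w) (surfacePoly f g) = w ^ 2 + aeval v f * w - aeval v g := by
  have h1 := aeval_cvec_emb v w f
  have h2 := aeval_cvec_emb v w g
  simp only [emb] at h1 h2
  rw [surfacePoly, map_sub, map_add, map_mul, map_pow, h1, h2, aeval_X, cvec_three]

theorem cvec_ne_zero {v : Fin 3 → K} (hv : v ≠ 0) (w : K) : cvec v w ≠ 0 := by
  intro h
  apply hv
  funext i
  have := congrFun h i.castSucc
  simpa using this

theorem WP.mk_eq_mk_iff {v v' : Fin 4 → K} {hv : v ≠ 0} {hv' : v' ≠ 0} :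
    WP.mk v hv = WP.mk v' hv' ↔ ∃ c : K, c ≠ 0 ∧ ∀ i, v' i = c ^ wt i * v i :=
  ⟨fun h => Quotient.exact h, fun h => Quotient.sound h⟩

theorem WP.exists_rep_mk {v : Fin 4 → K} (hv : v ≠ 0) :
    ∃ c : K, c ≠ 0 ∧ ∀ i, (WP.mk v hv).rep i = c ^ wt i * v i :=
  WP.mk_eq_mk_iff.mp (WP.mk_rep (WP.mk v hv)).symm

theorem aeval_rep_eq_zero_iff {A : MvPolynomial (Fin 4) k} {n : ℕ}
    (hA : IsWeightedHomogeneous wt A n) {v : Fin 4 → K} (hv : v ≠ 0) :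
    aeval (WP.mk v hv).rep A = 0 ↔ aeval v A = 0 := by
  obtain ⟨c, hc, h⟩ := WP.exists_rep_mk hv
  rw [funext h, hA.aeval_smul, mul_eq_zero, or_iff_right (pow_ne_zero n hc)]

theorem mem_zeroLocus_iff {I : Ideal (MvPolynomial (Fin 4) K)} (hI : IsHomogeneousIdeal I)
    {v : Fin 4 → K} (hv : v ≠ 0) :
    WP.mk v hv ∈ zeroLocus (I : Set (MvPolynomial (Fin 4) K)) ↔ I ≤ pointIdeal v := by
  obtain ⟨c, hc, h⟩ := WP.exists_rep_mk hv
  rw [← pointIdeal_smul hc v, ← funext h, le_pointIdeal_iff hI]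
  rfl

theorem mk_mem_line {L : ℙ K (Fin 3 → K)} {v : Fin 3 → K} (hv : v ≠ 0) :
    Projectivization.mk K v hv ∈ line L ↔ dotProduct L.rep v = 0 := by
  have h := Projectivization.orthogonal_mk (F := K) L.rep_nonzero hv
  rw [Projectivization.mk_rep] at h
  exact h

theorem IsLocalRep.map {S : Set (ℙ K (Fin 3 → K))} {φ : S → U K} {h : MvPolynomial (Fin 3) k}
    {H : Fin 4 → MvPolynomial (Fin 3) k} (hr : IsLocalRep k φ h H) :
    IsLocalRep K φ (MvPolynomial.map (algebraMap k K) h)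
      (fun i => MvPolynomial.map (algebraMap k K) (H i)) := by
  obtain ⟨⟨d, hd⟩, ⟨e, he⟩, heq⟩ := hr
  refine ⟨⟨d, isWeightedHomogeneous_map _ hd⟩, ⟨e, fun i => isWeightedHomogeneous_map _ (he i)⟩,
    fun s v hv hs h0 => ?_⟩
  simp only [aeval_map_algebraMap] at h0 ⊢
  exact heq s v hv hs h0

theorem aeval_rep_ne_zero_iff {h : MvPolynomial (Fin 3) k} {d : ℕ} (hd : h.IsHomogeneous d)
    {v : Fin 3 → K} (hv : v ≠ 0) :
    aeval (Projectivization.mk K v hv).rep h ≠ 0 ↔ aeval v h ≠ 0 := by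
  obtain ⟨c, hc⟩ := Projectivization.exists_smul_eq_mk_rep K v hv
  have h1 : (Projectivization.mk K v hv).rep = fun i => (c : K) * v i := by
    rw [← hc]; rfl
  rw [h1, hd.aeval_smul', mul_ne_zero_iff, and_iff_right (pow_ne_zero d c.ne_zero)]

/-- The point with first coordinates `v` and last coordinate `w`. -/
def upt (v : Fin 3 → K) (hv : v ≠ 0) (w : K) : U K :=
  ⟨WP.mk (cvec v w) (cvec_ne_zero hv w), fun h => hv <| by
    funext i
    have := WP.castSucc_eq_zero_of_mk_eq_Omega _ h i
    simpa using this⟩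

theorem upt_eq_iff {v v' : Fin 3 → K} {hv : v ≠ 0} {hv' : v' ≠ 0} {w w' : K} :
    upt v hv w = upt v' hv' w' ↔ ∃ c : K, c ≠ 0 ∧ (∀ i, v' i = c * v i) ∧ w' = c ^ 2 * w := by
  rw [Subtype.ext_iff]
  refine WP.mk_eq_mk_iff.trans (exists_congr fun c => and_congr_right fun _ => ?_)
  constructor
  · intro h
    refine ⟨fun i => ?_, ?_⟩
    · have := h i.castSucc
      rwa [cvec_castSucc, cvec_castSucc, wt_castSucc, pow_one] at this
    · have := h 3
      rwa [cvec_three, cvec_three] at this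
  · rintro ⟨h1, h2⟩ i
    induction i using Fin.lastCases with
    | last => change cvec v' w' 3 = _ * cvec v w 3; rw [cvec_three, cvec_three]; exact h2
    | cast i => rw [cvec_castSucc, cvec_castSucc, wt_castSucc, pow_one]; exact h1 i

theorem upt_mem_surface {f g : MvPolynomial (Fin 3) k} (hf : f.IsHomogeneous 2)
    (hg : g.IsHomogeneous 4) {v : Fin 3 → K} {hv : v ≠ 0} {w : K} :
    (upt v hv w).1 ∈ surface K f g ↔ w ^ 2 + aeval v f * w - aeval v g = 0 := by
  rw [← aeval_cvec_surfacePoly]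
  exact aeval_rep_eq_zero_iff (isWeightedHomogeneous_surfacePoly hf hg) _

variable [IsAlgClosed K]

theorem eq_upt_of_mk {x : U K} {v : Fin 4 → K} {hv : v ≠ 0} (h : WP.mk v hv = x.1) :
    ∃ hv' : (fun i : Fin 3 => v i.castSucc) ≠ 0, x = upt (fun i => v i.castSucc) hv' (v 3) := by
  have hv' : (fun i : Fin 3 => v i.castSucc) ≠ 0 := by
    intro h0
    exact x.2 (h ▸ WP.mk_eq_Omega hv (congrFun h0))
  refine ⟨hv', Subtype.ext ?_⟩
  rw [← h]
  unfold upt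
  congr 1
  exact (cvec_eta v).symm

theorem phi_upt {v : Fin 3 → K} (hv : v ≠ 0) (w : K) :
    phi (upt v hv w) = Projectivization.mk K v hv := by
  obtain ⟨c, hc, h⟩ := WP.exists_rep_mk (cvec_ne_zero hv w)
  refine (Projectivization.mk_eq_mk_iff' K _ _ _ _).mpr ⟨c, ?_⟩
  funext i
  have := h i.castSucc
  rw [cvec_castSucc, wt_castSucc, pow_one] at this
  exact this.symm

theorem exists_eq_upt {x : U K} {v : Fin 3 → K} {hv : v ≠ 0}
    (h : phi x = Projectivization.mk K v hv) : ∃ w, x = upt v hv w := by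
  obtain ⟨h0, hx⟩ := eq_upt_of_mk (WP.mk_rep x.1)
  rw [hx, phi_upt] at h
  obtain ⟨c, hc⟩ := (Projectivization.mk_eq_mk_iff' K _ _ _ _).mp h
  have hc0 : c ≠ 0 := by
    rintro rfl
    exact h0 (by rw [← hc, zero_smul])
  refine ⟨(c ^ 2)⁻¹ * x.1.rep 3, ?_⟩
  conv_lhs => rw [hx]
  refine (upt_eq_iff.mpr ⟨c, hc0, fun i => ?_, ?_⟩).symm
  · exact (congrFun hc i).symm
  · rw [mul_inv_cancel_left₀ (pow_ne_zero 2 hc0)]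

theorem iota_upt {f : MvPolynomial (Fin 3) k} (hf : f.IsHomogeneous 2) {v : Fin 3 → K}
    (hv : v ≠ 0) (w : K) : iota f (upt v hv w) = upt v hv (-aeval v f - w) := by
  obtain ⟨c, hc, h⟩ := WP.exists_rep_mk (cvec_ne_zero hv w)
  obtain ⟨h0, hx⟩ := eq_upt_of_mk (x := iota f (upt v hv w)) rfl
  rw [hx]
  refine (upt_eq_iff.mpr ⟨c, hc, fun i => ?_, ?_⟩).symm
  · rw [iotaVec_castSucc]
    have := h i.castSucc
    rwa [cvec_castSucc, wt_castSucc, pow_one] at this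
  · have h3 := h 3
    rw [cvec_three] at h3
    have h4 : (fun i : Fin 3 => (upt v hv w).1.rep i.castSucc) = fun i => c * v i := by
      funext i
      have := h i.castSucc
      rwa [cvec_castSucc, wt_castSucc, pow_one] at this
    rw [iotaVec, Function.update_self, h4, hf.aeval_smul']
    change _ - (WP.mk (cvec v w) _).rep 3 = _
    rw [h3]
    change _ - c ^ 2 * w = _
    ring

/-- A local representation by polynomials in terms of coordinates. -/
theorem IsLocalRep.eq_upt {S : Set (ℙ K (Fin 3 → K))} {φ : S → U K} {h : MvPolynomial (Fin 3) k}
    {H : Fin 4 → MvPolynomial (Fin 3) k} (hr : IsLocalRep k φ h H) (s : S) {v : Fin 3 → K}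
    {hv : v ≠ 0} (hs : Projectivization.mk K v hv = s.1) (h0 : aeval v h ≠ 0) :
    ∃ h1 : (fun i : Fin 3 => aeval v (H i.castSucc)) ≠ 0,
      φ s = upt (fun i => aeval v (H i.castSucc)) h1 (aeval v (H 3)) := by
  obtain ⟨hH, h2⟩ := hr.eq_on s v hv hs h0
  exact eq_upt_of_mk h2

end Coordinates

section OsculatingSurface

/-- A point `m` of the plane, as part of a frame, and a quadratic form `q` over `k` whose graph
`w = q` osculates the surface `w² + f w = g` to order three above `m`, at a point that is unramified
over the plane. The binary forms `P₃`, `P₄` in the forms `u`, `v` that vanish at `m` describe the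
intersection. -/
structure Osculation {k : Type*} [Field k] (f g : MvPolynomial (Fin 3) k) where
  T : Frame k
  q : MvPolynomial (Fin 3) k
  P₃ : MvPolynomial (Fin 2) k
  P₄ : MvPolynomial (Fin 2) k
  hf : f.IsHomogeneous 2
  hg : g.IsHomogeneous 4
  hq : q.IsHomogeneous 2
  hP₃ : P₃.IsHomogeneous 3
  hP₄ : P₄.IsHomogeneous 4
  ne : eval T.m (f + 2 * q) ≠ 0
  eq : q ^ 2 + f * q - g = lin T.l * T.ext P₃ + T.ext P₄

namespace Frame

section Vec

variable {M : Type*} [Field M] (F : Frame M)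

/-- The point of the line with coordinates `u = c 0`, `v = c 1`. -/
def vec (c : Fin 2 → M) : Fin 3 → M := fun i => F.s i * c 0 + F.p i * c 1

theorem sum_mul_vec (a : Fin 3 → M) (c : Fin 2 → M) : ∑ i, a i * F.vec c i =
    (∑ i, a i * F.s i) * c 0 + (∑ i, a i * F.p i) * c 1 := by
  simp only [vec, Finset.sum_mul, ← Finset.sum_add_distrib]
  exact Finset.sum_congr rfl fun i _ => by ring

theorem u_vec (c : Fin 2 → M) : ∑ i, F.u i * F.vec c i = c 0 := by
  rw [sum_mul_vec, u_s, u_p]; ring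

theorem v_vec (c : Fin 2 → M) : ∑ i, F.v i * F.vec c i = c 1 := by
  rw [sum_mul_vec, v_s, v_p]; ring

theorem l_vec (c : Fin 2 → M) : ∑ i, F.l i * F.vec c i = 0 := by
  rw [sum_mul_vec, l_s, l_p]; ring

theorem vec_ne_zero {c : Fin 2 → M} (hc : c ≠ 0) : F.vec c ≠ 0 := by
  intro h
  have h0 := F.u_vec c
  have h1 := F.v_vec c
  simp only [h, Pi.zero_apply, mul_zero, Finset.sum_const_zero] at h0 h1
  apply hc
  funext i
  fin_cases i
  exacts [h0.symm, h1.symm]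

theorem eval_res (c : Fin 2 → M) (A : MvPolynomial (Fin 3) M) :
    eval c (F.res A) = eval (F.vec c) A :=
  F.aeval_res c A

theorem vec_zero_one : F.vec ![0, 1] = F.p := by
  funext i; simp [vec]

theorem exists_eq_vec {x : Fin 3 → M} (hx : ∑ i, F.l i * x i = 0) :
    x = F.vec ![∑ i, F.u i * x i, ∑ i, F.v i * x i] := by
  funext j
  have h2 : ∑ i, (F.p j * F.v i + F.s j * F.u i + F.m j * F.l i) * x i = x j := by
    simp only [F.dual]
    simp
  have h3 : ∑ i, F.m j * F.l i * x i = 0 := by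
    simp only [mul_assoc, ← Finset.mul_sum, hx, mul_zero]
  rw [← h2]
  simp only [add_mul, Finset.sum_add_distrib]
  rw [h3]
  simp only [vec, Finset.mul_sum, Matrix.cons_val_zero, Matrix.cons_val_one, mul_assoc]
  ring

end Vec

theorem exists_m_ne_zero {M : Type*} [Field M] (T : Frame M) : T.m ≠ 0 := by
  intro h
  have := T.l_m
  simp [h] at this

/-- A line through the point `m` of the frame belongs to the pencil spanned by `u` and `v`. -/
theorem exists_ofPencil {M : Type*} [Field M] (T : Frame M) {l : Fin 3 → M} (h0 : l ≠ 0)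
    (hm : ∑ i, l i * T.m i = 0) :
    ∃ (γ δ : M) (h : γ * (∑ i, l i * T.s i) + δ * (∑ i, l i * T.p i) = 1),
      (T.ofPencil _ _ γ δ h).l = l := by
  have h1 : ∀ j, l j = (∑ i, l i * T.s i) * T.u j + (∑ i, l i * T.p i) * T.v j := by
    intro j
    have h2 : ∑ i, l i * (T.p i * T.v j + T.s i * T.u j + T.m i * T.l j) = l j := by
      simp only [T.dual]
      simp
    have h3 : ∑ i, l i * T.m i * T.l j = 0 := by
      rw [← Finset.sum_mul, hm, zero_mul]
    rw [← h2, Finset.sum_mul, Finset.sum_mul, ← add_zero (_ + _), ← h3, ← Finset.sum_add_distrib,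
      ← Finset.sum_add_distrib]
    exact Finset.sum_congr rfl fun j _ => by ring
  have h4 : (∑ i, l i * T.p i) ≠ 0 ∨ (∑ i, l i * T.s i) ≠ 0 := by
    by_contra! h5
    apply h0
    funext j
    rw [h1 j, h5.1, h5.2]
    simp
  rcases h4 with h4 | h4
  · exact ⟨0, (∑ i, l i * T.p i)⁻¹, by field_simp; simp, funext fun j => (h1 j).symm⟩
  · exact ⟨(∑ i, l i * T.s i)⁻¹, 0, by field_simp; simp, funext fun j => (h1 j).symm⟩

end Frame

namespace Osculation

variable {k K : Type*} [Field k] [Field K] [Algebra k K]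
variable {f g : MvPolynomial (Fin 3) k} (O : Osculation f g)

theorem eval_map_comp {M : Type*} [Field M] (φ : k →+* M) (A : MvPolynomial (Fin 3) k)
    (v : Fin 3 → k) : eval (fun i => φ (v i)) (MvPolynomial.map φ A) = φ (eval v A) := by
  rw [MvPolynomial.eval_map, eval₂_comp]
  rfl

/-- Base change of an osculating section. -/
def baseChange {M : Type*} [Field M] (φ : k →+* M) :
    Osculation (MvPolynomial.map φ f) (MvPolynomial.map φ g) where
  T := O.T.map φ
  q := MvPolynomial.map φ O.q
  P₃ := MvPolynomial.map φ O.P₃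
  P₄ := MvPolynomial.map φ O.P₄
  hf := isWeightedHomogeneous_map φ O.hf
  hg := isWeightedHomogeneous_map φ O.hg
  hq := isWeightedHomogeneous_map φ O.hq
  hP₃ := isWeightedHomogeneous_map φ O.hP₃
  hP₄ := isWeightedHomogeneous_map φ O.hP₄
  ne := by
    have h1 : MvPolynomial.map φ f + 2 * MvPolynomial.map φ O.q =
        MvPolynomial.map φ (f + 2 * O.q) := by simp
    rw [h1]
    change eval (fun i => φ (O.T.m i)) _ ≠ 0
    rw [eval_map_comp]
    exact (map_ne_zero φ).mpr O.ne
  eq := by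
    have h1 := congrArg (MvPolynomial.map φ) O.eq
    simp only [map_add, map_sub, map_mul, map_pow, Frame.map_ext, map_lin] at h1
    exact h1

/-- On a line through the point, the intersection of the osculating section with the surface
consists of the point, with multiplicity three, and a residual point. -/
theorem res_eq {M : Type*} [Field M] (φ : k →+* M) {α β γ δ : M} (h : γ * α + δ * β = 1) :
    ((O.T.map φ).ofPencil α β γ δ h).res
      (MvPolynomial.map φ O.q ^ 2 + MvPolynomial.map φ f * MvPolynomial.map φ O.q -
        MvPolynomial.map φ g) =
      X 0 ^ 3 * (C (eval ![β, -α] (MvPolynomial.map φ O.P₃)) * X 1 +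
        C (eval ![β, -α] (MvPolynomial.map φ O.P₄)) * X 0) :=
  let O' := O.baseChange φ
  (osculates_ofPencil O'.T O'.hf O'.hg O'.hq O'.ne O'.hP₃ O'.hP₄ O'.eq h).1

theorem osculates {M : Type*} [Field M] (φ : k →+* M) {α β γ δ : M} (h : γ * α + δ * β = 1) :
    ((O.T.map φ).ofPencil α β γ δ h).Osculates (MvPolynomial.map φ f) (MvPolynomial.map φ g)
      (MvPolynomial.map φ O.q) :=
  let O' := O.baseChange φ
  (osculates_ofPencil O'.T O'.hf O'.hg O'.hq O'.ne O'.hP₃ O'.hP₄ O'.eq h).2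

/-- The osculating section is not contained in the surface: otherwise the surface would be
reducible, and singular where its components meet. -/
theorem ne_zero_of_smooth [IsAlgClosed K] (hX : IsSmoothSurface K f g) :
    O.P₃ ≠ 0 ∨ O.P₄ ≠ 0 := by
  by_contra! h0
  have h1 := O.eq
  rw [h0.1, h0.2, map_zero, mul_zero, add_zero] at h1
  have h2 : surfacePoly f g = (X 3 - emb O.q) * (X 3 + emb f + emb O.q) := by
    rw [surfacePoly_eq f g O.q, h1, map_zero, add_zero]
  obtain ⟨c, hc, hc0⟩ : ∃ v : Fin 3 → K, v ≠ 0 ∧ aeval v (f + 2 * O.q) = 0 := by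
    have hh : (f + 2 * O.q).IsHomogeneous 2 := by
      have := O.hf.add (O.hq.C_mul 2)
      rwa [map_ofNat] at this
    obtain ⟨c, hc, h3⟩ := exists_zero_of_binary_form (K := K)
      (O.T.isHomogeneous_res hh) two_ne_zero
    rw [Frame.aeval_res] at h3
    exact ⟨_, (O.T.map (algebraMap k K)).vec_ne_zero hc, h3⟩
  set v := cvec c (aeval c O.q) with hv
  have e1 : aeval v (X 3 - emb O.q) = 0 := by
    rw [map_sub, hv, aeval_cvec_emb, aeval_X, cvec_three, sub_self]
  have e2 : aeval v (X 3 + emb f + emb O.q) = 0 := by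
    rw [map_add, map_add, hv, aeval_cvec_emb, aeval_cvec_emb, aeval_X, cvec_three, ← hc0, map_add,
      map_mul, map_ofNat]
    ring
  obtain ⟨i, hi⟩ := hX v (cvec_ne_zero hc _) (by rw [h2, map_mul, e1, zero_mul])
  apply hi
  rw [h2, Derivation.leibniz, smul_eq_mul, smul_eq_mul, map_add, map_mul, map_mul, e1, e2]
  ring

end Osculation

end OsculatingSurface

/-! ### The section `ξ` of the projection -/

section Xi

variable {k K : Type*} [Field k] [Field K] [Algebra k K]
variable {f g : MvPolynomial (Fin 3) k}

theorem aeval_algebraMap_comp {σ : Type*}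
    (A : MvPolynomial σ k) (v : σ → k) :
    aeval (fun i => algebraMap k K (v i)) A = algebraMap k K (eval v A) := by
  rw [← aeval_eq_eval]
  exact aeval_algebraMap_apply _ _ _

namespace Osculation

variable (O : Osculation f g)

variable (K) in
theorem map_m_ne_zero : (fun i => algebraMap k K (O.T.m i)) ≠ 0 :=
  (O.T.map (algebraMap k K)).exists_m_ne_zero

variable (K) in
/-- The point of contact of the osculating section. -/
def point : U K :=
  upt (fun i => algebraMap k K (O.T.m i)) (O.map_m_ne_zero K) (algebraMap k K (eval O.T.m O.q))

variable (K) in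
/-- The morphism from the plane to the graph `w = q`. -/
def xi (S : ℙ K (Fin 3 → K)) : U K := upt S.rep S.rep_nonzero (aeval S.rep O.q)

theorem xi_mk {v : Fin 3 → K} (hv : v ≠ 0) :
    O.xi K (Projectivization.mk K v hv) = upt v hv (aeval v O.q) := by
  obtain ⟨c, hc⟩ := Projectivization.exists_smul_eq_mk_rep K v hv
  have h1 : ∀ i, (Projectivization.mk K v hv).rep i = (c : K) * v i := fun i =>
    congrFun hc.symm i
  refine (upt_eq_iff.mpr ⟨(c : K), c.ne_zero, h1, ?_⟩).symm
  rw [funext h1, O.hq.aeval_smul']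

theorem isLocalRep_xi (S : Set (ℙ K (Fin 3 → K))) :
    IsLocalRep k (fun s : S => O.xi K s.1) 1 (cvec X O.q) := by
  refine ⟨⟨0, isHomogeneous_one _ _⟩, ⟨1, fun i => ?_⟩, fun s v hv hs _ => ?_⟩
  · rw [one_mul]
    induction i using Fin.lastCases with
    | last => exact (cvec_three X O.q).symm ▸ O.hq
    | cast i => rw [cvec_castSucc, wt_castSucc]; exact isHomogeneous_X _ _
  · have h1 : (fun i => aeval v (cvec X O.q i)) = cvec v (aeval v O.q) := by
      funext i
      induction i using Fin.lastCases with
      | last =>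
        change aeval v (cvec X O.q 3) = cvec v (aeval v O.q) 3
        rw [cvec_three, cvec_three]
      | cast i => rw [cvec_castSucc, cvec_castSucc, aeval_X]
    simp only [h1]
    refine ⟨cvec_ne_zero hv _, ?_⟩
    rw [← hs, xi_mk]
    rfl

theorem isMorphism_xi (S : Set (ℙ K (Fin 3 → K))) : IsMorphism k (fun s : S => O.xi K s.1) :=
  fun s => ⟨1, _, O.isLocalRep_xi S, by simp⟩

variable [IsAlgClosed K]

theorem phi_point : phi (O.point K) = Projectivization.mk K _ (O.map_m_ne_zero K) := phi_upt _ _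

theorem phi_xi (S : ℙ K (Fin 3 → K)) : phi (O.xi K S) = S := by
  rw [xi, phi_upt, Projectivization.mk_rep]

theorem xi_phi_point : O.xi K (phi (O.point K)) = O.point K := by
  rw [phi_point, xi_mk, point]
  congr 1
  exact aeval_algebraMap_comp _ _

theorem isWeightedHomogeneous_X_sub_emb : IsWeightedHomogeneous wt (X 3 - emb O.q) 2 :=
  (isWeightedHomogeneous_X k wt 3).sub (isWeightedHomogeneous_emb O.hq)

theorem range_xi : Set.range (fun S => (O.xi K S).1) =
    zeroLocus {MvPolynomial.map (algebraMap k K) (X 3 - emb O.q)} := by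
  have hwt := O.isWeightedHomogeneous_X_sub_emb
  ext x
  have h1 : x ∈ zeroLocus {MvPolynomial.map (algebraMap k K) (X 3 - emb O.q)} ↔
      aeval x.rep (X 3 - emb O.q) = 0 := by
    simp only [zeroLocus, Set.mem_ofPred_eq, Set.mem_singleton_iff, forall_eq]
    rw [MvPolynomial.eval_map, ← aeval_def]
  rw [h1]
  constructor
  · rintro ⟨S, rfl⟩
    refine (aeval_rep_eq_zero_iff hwt _).mpr ?_
    rw [map_sub, aeval_cvec_emb, aeval_X, cvec_three, sub_self]
  · intro hx
    have hxO : x ≠ Omega K := by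
      rintro rfl
      have h2 : (![0, 0, 0, 1] : Fin 4 → K) = cvec (fun i => (0 : K) * (0 : Fin 3 → K) i) 1 := by
        funext i; fin_cases i <;> simp [cvec, Fin.snoc]
      rw [Omega, aeval_rep_eq_zero_iff hwt, h2, map_sub, aeval_cvec_emb, aeval_X, cvec_three,
        O.hq.aeval_smul'] at hx
      simp at hx
    obtain ⟨w, hw⟩ := exists_eq_upt (x := ⟨x, hxO⟩) (Projectivization.mk_rep _).symm
    refine ⟨phi ⟨x, hxO⟩, ?_⟩
    have h3 : x = (upt (phi ⟨x, hxO⟩).rep (Projectivization.rep_nonzero _) w).1 :=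
      congrArg Subtype.val hw
    rw [h3, upt, aeval_rep_eq_zero_iff hwt, map_sub, aeval_cvec_emb, aeval_X, cvec_three,
      sub_eq_zero] at hx
    change (O.xi K (phi ⟨x, hxO⟩)).1 = x
    conv_rhs => rw [h3, hx]
    rfl

theorem isSurfaceOfDegree_range_xi :
    IsSurfaceOfDegree k (Set.range fun S => (O.xi K S).1) 2 := by
  have hmap : MvPolynomial.map (algebraMap k K) (X 3 - emb O.q) =
      X 3 - emb (MvPolynomial.map (algebraMap k K) O.q) := by
    rw [map_sub, map_X, map_rename]
  refine ⟨X 3 - emb O.q, O.isWeightedHomogeneous_X_sub_emb, ?_, O.range_xi⟩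
  · set q := MvPolynomial.map (algebraMap k K) O.q
    rw [hmap]
    -- the coordinate ring of the graph `w = q` is a polynomial ring
    have hker : RingHom.ker (aeval (cvec X q) : MvPolynomial (Fin 4) K →ₐ[K] _) =
        Ideal.span {X 3 - emb q} := by
      refine ker_eq_of_section (aeval (cvec X q) : MvPolynomial (Fin 4) K →ₐ[K] _).toRingHom
        (emb : MvPolynomial (Fin 3) K →ₐ[K] _).toRingHom ?_ (fun c => ?_) fun i => ?_
      · rw [Ideal.span_singleton_le_iff_mem, RingHom.mem_ker]
        change aeval (cvec X q) (X 3 - emb q) = 0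
        rw [map_sub, aeval_cvec_emb, aeval_X, cvec_three, aeval_X_left_apply, sub_self]
      · change emb (aeval (cvec X q) (C c)) = C c
        rw [algHom_C, algebraMap_eq, algHom_C, algebraMap_eq]
      · change X i - emb (aeval (cvec X q) (X i)) ∈ _
        rw [aeval_X]
        induction i using Fin.lastCases with
        | last =>
          change X 3 - emb (cvec X q 3) ∈ _
          rw [cvec_three]
          exact Ideal.mem_span_singleton_self _
        | cast i => simp
    have h0 : X 3 - emb q ≠ 0 := by
      intro h
      have := congrArg (aeval (cvec (0 : Fin 3 → K) 1)) h
      rw [map_sub, aeval_cvec_emb, aeval_X, cvec_three, map_zero] at this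
      have h2 : aeval (0 : Fin 3 → K) q = 0 := by
        have h3 : q.IsHomogeneous 2 := isWeightedHomogeneous_map (algebraMap k K) O.hq
        have h4 := h3.aeval_smul' (0 : K) 0
        simpa using h4
      rw [h2, sub_zero] at this
      exact one_ne_zero this
    have hp : Prime (X 3 - emb q) := by
      rw [← Ideal.span_singleton_prime h0, ← hker]
      exact RingHom.ker_isPrime _
    exact hp.irreducible

/-- A line through the point of contact, with the intersection of the osculating section and the
surface above it. -/
theorem exists_frame (L : linesThrough (phi (O.point K))) :
    ∃ (γ δ : K) (h : γ * (∑ i, L.1.rep i * algebraMap k K (O.T.s i)) +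
      δ * (∑ i, L.1.rep i * algebraMap k K (O.T.p i)) = 1),
      ((O.T.map (algebraMap k K)).ofPencil _ _ γ δ h).l = L.1.rep := by
  refine (O.T.map (algebraMap k K)).exists_ofPencil L.1.rep_nonzero ?_
  obtain ⟨L, hL⟩ := L
  have h : phi (O.point K) ∈ line L := hL
  rw [phi_point, mk_mem_line] at h
  exact h

end Osculation

variable [IsAlgClosed K] in
/-- A rational point of the surface that is unramified over the plane is the point of contact of an
osculating section. -/
theorem exists_osculation (hf : f.IsHomogeneous 2) (hg : g.IsHomogeneous 4) {P : U K}
    (hPk : ∃ (p : Fin 4 → k) (hp : (fun i => algebraMap k K (p i)) ≠ 0),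
      P.1 = WP.mk (fun i => algebraMap k K (p i)) hp)
    (hPX : P.1 ∈ surface K f g) (hPR : phi P ∉ branch K f g) :
    ∃ O : Osculation f g, P = O.point K := by
  obtain ⟨p, hp, hP⟩ := hPk
  obtain ⟨h0, rfl⟩ := eq_upt_of_mk hP.symm
  have hp0 : (fun i : Fin 3 => p i.castSucc) ≠ 0 := by
    intro h
    exact h0 (by funext i; simp [congrFun h i])
  obtain ⟨T, hT⟩ := exists_frame hp0
  rw [upt_mem_surface hf hg] at hPX
  have ef := aeval_algebraMap_comp (K := K) f T.m
  have eg := aeval_algebraMap_comp (K := K) g T.m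
  rw [hT] at ef eg
  have hw : p 3 ^ 2 + eval T.m f * p 3 - eval T.m g = 0 := by
    apply (algebraMap k K).injective
    rw [hT]
    simp only [map_sub, map_add, map_mul, map_pow, map_zero, ← ef, ← eg]
    exact hPX
  have hh : (f ^ 2 + 4 * g).IsHomogeneous 4 := by
    have h4 := hg.C_mul 4
    rw [map_ofNat] at h4
    exact (hf.pow 2).add h4
  have hne : eval T.m f + 2 * p 3 ≠ 0 := by
    intro h
    rw [phi_upt, branch, Set.mem_ofPred_eq] at hPR
    change aeval _ _ ≠ 0 at hPR
    rw [aeval_rep_ne_zero_iff hh, aeval_algebraMap_comp, ← hT] at hPR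
    apply hPR
    rw [map_eq_zero, map_add, map_pow, map_mul, map_ofNat]
    linear_combination (eval T.m f + 2 * p 3) * h - 4 * hw
  obtain ⟨q, P₃, P₄, hq, hqw, hP₃, hP₄, hΦ⟩ := exists_osculating_section T hf hg hw hne
  refine ⟨⟨T, q, P₃, P₄, hf, hg, hq, hP₃, hP₄, ?_, hΦ⟩, ?_⟩
  · rw [map_add, map_mul, map_ofNat, hqw]
    exact hne
  · simp only [Osculation.point, hqw]
    simp only [hT]

end Xi

/-! ### The sections `τ_L` -/

section Tau

variable {k K : Type*} [Field k] [Field K] [Algebra k K]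
variable {f g : MvPolynomial (Fin 3) k}

/-- In coordinates on the line, a parametrisation by an affine line is a substitution of linear
polynomials. -/
theorem Frame.aeval_affine {M : Type*} [Field M] (F : Frame M) (a b : Fin 2 → M)
    (A : MvPolynomial (Fin 3) M) :
    aeval (fun j => Polynomial.C (F.vec a j) + Polynomial.X * Polynomial.C (F.vec b j)) A =
      aeval ![Polynomial.C (a 0) + Polynomial.X * Polynomial.C (b 0),
        Polynomial.C (a 1) + Polynomial.X * Polynomial.C (b 1)] (F.res A) := by
  rw [aeval_res]
  congr 2
  funext j
  simp only [vec, map_add, map_mul, Matrix.cons_val_zero, Matrix.cons_val_one,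
    Polynomial.algebraMap_eq]
  ring

namespace Frame

variable {F : Frame K} {L : ℙ K (Fin 3 → K)}

theorem vec_mem_line (hl : F.l = L.rep) {c : Fin 2 → K} (hc : c ≠ 0) :
    Projectivization.mk K (F.vec c) (F.vec_ne_zero hc) ∈ line L := by
  rw [mk_mem_line, ← hl]
  exact F.l_vec c

variable {τ : line L → U K}

variable [IsAlgClosed K]

/-- A map from the line to `U` that is given by polynomials and is a section of the projection is
given by polynomials of the form `(λ S, w)`. -/
theorem exists_factor_of_isLocalRep (hl : F.l = L.rep) (hs : ∀ S, phi (τ S) = S.1)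
    {h : MvPolynomial (Fin 3) K} {H : Fin 4 → MvPolynomial (Fin 3) K} (hr : IsLocalRep K τ h H)
    (h0 : F.res h ≠ 0) : ∃ (e : ℕ) (r : MvPolynomial (Fin 2) K), r.IsHomogeneous e ∧ r ≠ 0 ∧
      (F.res (H 3)).IsHomogeneous (2 * (e + 1)) ∧
      (∀ i, F.res (H i.castSucc) = r * F.res (X i)) ∧
      ∀ (c : Fin 2 → K) (hc : c ≠ 0), eval c (F.res h) ≠ 0 → eval c r ≠ 0 ∧
        ∀ w, τ ⟨_, vec_mem_line hl hc⟩ = upt _ (F.vec_ne_zero hc) w →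
          eval c (F.res (H 3)) = eval c r ^ 2 * w := by
  obtain ⟨e, he⟩ := hr.homogeneous_H
  -- the coordinates of `τ` are proportional to those of the point
  have hpt : ∀ (c : Fin 2 → K) (hc : c ≠ 0), eval c (F.res h) ≠ 0 → ∀ w,
      τ ⟨_, vec_mem_line hl hc⟩ = upt _ (F.vec_ne_zero hc) w → ∃ a : K, a ≠ 0 ∧
        (∀ i, eval c (F.res (H (Fin.castSucc i))) = a * F.vec c i) ∧
        eval c (F.res (H 3)) = a ^ 2 * w := by
    intro c hc hne w hw
    rw [eval_res] at hne
    obtain ⟨h1, h2⟩ := hr.eq_upt ⟨_, vec_mem_line hl hc⟩ (v := F.vec c) (hv := F.vec_ne_zero hc)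
      rfl hne
    rw [hw] at h2
    simp only [eval_res]
    exact upt_eq_iff.mp h2
  have hex : ∀ (c : Fin 2 → K) (hc : c ≠ 0), ∃ w,
      τ ⟨_, vec_mem_line hl hc⟩ = upt _ (F.vec_ne_zero hc) w := fun c hc => exists_eq_upt (hs _)
  have hX : ∀ (c : Fin 2 → K) (i : Fin 3), eval c (F.res (X i)) = F.vec c i := fun c i => by
    rw [eval_res, eval_X]
  have hcross : ∀ i j : Fin 3, F.res (X i) * F.res (H j.castSucc) =
      F.res (X j) * F.res (H i.castSucc) := by
    intro i j
    refine mul_left_cancel₀ h0 (MvPolynomial.funext fun c => ?_)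
    simp only [map_mul, hX]
    by_cases h1 : eval c (F.res h) = 0
    · simp [h1]
    by_cases hc : c = 0
    · simp [hc, vec]
    obtain ⟨w, hw⟩ := hex c hc
    obtain ⟨a, -, h2, -⟩ := hpt c hc h1 w hw
    rw [h2, h2]
    ring
  have hcomb : ∀ (a : Fin 3 → K) (j : Fin 3), F.res (lin a) * F.res (H j.castSucc) =
      F.res (X j) * ∑ i, C (a i) * F.res (H (Fin.castSucc i)) := by
    intro a j
    rw [lin, map_sum, Finset.sum_mul, Finset.mul_sum]
    refine Finset.sum_congr rfl fun i _ => ?_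
    rw [map_mul, algHom_C, algebraMap_eq]
    linear_combination C (a i) * hcross i j
  set A := ∑ i, C (F.u i) * F.res (H (Fin.castSucc i)) with hA
  set B := ∑ i, C (F.v i) * F.res (H (Fin.castSucc i)) with hB
  have hu : ∀ j : Fin 3, X 0 * F.res (H j.castSucc) = F.res (X j) * A := fun j => by
    rw [← hcomb, res_u]
  have hv : ∀ j : Fin 3, X 1 * F.res (H j.castSucc) = F.res (X j) * B := fun j => by
    rw [← hcomb, res_v]
  have hAB : X 1 * A = X 0 * B := by
    have h1 : ∀ i : Fin 3, X 1 * (C (F.u i) * F.res (H i.castSucc)) =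
        F.res (C (F.u i) * X i) * B := fun i => by
      rw [map_mul, algHom_C, algebraMap_eq]
      linear_combination C (F.u i) * hv i
    rw [hA, Finset.mul_sum, Finset.sum_congr rfl fun i _ => h1 i, ← Finset.sum_mul, ← map_sum]
    change F.res (lin F.u) * B = _
    rw [res_u]
  have hdvd : X 0 ∣ A := by
    refine ((prime_X 0).dvd_or_dvd (Dvd.intro B hAB.symm)).resolve_left ?_
    rw [X_dvd_X]
    simp
  obtain ⟨r, hr⟩ := hdvd
  have hHr : ∀ j : Fin 3, F.res (H j.castSucc) = r * F.res (X j) := fun j => by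
    refine mul_left_cancel₀ (X_ne_zero (0 : Fin 2)) ?_
    rw [hu, hr]; ring
  have hcr : ∀ (c : Fin 2 → K) (hc : c ≠ 0), eval c (F.res h) ≠ 0 → eval c r ≠ 0 ∧
      ∀ w, τ ⟨_, vec_mem_line hl hc⟩ = upt _ (F.vec_ne_zero hc) w →
        eval c (F.res (H 3)) = eval c r ^ 2 * w := by
    intro c hc hne
    have key : ∀ w, τ ⟨_, vec_mem_line hl hc⟩ = upt _ (F.vec_ne_zero hc) w → eval c r ≠ 0 ∧
        eval c (F.res (H 3)) = eval c r ^ 2 * w := by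
      intro w hw
      obtain ⟨a, ha, h1, h2⟩ := hpt c hc hne w hw
      obtain ⟨i, hi⟩ := Function.ne_iff.mp (F.vec_ne_zero hc)
      have h3 := h1 i
      rw [hHr, map_mul, hX] at h3
      rw [mul_right_cancel₀ hi h3]
      exact ⟨ha, h2⟩
    obtain ⟨w, hw⟩ := hex c hc
    exact ⟨(key w hw).1, fun w hw => (key w hw).2⟩
  have hr0 : r ≠ 0 := by
    obtain ⟨c, hc⟩ : ∃ c, eval c (F.res h * X 0) ≠ 0 := by
      by_contra! h1
      exact mul_ne_zero h0 (X_ne_zero 0) (MvPolynomial.funext fun c => by rw [h1, map_zero])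
    rw [map_mul, mul_ne_zero_iff, eval_X] at hc
    have hc0 : c ≠ 0 := by rintro rfl; exact hc.2 rfl
    intro h1
    exact (hcr c hc0 hc.1).1 (by rw [h1, map_zero])
  have hAh : A.IsHomogeneous e := by
    refine IsHomogeneous.sum _ _ _ fun i _ => ?_
    have := he (Fin.castSucc i)
    rw [wt_castSucc, mul_one] at this
    exact (F.isHomogeneous_res this).C_mul _
  cases e with
  | zero =>
    obtain ⟨a, ha⟩ := exists_eq_C_of_isHomogeneous_zero hAh
    have h1 : a = 0 := by
      have := congrArg (eval 0) (ha.symm.trans hr)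
      simpa using this
    rw [h1, C_0] at ha
    rw [ha] at hr
    exact absurd hr.symm (mul_ne_zero (X_ne_zero 0) hr0)
  | succ e =>
    refine ⟨e, r, ?_, hr0, ?_, hHr, hcr⟩
    · have h1 : homogeneousComponent (e + 1) A = A := homogeneousComponent_of_mem hAh |>.trans
        (if_pos rfl)
      have h2 : homogeneousComponent (e + 1) (r * X 0) = homogeneousComponent e r * X 0 :=
        weightedHomogeneousComponent_mul_right (w := 1) (isHomogeneous_X K (0 : Fin 2)) r e
      rw [hr, mul_comm (X 0), h2] at h1
      rw [← mul_right_cancel₀ (X_ne_zero (0 : Fin 2)) h1]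
      exact homogeneousComponent_isHomogeneous e r
    · have := F.isHomogeneous_res (he 3)
      rwa [mul_comm] at this

/-- A section of the projection over a line is given by a quadratic form: the last coordinate is a
quotient of two forms whose degrees differ by two, and the denominator is constant because it has no
zeros. -/
theorem exists_quadratic_form (hl : F.l = L.rep) (hm : IsMorphism K τ)
    (hs : ∀ S, phi (τ S) = S.1) : ∃ R : MvPolynomial (Fin 2) K, R.IsHomogeneous 2 ∧
      ∀ (h : MvPolynomial (Fin 3) K) (H : Fin 4 → MvPolynomial (Fin 3) K), IsLocalRep K τ h H →
        F.res h ≠ 0 → ∃ r : MvPolynomial (Fin 2) K, r ≠ 0 ∧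
          (∀ i : Fin 3, F.res (H i.castSucc) = r * F.res (X i)) ∧ F.res (H 3) = r ^ 2 * R := by
  -- any two local representations agree
  have hcomp : ∀ {h h' : MvPolynomial (Fin 3) K} {H₃ H₃' r r' : MvPolynomial (Fin 2) K},
      F.res h ≠ 0 → F.res h' ≠ 0 →
      (∀ (c : Fin 2 → K) (hc : c ≠ 0), eval c (F.res h) ≠ 0 → eval c r ≠ 0 ∧
        ∀ w, τ ⟨_, vec_mem_line hl hc⟩ = upt _ (F.vec_ne_zero hc) w →
          eval c H₃ = eval c r ^ 2 * w) →
      (∀ (c : Fin 2 → K) (hc : c ≠ 0), eval c (F.res h') ≠ 0 → eval c r' ≠ 0 ∧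
        ∀ w, τ ⟨_, vec_mem_line hl hc⟩ = upt _ (F.vec_ne_zero hc) w →
          eval c H₃' = eval c r' ^ 2 * w) →
      H₃ * r' ^ 2 = H₃' * r ^ 2 := by
    intro h h' H₃ H₃' r r' h0 h0' h1 h2
    refine mul_left_cancel₀ (mul_ne_zero (mul_ne_zero h0 h0') (X_ne_zero 0))
      (MvPolynomial.funext fun c => ?_)
    simp only [map_mul, map_pow, eval_X]
    by_cases hc0 : c 0 = 0
    · simp [hc0]
    by_cases hh : eval c (F.res h) = 0
    · simp [hh]
    by_cases hh' : eval c (F.res h') = 0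
    · simp [hh']
    have hc : c ≠ 0 := by rintro rfl; exact hc0 rfl
    obtain ⟨w, hw⟩ := exists_eq_upt (hs ⟨_, vec_mem_line hl hc⟩)
    rw [(h1 c hc hh).2 w hw, (h2 c hc hh').2 w hw]
    ring
  -- around every point there is a local representation
  have hloc : ∀ c : Fin 2 → K, c ≠ 0 → ∃ (h : MvPolynomial (Fin 3) K)
      (H : Fin 4 → MvPolynomial (Fin 3) K), IsLocalRep K τ h H ∧ eval c (F.res h) ≠ 0 := by
    intro c hc
    obtain ⟨h, H, hr, hne⟩ := hm ⟨_, vec_mem_line hl hc⟩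
    obtain ⟨d, hd⟩ := hr.homogeneous_h
    refine ⟨h, H, hr, ?_⟩
    rw [eval_res]
    exact (aeval_rep_ne_zero_iff hd (F.vec_ne_zero hc)).mp hne
  obtain ⟨h, H, hr, hne⟩ := hloc ![0, 1] (fun h => one_ne_zero (congrFun h 1))
  have h0 : F.res h ≠ 0 := by rintro h1; rw [h1, map_zero] at hne; exact hne rfl
  obtain ⟨e, r, hrh, hr0, hH₃, -, hrc⟩ := exists_factor_of_isLocalRep hl hs hr h0
  obtain ⟨d, D, N, G, -, hD, hD0, hN, -, -, hG0, hGD, hGN, hco⟩ :=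
    exists_gcd_binary_forms K (hrh.pow 2) hH₃ (Or.inl (pow_ne_zero 2 hr0))
  have hde : ¬ e * 2 < d := fun hlt => pow_ne_zero 2 hr0 (by rw [hGD, hD0 hlt, mul_zero])
  have hnz : e * 2 - d = 0 := by
    by_contra hpos
    obtain ⟨c, hc, hcD⟩ := exists_zero_of_binary_form (K := K) hD hpos
    obtain ⟨h', H', hr', hne'⟩ := hloc c hc
    have h0' : F.res h' ≠ 0 := by rintro h1; rw [h1, map_zero] at hne'; exact hne' rfl
    obtain ⟨e', r', -, -, -, -, hrc'⟩ := exists_factor_of_isLocalRep hl hs hr' h0'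
    have h1 := hcomp h0 h0' hrc hrc'
    rw [hGN, hGD] at h1
    have h2 : N * r' ^ 2 = F.res (H' 3) * D := mul_left_cancel₀ hG0 (by linear_combination h1)
    have h3 := congrArg (aeval c) h2
    rw [map_mul, map_mul, hcD, mul_zero, map_pow] at h3
    exact (mul_eq_zero.mp h3).elim (hco c hc hcD) (pow_ne_zero 2 (hrc' c hc hne').1)
  rw [hnz] at hD
  obtain ⟨a, rfl⟩ := exists_eq_C_of_isHomogeneous_zero hD
  have ha : a ≠ 0 := by
    rintro rfl
    rw [C_0, mul_zero] at hGD
    exact pow_ne_zero 2 hr0 hGD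
  have hN2 : N.IsHomogeneous 2 := by
    convert hN using 1
    omega
  refine ⟨C a⁻¹ * N, hN2.C_mul _, fun h' H' hr' h0' => ?_⟩
  obtain ⟨e', r', -, hr0', -, hHr', hrc'⟩ := exists_factor_of_isLocalRep hl hs hr' h0'
  refine ⟨r', hr0', hHr', ?_⟩
  have h1 := hcomp h0 h0' hrc hrc'
  rw [hGN, hGD] at h1
  have h2 : N * r' ^ 2 = F.res (H' 3) * C a := mul_left_cancel₀ hG0 (by linear_combination h1)
  have h3 : (C a : MvPolynomial (Fin 2) K) * C a⁻¹ = 1 := by rw [← C_mul, mul_inv_cancel₀ ha, C_1]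
  linear_combination -F.res (H' 3) * h3 - C a⁻¹ * h2

end Frame

end Tau

/-! ### Existence and uniqueness of `τ_L` -/

section TauUnique

variable {k K : Type*} [Field k] [Field K] [Algebra k K]
variable {f g : MvPolynomial (Fin 3) k}

theorem Frame.vec_linearIndependent {M : Type*} [Field M] (F : Frame M) {a b : Fin 2 → M}
    (h : LinearIndependent M ![F.vec a, F.vec b]) : a 0 * b 1 - b 0 * a 1 ≠ 0 := by
  intro h0
  have h1 : ∀ x y : M, (∀ j, x * a j + y * b j = 0) → x = 0 ∧ y = 0 := fun x y hxy => by
    refine LinearIndependent.pair_iff.mp h x y (funext fun i => ?_)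
    simp only [vec, Pi.add_apply, Pi.smul_apply, smul_eq_mul, Pi.zero_apply]
    linear_combination F.s i * hxy 0 + F.p i * hxy 1
  have h2 := h1 (b 1) (-a 1) fun j => by
    fin_cases j
    · simp only [Fin.zero_eta]; linear_combination h0
    · simp only [Fin.mk_one]; ring
  have h3 := h1 (b 0) (-a 0) fun j => by
    fin_cases j
    · simp only [Fin.zero_eta]; ring
    · simp only [Fin.mk_one]; linear_combination -h0
  have h4 := h1 1 0 fun j => by
    fin_cases j
    · simp only [Fin.zero_eta]; linear_combination -h3.2
    · simp only [Fin.mk_one]; linear_combination -h2.2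
  exact one_ne_zero h4.1

theorem dotProduct_rep_eq_zero {L S : ℙ K (Fin 3 → K)} (h : S ∈ line L) :
    ∑ i, L.rep i * S.rep i = 0 := by
  have h1 := mk_mem_line (L := L) S.rep_nonzero
  rw [Projectivization.mk_rep] at h1
  exact h1.mp h

/-- The equation of the surface on a parametrised curve above a line. -/
theorem Frame.aeval_affine_surfacePoly (hf : f.IsHomogeneous 2) (hg : g.IsHomogeneous 4)
    (F : Frame K) (a b : Fin 2 → K) {r : Polynomial K}
    {y : Fin 4 → Polynomial K} {R : MvPolynomial (Fin 2) K}
    (hy : ∀ i : Fin 3, y i.castSucc = r * (Polynomial.C (F.vec a i) +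
      Polynomial.X * Polynomial.C (F.vec b i)))
    (hR : y 3 = r ^ 2 * aeval ![Polynomial.C (a 0) + Polynomial.X * Polynomial.C (b 0),
        Polynomial.C (a 1) + Polynomial.X * Polynomial.C (b 1)] R) :
    aeval y (MvPolynomial.map (algebraMap k K) (surfacePoly f g)) =
      r ^ 4 * aeval ![Polynomial.C (a 0) + Polynomial.X * Polynomial.C (b 0),
        Polynomial.C (a 1) + Polynomial.X * Polynomial.C (b 1)]
          (R ^ 2 + F.res (MvPolynomial.map (algebraMap k K) f) * R -
            F.res (MvPolynomial.map (algebraMap k K) g)) := by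
  have hf' : (MvPolynomial.map (algebraMap k K) f).IsHomogeneous 2 :=
    isWeightedHomogeneous_map _ hf
  have hg' : (MvPolynomial.map (algebraMap k K) g).IsHomogeneous 4 :=
    isWeightedHomogeneous_map _ hg
  rw [← cvec_eta y, map_surfacePoly, aeval_cvec_surfacePoly, hR, funext hy, hf'.aeval_smul',
    hg'.aeval_smul', F.aeval_affine, F.aeval_affine]
  simp only [map_add, map_sub, map_mul, map_pow]
  ring

namespace Osculation

variable [IsAlgClosed K] (O : Osculation f g)

theorem isTau_xi (L : linesThrough (phi (O.point K))) :
    IsTau f g (O.point K) L (fun S => O.xi K S.1) where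
  morphism S := ⟨_, _, (O.isLocalRep_xi (line L.1)).map, by simp⟩
  sec S := O.phi_xi S.1
  through := O.xi_phi_point
  meets := by
    obtain ⟨γ, δ, h, hl⟩ := O.exists_frame L
    set F := (O.T.map (algebraMap k K)).ofPencil _ _ γ δ h with hF
    obtain ⟨c, hc⟩ := Projectivization.exists_smul_eq_mk_rep K _ (O.map_m_ne_zero K)
    have hrep : (phi (O.point K)).rep = F.vec ![0, (c : K)] := by
      rw [phi_point, ← hc]
      funext i
      simp [Frame.vec, hF, Frame.ofPencil, Frame.map, mul_comm, Units.smul_def]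
    have hs : F.s = F.vec ![1, 0] := by
      funext i; simp [Frame.vec]
    refine ⟨_, _, F.s, (O.isLocalRep_xi (line L.1)).map, by simp, ?_, ?_, ?_⟩
    · rw [hrep, hs, LinearIndependent.pair_iff]
      intro x y hxy
      have h1 : F.vec ![y, x * c] = 0 := by
        rw [← hxy]
        funext i
        simp only [Frame.vec, Matrix.cons_val_zero, Matrix.cons_val_one, Pi.add_apply,
          Pi.smul_apply, smul_eq_mul]
        ring
      by_contra h2
      refine F.vec_ne_zero (c := ![y, x * c]) (fun h3 => h2 ⟨?_, congrFun h3 0⟩) h1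
      exact (mul_eq_zero.mp (congrFun h3 1)).resolve_right c.ne_zero
    · rw [← hl]
      exact F.l_s
    · rw [hrep, hs, F.aeval_affine_surfacePoly O.hf O.hg ![0, (c : K)] ![1, 0] (r := 1)
        (R := F.res (MvPolynomial.map (algebraMap k K) O.q))]
      · rw [one_pow, one_mul]
        have h1 := O.res_eq (algebraMap k K) h
        simp only [map_sub, map_add, map_mul, map_pow] at h1
        rw [← hF] at h1
        rw [h1, map_mul, map_pow, aeval_X]
        refine Dvd.intro _ (congrArg₂ _ ?_ rfl)
        simp
      · intro i
        simp
      · change aeval _ (MvPolynomial.map _ (cvec X O.q 3)) = _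
        rw [cvec_three, one_pow, one_mul, ← F.aeval_affine]

theorem isTau_unique (L : linesThrough (phi (O.point K))) {τ : line L.1 → U K}
    (hτ : IsTau f g (O.point K) L τ) : τ = fun S => O.xi K S.1 := by
  obtain ⟨γ, δ, h, hl⟩ := O.exists_frame L
  set F := (O.T.map (algebraMap k K)).ofPencil _ _ γ δ h with hF
  obtain ⟨R, hR, hRr⟩ := F.exists_quadratic_form hl hτ.morphism hτ.sec
  set q := MvPolynomial.map (algebraMap k K) O.q with hq
  have hq2 : q.IsHomogeneous 2 := isWeightedHomogeneous_map _ O.hq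
  have hev : ∀ v : Fin 3 → K, aeval v O.q = eval v q := fun v => by
    rw [hq, MvPolynomial.eval_map, aeval_def]
  have hRq : R = F.res q := by
    obtain ⟨h, H, v, hr, hne, hind, hv, hdvd⟩ := hτ.meets
    obtain ⟨c, hc⟩ := Projectivization.exists_smul_eq_mk_rep K _ (O.map_m_ne_zero K)
    set a : Fin 2 → K := ![0, (c : K)] with ha
    have hrep : (phi (O.point K)).rep = F.vec a := by
      rw [phi_point, ← hc]
      funext i
      simp [Frame.vec, hF, Frame.ofPencil, Frame.map, mul_comm, Units.smul_def, ha]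
    rw [← hl] at hv
    obtain ⟨b, hb⟩ : ∃ b, v = F.vec b := ⟨_, F.exists_eq_vec hv⟩
    have hne' : eval a (F.res h) ≠ 0 := by
      rw [F.eval_res, ← hrep]
      exact hne
    obtain ⟨r, -, hrX, hr3⟩ := hRr h H hr fun h0 => hne' (by rw [h0, map_zero])
    have hva : ∀ i : Fin 3, eval a (F.res (H i.castSucc)) = eval a r * F.vec a i := fun i => by
      rw [hrX, map_mul, F.eval_res a (X i), eval_X]
    -- the values at the point of contact
    obtain ⟨hr0, hRa⟩ : eval a r ≠ 0 ∧ eval a R = eval a (F.res q) := by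
      obtain ⟨h1, h2⟩ := hr.eq_upt ⟨phi (O.point K), L.2⟩ (hv := Projectivization.rep_nonzero _)
        (Projectivization.mk_rep _) hne
      obtain ⟨t, ht, h3, h4⟩ := upt_eq_iff.mp (O.xi_phi_point.trans (hτ.through.symm.trans h2))
      obtain ⟨i, hi⟩ := Function.ne_iff.mp (phi (O.point K)).rep_nonzero
      have h5 := h3 i
      rw [hrep] at h5 h4 hi
      change eval _ _ = _ at h5
      rw [← F.eval_res, hva] at h5
      have h6 := mul_right_cancel₀ hi h5
      change eval _ _ = _ at h4
      rw [← F.eval_res, hr3, map_mul, map_pow, h6, hev, ← F.eval_res] at h4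
      exact ⟨h6 ▸ ht, mul_left_cancel₀ (pow_ne_zero 2 ht) h4⟩
    set θ : MvPolynomial (Fin 2) K →ₐ[K] Polynomial K :=
      aeval ![Polynomial.C (a 0) + Polynomial.X * Polynomial.C (b 0),
        Polynomial.C (a 1) + Polynomial.X * Polynomial.C (b 1)] with hθ
    have hθ0 : ∀ A, (θ A).eval 0 = eval a A := fun A => by
      have h1 : (Polynomial.aeval (0 : K)).comp θ = aeval a := by
        ext1 i
        fin_cases i <;> simp [hθ]
      exact DFunLike.congr_fun h1 A
    rw [hrep, hb, F.aeval_affine_surfacePoly O.hf O.hg a b (r := θ r) (R := R)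
      (fun i => by
        rw [F.aeval_affine, hrX, map_mul, ← F.aeval_affine a b (X i), aeval_X])
      (by rw [F.aeval_affine, hr3, map_mul, map_pow])] at hdvd
    have hΦ : Polynomial.X ^ 3 ∣ θ (F.res (q ^ 2 + MvPolynomial.map (algebraMap k K) f * q -
        MvPolynomial.map (algebraMap k K) g)) := by
      obtain ⟨z, hz⟩ := (O.osculates (algebraMap k K) ‹_›).dvd
      rw [← hF] at hz
      rw [hz, map_mul, map_pow]
      have h1 : θ (X 0) = Polynomial.X * Polynomial.C (b 0) := by
        rw [hθ, aeval_X]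
        simp [ha]
      rw [h1, mul_pow, mul_assoc]
      exact dvd_mul_right _ _
    have hcop : ∀ {y : Polynomial K}, y.eval 0 ≠ 0 → IsCoprime (Polynomial.X ^ 3) y :=
      fun {y} hy => by
        refine IsCoprime.pow_left ((Polynomial.irreducible_X.coprime_iff_not_dvd).mpr ?_)
        rwa [Polynomial.X_dvd_iff, Polynomial.coeff_zero_eq_eval_zero]
    have h1 := (hcop (y := θ r ^ 4) (by
      rw [Polynomial.eval_pow, hθ0]; exact pow_ne_zero 4 hr0)).dvd_of_dvd_mul_left hdvd
    have h2 : θ (R ^ 2 + F.res (MvPolynomial.map (algebraMap k K) f) * R -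
        F.res (MvPolynomial.map (algebraMap k K) g)) =
        θ (R + F.res (MvPolynomial.map (algebraMap k K) f + q)) * θ (R - F.res q) +
        θ (F.res (q ^ 2 + MvPolynomial.map (algebraMap k K) f * q -
          MvPolynomial.map (algebraMap k K) g)) := by
      simp only [map_add, map_sub, map_mul, map_pow]
      ring
    have h3 : Polynomial.X ^ 3 ∣
        θ (R + F.res (MvPolynomial.map (algebraMap k K) f + q)) * θ (R - F.res q) := by
      rw [h2] at h1
      exact (dvd_add_left hΦ).mp h1
    have h4 : eval a (R + F.res (MvPolynomial.map (algebraMap k K) f + q)) ≠ 0 := by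
      have h5 : eval a (R + F.res (MvPolynomial.map (algebraMap k K) f + q)) =
          eval a (F.res (MvPolynomial.map (algebraMap k K) f + 2 * q)) := by
        rw [map_add, hRa, ← map_add, ← map_add]
        congr 2
        ring
      have h6 : (MvPolynomial.map (algebraMap k K) f + 2 * q).IsHomogeneous 2 := by
        have := (isWeightedHomogeneous_map (algebraMap k K) O.hf).add (hq2.C_mul 2)
        rwa [map_ofNat] at this
      have h7 : F.vec a = fun i => (c : K) * F.p i := by
        funext i
        simp [Frame.vec, ha, mul_comm]
      rw [h5, F.eval_res, h7, ← aeval_eq_eval, h6.aeval_smul']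
      exact mul_ne_zero (pow_ne_zero 2 c.ne_zero)
        (O.osculates (algebraMap k K) ‹_›).ne
    have h5 := (hcop (y := θ (R + F.res (MvPolynomial.map (algebraMap k K) f + q))) (by
      rwa [hθ0])).dvd_of_dvd_mul_left h3
    have hhom : (R - F.res q).IsHomogeneous 2 := hR.sub (F.isHomogeneous_res hq2)
    have hdeg : (θ (R - F.res q)).natDegree ≤ 2 := by
      refine (aeval_natDegree_le (n := 1) _ hhom.totalDegree_le _ fun i => ?_).trans (by simp)
      fin_cases i
      all_goals
        simp only [Fin.zero_eta, Fin.mk_one, Matrix.cons_val_zero, Matrix.cons_val_one]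
        compute_degree
    have h6 : θ (R - F.res q) = 0 := by
      refine Polynomial.eq_zero_of_dvd_of_natDegree_lt h5 ?_
      rw [Polynomial.natDegree_X_pow]
      omega
    refine sub_eq_zero.mp (eq_zero_of_aeval_affine hhom (F.vec_linearIndependent ?_) h6)
    rwa [← hrep, ← hb]
  funext S
  obtain ⟨h, H, hr, hne⟩ := hτ.morphism S
  obtain ⟨a, ha⟩ : ∃ a, S.1.rep = F.vec a := by
    refine ⟨_, F.exists_eq_vec ?_⟩
    rw [hl]
    exact dotProduct_rep_eq_zero S.2
  obtain ⟨h1, h2⟩ := hr.eq_upt S (hv := Projectivization.rep_nonzero _)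
    (Projectivization.mk_rep _) hne
  obtain ⟨r, -, hrX, hr3⟩ := hRr h H hr fun h0 => hne (by
    change eval _ _ = 0
    rw [ha, ← F.eval_res, h0, map_zero])
  have h3 : ∀ i : Fin 3, aeval S.1.rep (H i.castSucc) = eval a r * S.1.rep i := fun i => by
    rw [ha]
    change eval _ _ = _
    rw [← F.eval_res, hrX, map_mul, F.eval_res a (X i), eval_X]
  rw [h2, Osculation.xi]
  refine (upt_eq_iff.mpr ⟨eval a r, ?_, h3, ?_⟩).symm
  · intro h0
    exact h1 (funext fun i => by rw [h3, h0, zero_mul]; rfl)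
  · rw [hev, ha]
    change eval _ _ = _
    rw [← F.eval_res, hr3, map_mul, map_pow, hRq, ← F.eval_res]

end Osculation

end TauUnique

/-! ### Maps on a pencil of lines -/

section Pencil

variable {k K : Type*} [Field k] [Field K] [Algebra k K]

/-- The frame of the dual plane. -/
def Frame.dualFrame {M : Type*} [Field M] (T : Frame M) : Frame M where
  p := T.v
  s := T.u
  m := T.l
  v := T.p
  u := T.s
  l := T.m
  dual i j := by
    have h := T.dual j i
    rw [show (if i = j then (1 : M) else 0) = if j = i then 1 else 0 by simp only [eq_comm], ← h]
    ring

/-- The coefficients of the members of the pencil of lines spanned by `a` and `b`, as linear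
polynomials. -/
def pencilHom (a b : Fin 3 → k) : MvPolynomial (Fin 3) k →ₐ[k] MvPolynomial (Fin 2) k :=
  aeval fun i => C (a i) * X 0 + C (b i) * X 1

/-- The coefficients of a member of the pencil of lines spanned by `a` and `b`. -/
def member {S : Type*} [CommRing S] [Algebra k S] (a b : Fin 3 → k) (c : Fin 2 → S) : Fin 3 → S :=
  fun i => algebraMap k S (a i) * c 0 + algebraMap k S (b i) * c 1

theorem aeval_pencilHom {S : Type*} [CommRing S] [Algebra k S] (a b : Fin 3 → k) (c : Fin 2 → S)
    (A : MvPolynomial (Fin 3) k) : aeval c (pencilHom a b A) = aeval (member a b c) A := by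
  rw [pencilHom, ← AlgHom.comp_apply, comp_aeval]
  simp
  rfl

theorem isHomogeneous_pencilHom (a b : Fin 3 → k) {A : MvPolynomial (Fin 3) k} {n : ℕ}
    (hA : A.IsHomogeneous n) : (pencilHom a b A).IsHomogeneous n :=
  IsWeightedHomogeneous.aeval_weight (w := 1) (w' := 1) hA fun i =>
    IsHomogeneous.add (isHomogeneous_C_mul_X (a i) 0) (isHomogeneous_C_mul_X (b i) 1)

theorem aeval_genericLine (a b : Fin 3 → k) (A : MvPolynomial (Fin 3) k) :
    aeval (genericLine a b) A = aeval ![1, RatFunc.X] (pencilHom a b A) := by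
  rw [aeval_pencilHom]
  congr 2
  funext i
  simp only [genericLine, member, RatFunc.algebraMap_eq_C, Matrix.cons_val_zero,
    Matrix.cons_val_one]
  ring

theorem aeval_genericLine_eq_zero_iff (a b : Fin 3 → k) {A : MvPolynomial (Fin 3) k} {n : ℕ}
    (hA : A.IsHomogeneous n) : aeval (genericLine a b) A = 0 ↔ pencilHom a b A = 0 := by
  rw [aeval_genericLine]
  refine ⟨fun h => ?_, fun h => by rw [h, map_zero]⟩
  by_contra h0
  refine aeval_generic_ne_zero (isHomogeneous_pencilHom a b hA) h0 (a₁ := 1) (a₂ := 0) (b₁ := 0)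
    (b₂ := 1) (by simp) ?_
  simpa using h

/-- The lines `a` and `b` over `k` span the pencil of lines through `Q`. -/
structure SpansPencil (a b : Fin 3 → k) (Q : ℙ K (Fin 3 → K)) : Prop where
  ne : ∀ c : Fin 2 → K, c ≠ 0 → member a b c ≠ 0
  mem : ∀ (c : Fin 2 → K) (h : member a b c ≠ 0), Projectivization.mk K _ h ∈ linesThrough Q
  exists_eq : ∀ L ∈ linesThrough Q, ∃ c : Fin 2 → K, c ≠ 0 ∧ L.rep = member a b c

theorem spansPencil_of_linearIndependent (T : Frame k)
    {Q : ℙ K (Fin 3 → K)} {t : K} (ht : t ≠ 0) (hQ : ∀ i, Q.rep i = t * algebraMap k K (T.m i))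
    {a b : Fin 3 → k} (hab : LinearIndependent k ![a, b])
    (ha : dotProduct (fun i => algebraMap k K (a i)) Q.rep = 0)
    (hb : dotProduct (fun i => algebraMap k K (b i)) Q.rep = 0) :
    (∑ i, a i * T.m i = 0 ∧ ∑ i, b i * T.m i = 0) ∧ SpansPencil a b Q := by
  have hdot : ∀ x : Fin 3 → k, dotProduct (fun i => algebraMap k K (x i)) Q.rep = 0 →
      ∑ i, x i * T.m i = 0 := by
    intro x hx
    have h1 : dotProduct (fun i => algebraMap k K (x i)) Q.rep =
        t * algebraMap k K (∑ i, x i * T.m i) := by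
      simp only [dotProduct, map_sum, map_mul, Finset.mul_sum, hQ]
      exact Finset.sum_congr rfl fun i _ => by ring
    rw [h1, mul_eq_zero, or_iff_right ht, map_eq_zero] at hx
    exact hx
  refine ⟨⟨hdot a ha, hdot b hb⟩, ?_⟩
  obtain ⟨a', rfl⟩ : ∃ a', a = T.dualFrame.vec a' := ⟨_, T.dualFrame.exists_eq_vec (by
    rw [← hdot a ha]; exact Finset.sum_congr rfl fun i _ => mul_comm _ _)⟩
  obtain ⟨b', rfl⟩ : ∃ b', b = T.dualFrame.vec b' := ⟨_, T.dualFrame.exists_eq_vec (by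
    rw [← hdot b hb]; exact Finset.sum_congr rfl fun i _ => mul_comm _ _)⟩
  have hdet := T.dualFrame.vec_linearIndependent hab
  set Δ := a' 0 * b' 1 - b' 0 * a' 1 with hΔ
  have hdetK : algebraMap k K Δ ≠ 0 := (map_ne_zero _).mpr hdet
  set T' := (T.map (algebraMap k K)).dualFrame with hT'
  have hmem : ∀ c : Fin 2 → K, member (T.dualFrame.vec a') (T.dualFrame.vec b') c =
      T'.vec fun j => algebraMap k K (a' j) * c 0 + algebraMap k K (b' j) * c 1 := by
    intro c
    funext i
    simp only [member, Frame.vec, Frame.dualFrame, Frame.map, map_add, map_mul, hT']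
    ring
  refine ⟨fun c hc => ?_, fun c h => ?_, fun L hL => ?_⟩
  · rw [hmem]
    refine T'.vec_ne_zero fun h => hc ?_
    have h0 := congrFun h 0
    have h1 := congrFun h 1
    simp only [Pi.zero_apply] at h0 h1
    have h2 : algebraMap k K Δ * c 0 = 0 := by
      rw [hΔ]; simp only [map_sub, map_mul]
      linear_combination algebraMap k K (b' 1) * h0 - algebraMap k K (b' 0) * h1
    have h3 : algebraMap k K Δ * c 1 = 0 := by
      rw [hΔ]; simp only [map_sub, map_mul]
      linear_combination algebraMap k K (a' 0) * h1 - algebraMap k K (a' 1) * h0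
    funext j
    fin_cases j
    · exact (mul_eq_zero.mp h2).resolve_left hdetK
    · exact (mul_eq_zero.mp h3).resolve_left hdetK
  · change (Projectivization.mk K _ h).orthogonal Q
    rw [Projectivization.orthogonal_comm, ← Set.mem_ofPred_eq (p := fun S => Q.orthogonal S)]
    refine (mk_mem_line (L := Q) h).mpr ?_
    simp only [hmem, dotProduct, hQ, mul_assoc, ← Finset.mul_sum]
    refine mul_eq_zero_of_right _ (T'.l_vec _)
  · have h1 : ∑ i, T'.l i * L.rep i = 0 := by
      have h2 := dotProduct_rep_eq_zero (L := L) (S := Q) hL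
      simp only [hQ] at h2
      refine mul_left_cancel₀ ht ?_
      rw [mul_zero, ← h2, Finset.mul_sum]
      refine Finset.sum_congr rfl fun i _ => ?_
      change t * (algebraMap k K (T.m i) * L.rep i) = _
      ring
    set c' : Fin 2 → K := ![∑ i, T'.u i * L.rep i, ∑ i, T'.v i * L.rep i] with hc'
    have h2 : L.rep = T'.vec c' := T'.exists_eq_vec h1
    refine ⟨![(algebraMap k K Δ)⁻¹ * (algebraMap k K (b' 1) * c' 0 - algebraMap k K (b' 0) * c' 1),
      (algebraMap k K Δ)⁻¹ * (algebraMap k K (a' 0) * c' 1 - algebraMap k K (a' 1) * c' 0)], ?_, ?_⟩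
    · intro h
      refine L.rep_nonzero ?_
      have h3 := congrFun h 0
      have h4 := congrFun h 1
      simp only [Matrix.cons_val_zero, Matrix.cons_val_one, Pi.zero_apply, mul_eq_zero,
        inv_eq_zero, hdetK, false_or] at h3 h4
      have h5 : algebraMap k K Δ * c' 0 = 0 := by
        rw [hΔ]; simp only [map_sub, map_mul]
        linear_combination algebraMap k K (a' 0) * h3 + algebraMap k K (b' 0) * h4
      have h6 : algebraMap k K Δ * c' 1 = 0 := by
        rw [hΔ]; simp only [map_sub, map_mul]
        linear_combination algebraMap k K (a' 1) * h3 + algebraMap k K (b' 1) * h4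
      rw [h2]
      funext i
      simp only [Frame.vec, (mul_eq_zero.mp h5).resolve_left hdetK,
        (mul_eq_zero.mp h6).resolve_left hdetK, mul_zero, add_zero, Pi.zero_apply]
    · rw [h2, hmem]
      congr 1
      funext j
      have h3 : (algebraMap k K Δ)⁻¹ * (algebraMap k K (a' 0) * algebraMap k K (b' 1) -
          algebraMap k K (b' 0) * algebraMap k K (a' 1)) = 1 := by
        rw [← map_mul, ← map_mul, ← map_sub, ← hΔ, inv_mul_cancel₀ hdetK]
      fin_cases j
      · simp only [Fin.zero_eta, Matrix.cons_val_zero, Matrix.cons_val_one]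
        linear_combination (-c' 0) * h3
      · simp only [Fin.mk_one, Matrix.cons_val_zero, Matrix.cons_val_one]
        linear_combination (-c' 1) * h3

end Pencil

section PencilMaps

variable {k K : Type*} [Field k] [Field K] [Algebra k K]

theorem upt_eq_upt_of_mul_eq {v v' : Fin 3 → K} {hv : v ≠ 0} {hv' : v' ≠ 0} {w w' : K}
    (h1 : ∀ i j, v i * v' j = v j * v' i) (h2 : ∀ i, v i ^ 2 * w' = w * v' i ^ 2) :
    upt v hv w = upt v' hv' w' := by
  obtain ⟨i, hi⟩ := Function.ne_iff.mp hv
  change v i ≠ 0 at hi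
  have h3 : ∀ j, v' j = v' i / v i * v j := fun j => by
    field_simp
    linear_combination h1 i j
  refine upt_eq_iff.mpr ⟨v' i / v i, fun h0 => hv' (funext fun j => ?_), h3, ?_⟩
  · rw [h3, h0, zero_mul]; rfl
  · field_simp
    linear_combination h2 i

theorem mul_eq_of_upt_eq_upt {v v' : Fin 3 → K} {hv : v ≠ 0} {hv' : v' ≠ 0} {w w' : K}
    (h : upt v hv w = upt v' hv' w') :
    (∀ i j, v i * v' j = v j * v' i) ∧ ∀ i, v i ^ 2 * w' = w * v' i ^ 2 := by
  obtain ⟨c, -, h1, h2⟩ := upt_eq_iff.mp h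
  refine ⟨fun i j => ?_, fun i => ?_⟩
  · rw [h1, h1]; ring
  · rw [h1, h2]; ring

/-- Two vectors of homogeneous coordinates define the same ideal if they satisfy the equations that
express that they define the same point. -/
theorem pointIdeal_eq_of_mul_eq {M : Type*} [Field M] {v v' : Fin 4 → M} {i₀ j₀ : Fin 3}
    (hv : v i₀.castSucc ≠ 0) (hv' : v' j₀.castSucc ≠ 0)
    (h1 : ∀ i j : Fin 3, v i.castSucc * v' j.castSucc = v j.castSucc * v' i.castSucc)
    (h2 : ∀ i : Fin 3, v i.castSucc ^ 2 * v' 3 = v 3 * v' i.castSucc ^ 2) :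
    pointIdeal v' = pointIdeal v := by
  set t := v' i₀.castSucc / v i₀.castSucc with ht
  have h3 : ∀ j : Fin 3, v' j.castSucc = t * v j.castSucc := fun j => by
    rw [ht]
    field_simp
    linear_combination h1 i₀ j
  have ht0 : t ≠ 0 := fun h0 => hv' (by rw [h3, h0, zero_mul])
  rw [← pointIdeal_smul ht0 v]
  congr 1
  funext i
  induction i using Fin.lastCases with
  | last =>
    change v' 3 = t ^ 2 * v 3
    rw [ht]
    field_simp
    linear_combination h2 i₀
  | cast i => rw [h3, wt_castSucc, pow_one]

variable {a b : Fin 3 → k} {Q : ℙ K (Fin 3 → K)} {σ σ' : linesThrough Q → U K}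

/-- The value of a constant map at the generic line. -/
theorem isGenericValue_const {m : Fin 3 → k} (hm : (fun i => algebraMap k K (m i)) ≠ 0) (w : k) :
    IsGenericValue a b (fun _ : linesThrough Q => upt _ hm (algebraMap k K w))
      (cvec (fun i => algebraMap k (RatFunc k) (m i)) (algebraMap k (RatFunc k) w)) := by
  refine ⟨1, cvec (fun i => C (m i)) (C w), ⟨⟨0, isHomogeneous_one _ _⟩, ⟨0, fun i => ?_⟩,
    fun s v hv hs _ => ?_⟩, by simp, ?_⟩
  · rw [zero_mul]
    induction i using Fin.lastCases with
    | last => exact (cvec_three (fun i => C (m i)) (C w)).symm ▸ isHomogeneous_C _ _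
    | cast i => rw [cvec_castSucc]; exact isHomogeneous_C _ _
  · have h1 : (fun i => aeval v (cvec (fun i => C (m i)) (C w) i)) =
        cvec (fun i => algebraMap k K (m i)) (algebraMap k K w) := by
      rw [← cvec_eta fun i => aeval v (cvec (fun i => C (m i)) (C w) i), cvec_three]
      simp
    simp only [h1]
    exact ⟨cvec_ne_zero hm _, rfl⟩
  · rw [← cvec_eta fun i => aeval (genericLine a b) (cvec (fun i => C (m i)) (C w) i), cvec_three]
    simp

theorem SpansPencil.exists_localRep (hab : SpansPencil a b Q) (hσ : IsMorphism k σ)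
    {c : Fin 2 → K} (hc : member a b c ≠ 0) :
    ∃ (h : MvPolynomial (Fin 3) k) (H : Fin 4 → MvPolynomial (Fin 3) k),
      IsLocalRep k σ h H ∧ aeval (member a b c) h ≠ 0 ∧ pencilHom a b h ≠ 0 := by
  obtain ⟨h, H, hr, hne⟩ := hσ ⟨_, hab.mem c hc⟩
  obtain ⟨d, hd⟩ := hr.homogeneous_h
  rw [aeval_rep_ne_zero_iff hd] at hne
  refine ⟨h, H, hr, hne, fun h0 => hne ?_⟩
  rw [← aeval_pencilHom, h0, map_zero]

variable [IsAlgClosed K]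

theorem eq_zero_of_forall_aeval_eq_zero (K : Type*) [Field K] [Algebra k K] [IsAlgClosed K]
    {P G : MvPolynomial (Fin 2) k} (hG : G ≠ 0)
    (h : ∀ c : Fin 2 → K, c ≠ 0 → aeval c G ≠ 0 → aeval c P = 0) : P = 0 := by
  have hinj := MvPolynomial.map_injective (σ := Fin 2) _ (algebraMap k K).injective
  have h1 : X 0 * MvPolynomial.map (algebraMap k K) (G * P) = 0 := by
    refine MvPolynomial.funext fun c => ?_
    rw [map_mul, eval_X, map_mul, map_mul, MvPolynomial.eval_map, MvPolynomial.eval_map,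
      ← aeval_def, ← aeval_def, map_zero]
    by_cases h0 : c 0 = 0
    · rw [h0, zero_mul]
    by_cases hg : aeval c G = 0
    · rw [hg, zero_mul, mul_zero]
    · rw [h c (by rintro rfl; exact h0 rfl) hg, mul_zero, mul_zero]
  have h2 := (mul_eq_zero.mp h1).resolve_left (X_ne_zero 0)
  exact (mul_eq_zero.mp (hinj (h2.trans (map_zero _).symm))).resolve_left hG

/-- If two maps on the pencil agree on a dense open subset, then their local representations by
polynomials are proportional. -/
theorem SpansPencil.pencilHom_mul_eq (hab : SpansPencil a b Q) {G : MvPolynomial (Fin 2) k}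
    (hG : G ≠ 0) (hσ : ∀ (c : Fin 2 → K) (h : member a b c ≠ 0), aeval c G ≠ 0 →
      σ ⟨_, hab.mem c h⟩ = σ' ⟨_, hab.mem c h⟩)
    {h h' : MvPolynomial (Fin 3) k} {H H' : Fin 4 → MvPolynomial (Fin 3) k}
    (hr : IsLocalRep k σ h H) (hr' : IsLocalRep k σ' h' H')
    (h0 : pencilHom a b h ≠ 0) (h0' : pencilHom a b h' ≠ 0) :
    (∀ i j : Fin 3, pencilHom a b (H i.castSucc) * pencilHom a b (H' j.castSucc) =
      pencilHom a b (H j.castSucc) * pencilHom a b (H' i.castSucc)) ∧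
    ∀ i : Fin 3, pencilHom a b (H i.castSucc) ^ 2 * pencilHom a b (H' 3) =
      pencilHom a b (H 3) * pencilHom a b (H' i.castSucc) ^ 2 := by
  have hG' := mul_ne_zero (mul_ne_zero hG h0) h0'
  have key : ∀ c : Fin 2 → K, c ≠ 0 →
      aeval c (G * pencilHom a b h * pencilHom a b h') ≠ 0 →
      (∀ i j : Fin 3, aeval (member a b c) (H i.castSucc) * aeval (member a b c) (H' j.castSucc) =
        aeval (member a b c) (H j.castSucc) * aeval (member a b c) (H' i.castSucc)) ∧
      ∀ i : Fin 3, aeval (member a b c) (H i.castSucc) ^ 2 * aeval (member a b c) (H' 3) =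
        aeval (member a b c) (H 3) * aeval (member a b c) (H' i.castSucc) ^ 2 := by
    intro c hc hne
    rw [map_mul, map_mul, mul_ne_zero_iff, mul_ne_zero_iff, aeval_pencilHom, aeval_pencilHom] at hne
    obtain ⟨h1, h2⟩ := hr.eq_upt ⟨_, hab.mem c (hab.ne c hc)⟩ rfl hne.1.2
    obtain ⟨h1', h2'⟩ := hr'.eq_upt ⟨_, hab.mem c (hab.ne c hc)⟩ rfl hne.2
    rw [hσ c _ hne.1.1, h2'] at h2
    exact mul_eq_of_upt_eq_upt h2.symm
  constructor
  · intro i j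
    refine sub_eq_zero.mp (eq_zero_of_forall_aeval_eq_zero K hG' fun c hc hne => ?_)
    simp only [map_sub, map_mul, aeval_pencilHom]
    rw [(key c hc hne).1, sub_self]
  · intro i
    refine sub_eq_zero.mp (eq_zero_of_forall_aeval_eq_zero K hG' fun c hc hne => ?_)
    simp only [map_sub, map_mul, map_pow, aeval_pencilHom]
    rw [(key c hc hne).2, sub_self]

/-- Separatedness: two morphisms on the pencil that agree on a dense open subset are equal. -/
theorem SpansPencil.morphism_ext (hab : SpansPencil a b Q) (hm : IsMorphism k σ)
    (hm' : IsMorphism k σ') {G : MvPolynomial (Fin 2) k} (hG : G ≠ 0)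
    (hσ : ∀ (c : Fin 2 → K) (h : member a b c ≠ 0), aeval c G ≠ 0 →
      σ ⟨_, hab.mem c h⟩ = σ' ⟨_, hab.mem c h⟩) : σ = σ' := by
  funext ⟨L, hL⟩
  obtain ⟨c, hc, hLc⟩ := hab.exists_eq L hL
  have hne := hab.ne c hc
  obtain rfl : L = Projectivization.mk K _ hne := by
    rw [← Projectivization.mk_rep L]
    simp only [hLc]
  obtain ⟨h, H, hr, h1, h0⟩ := hab.exists_localRep hm hne
  obtain ⟨h', H', hr', h1', h0'⟩ := hab.exists_localRep hm' hne
  obtain ⟨e1, e2⟩ := hab.pencilHom_mul_eq hG hσ hr hr' h0 h0'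
  obtain ⟨h2, h3⟩ := hr.eq_upt ⟨_, hL⟩ rfl h1
  obtain ⟨h2', h3'⟩ := hr'.eq_upt ⟨_, hL⟩ rfl h1'
  rw [h3, h3']
  refine upt_eq_upt_of_mul_eq (fun i j => ?_) fun i => ?_
  · simpa only [map_mul, aeval_pencilHom] using congrArg (aeval c) (e1 i j)
  · simpa only [map_mul, map_pow, aeval_pencilHom] using congrArg (aeval c) (e2 i)

theorem SpansPencil.exists_generic_ne_zero (hab : SpansPencil a b Q)
    {h : MvPolynomial (Fin 3) k} {H : Fin 4 → MvPolynomial (Fin 3) k}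
    (hr : IsLocalRep k σ h H) (h0 : pencilHom a b h ≠ 0) :
    ∃ i : Fin 3, aeval (genericLine a b) (H i.castSucc) ≠ 0 := by
  by_contra! h1
  obtain ⟨e, he⟩ := hr.homogeneous_H
  have h2 : ∀ i : Fin 3, pencilHom a b (H i.castSucc) = 0 := fun i =>
    (aeval_genericLine_eq_zero_iff a b (he i.castSucc)).mp (h1 i)
  refine h0 (eq_zero_of_forall_aeval_eq_zero K one_ne_zero fun c hc _ => ?_)
  by_contra h3
  rw [aeval_pencilHom] at h3
  obtain ⟨h4, -⟩ := hr.eq_upt ⟨_, hab.mem c (hab.ne c hc)⟩ rfl h3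
  refine h4 (funext fun i => ?_)
  rw [← aeval_pencilHom, h2, map_zero]
  rfl

/-- The value of a map at the generic line, as a point over `k(t)`, is well defined. -/
theorem SpansPencil.pointIdeal_eq (hab : SpansPencil a b Q) {y y' : Fin 4 → RatFunc k}
    (hy : IsGenericValue a b σ y) (hy' : IsGenericValue a b σ y') :
    pointIdeal y' = pointIdeal y := by
  obtain ⟨h, H, hr, hne, rfl⟩ := hy
  obtain ⟨h', H', hr', hne', rfl⟩ := hy'
  have h0 : pencilHom a b h ≠ 0 := fun h1 => hne (by rw [aeval_genericLine, h1, map_zero])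
  have h0' : pencilHom a b h' ≠ 0 := fun h1 => hne' (by rw [aeval_genericLine, h1, map_zero])
  obtain ⟨e1, e2⟩ := hab.pencilHom_mul_eq one_ne_zero (fun _ _ _ => rfl) hr hr' h0 h0'
  obtain ⟨i, hi⟩ := hab.exists_generic_ne_zero hr h0
  obtain ⟨j, hj⟩ := hab.exists_generic_ne_zero hr' h0'
  refine pointIdeal_eq_of_mul_eq hi hj (fun i j => ?_) fun i => ?_
  · simpa only [map_mul, ← aeval_genericLine] using
      congrArg (aeval ![(1 : RatFunc k), RatFunc.X]) (e1 i j)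
  · simpa only [map_mul, map_pow, ← aeval_genericLine] using
      congrArg (aeval ![(1 : RatFunc k), RatFunc.X]) (e2 i)

/-- Morphisms on the pencil with the same value at the generic line are equal. -/
theorem SpansPencil.eq_of_pointIdeal_eq (hab : SpansPencil a b Q) (hm : IsMorphism k σ)
    (hm' : IsMorphism k σ') {y y' : Fin 4 → RatFunc k}
    (hy : IsGenericValue a b σ y) (hy' : IsGenericValue a b σ' y')
    (hI : pointIdeal y = pointIdeal y') : σ = σ' := by
  have e1 := mul_eq_mul_of_pointIdeal_le hI.le
  have e2 := mul_sq_eq_of_pointIdeal_le hI.le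
  obtain ⟨h, H, hr, hne, rfl⟩ := hy
  obtain ⟨h', H', hr', hne', rfl⟩ := hy'
  have h0 : pencilHom a b h ≠ 0 := fun h1 => hne (by rw [aeval_genericLine, h1, map_zero])
  have h0' : pencilHom a b h' ≠ 0 := fun h1 => hne' (by rw [aeval_genericLine, h1, map_zero])
  obtain ⟨e, he⟩ := hr.homogeneous_H
  obtain ⟨e', he'⟩ := hr'.homogeneous_H
  refine hab.morphism_ext hm hm' (mul_ne_zero h0 h0') fun c hc hG => ?_
  rw [map_mul, mul_ne_zero_iff, aeval_pencilHom, aeval_pencilHom] at hG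
  obtain ⟨h2, h3⟩ := hr.eq_upt ⟨_, hab.mem c hc⟩ rfl hG.1
  obtain ⟨h2', h3'⟩ := hr'.eq_upt ⟨_, hab.mem c hc⟩ rfl hG.2
  rw [h3, h3']
  -- the equations hold at the generic line, hence at all lines
  have hgen : ∀ {A B : MvPolynomial (Fin 3) k} {n : ℕ}, A.IsHomogeneous n → B.IsHomogeneous n →
      aeval (genericLine a b) A = aeval (genericLine a b) B →
      aeval (member a b c) A = aeval (member a b c) B := by
    intro A B n hA hB hAB
    have h4 := (aeval_genericLine_eq_zero_iff a b (hA.sub hB)).mp (by rw [map_sub, hAB, sub_self])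
    rw [← sub_eq_zero, ← map_sub, ← aeval_pencilHom, h4, map_zero]
  refine upt_eq_upt_of_mul_eq (fun i j => ?_) fun i => ?_
  · have h4 := (he i.castSucc).mul (he' j.castSucc)
    have h5 := (he j.castSucc).mul (he' i.castSucc)
    rw [wt_castSucc, wt_castSucc] at h4 h5
    simpa only [map_mul] using hgen h4 h5 (by simpa only [map_mul] using e1 i j)
  · have h4 := ((he i.castSucc).pow 2).mul (he' 3)
    have h5 := (he 3).mul ((he' i.castSucc).pow 2)
    rw [wt_castSucc] at h4 h5
    have h6 : e * wt 3 + e' * 1 * 2 = e * 1 * 2 + e' * wt 3 := by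
      change e * 2 + _ = _ + e' * 2; ring
    rw [h6] at h5
    simpa only [map_mul, map_pow] using hgen h4 h5 (by simpa only [map_mul, map_pow] using e2 i)

end PencilMaps

/-! ### The residual section -/

section ResidualSection

variable {k K : Type*} [Field k] [Field K] [Algebra k K]
variable {f g : MvPolynomial (Fin 3) k}

namespace Osculation

variable (O : Osculation f g)

/-- A binary form, evaluated at the point at which a line through the point of contact meets the
opposite side of the frame, as a form in the coefficients of the line. -/
def dir : MvPolynomial (Fin 2) k →ₐ[k] MvPolynomial (Fin 3) k := aeval ![lin O.T.p, -lin O.T.s]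

theorem isHomogeneous_dir {A : MvPolynomial (Fin 2) k} {n : ℕ} (hA : A.IsHomogeneous n) :
    (O.dir A).IsHomogeneous n := by
  refine IsWeightedHomogeneous.aeval_weight (w := 1) (w' := 1) hA fun i => ?_
  fin_cases i
  · exact isHomogeneous_lin _
  · exact (isHomogeneous_lin _).neg

theorem aeval_dir {S : Type*} [CommRing S] [Algebra k S] (l : Fin 3 → S)
    (A : MvPolynomial (Fin 2) k) : aeval l (O.dir A) =
      aeval ![∑ i, l i * algebraMap k S (O.T.p i), -∑ i, l i * algebraMap k S (O.T.s i)] A := by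
  rw [dir, ← AlgHom.comp_apply, comp_aeval]
  congr 2
  funext i
  fin_cases i
  · simp [aeval_lin, mul_comm]
  · simp [aeval_lin, mul_comm]

variable (K) in
/-- The binary forms that describe the residual intersection, on the lines through the point of
contact, of the surface with the osculating section, after division by their common divisor `D`.
The degrees are differences of natural numbers; `A` vanishes if the difference is truncated. -/
structure Residual where
  d : ℕ
  A : MvPolynomial (Fin 2) k
  B : MvPolynomial (Fin 2) k
  D : MvPolynomial (Fin 2) k
  hA : A.IsHomogeneous (3 - d)
  hA0 : 3 < d → A = 0
  hB : B.IsHomogeneous (4 - d)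
  hD : D.IsHomogeneous d
  eq₃ : O.P₃ = D * A
  eq₄ : O.P₄ = D * B
  ne : O.P₃ ≠ 0 ∨ O.P₄ ≠ 0
  coprime : ∀ c : Fin 2 → K, c ≠ 0 → aeval c A = 0 → aeval c B ≠ 0

theorem nonempty_residual [IsAlgClosed K] (hX : IsSmoothSurface K f g) :
    Nonempty (O.Residual K) := by
  have h0 := O.ne_zero_of_smooth hX
  obtain ⟨d, A, B, D, -, hA, hA0, hB, -, hD, -, h3, h4, hco⟩ :=
    exists_gcd_binary_forms K O.hP₃ O.hP₄ h0
  exact ⟨⟨d, A, B, D, hA, hA0, hB, hD, h3, h4, h0, hco⟩⟩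

namespace Residual

variable {O} (R : O.Residual K)

/-- The first coordinates of the residual point, as forms in the coefficients of the line. -/
def coord (i : Fin 3) : MvPolynomial (Fin 3) k :=
  O.dir R.A * (C (O.T.s i) * lin O.T.p - C (O.T.p i) * lin O.T.s) - C (O.T.m i) * O.dir R.B

theorem isHomogeneous_coord (i : Fin 3) : (R.coord i).IsHomogeneous (4 - R.d) := by
  refine IsHomogeneous.sub ?_ ((O.isHomogeneous_dir R.hB).C_mul _)
  by_cases h : 3 < R.d
  · rw [R.hA0 h, map_zero, zero_mul]
    exact isHomogeneous_zero _ _ _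
  · have h1 := (O.isHomogeneous_dir R.hA).mul
      (((isHomogeneous_lin O.T.p).C_mul (O.T.s i)).sub ((isHomogeneous_lin O.T.s).C_mul (O.T.p i)))
    have h2 : 4 - R.d = 3 - R.d + 1 := by omega
    rw [h2]
    exact h1

theorem aeval_coord {M : Type*} [Field M] [Algebra k M] (l : Fin 3 → M) {γ δ : M}
    (h : γ * (∑ i, l i * algebraMap k M (O.T.s i)) +
      δ * (∑ i, l i * algebraMap k M (O.T.p i)) = 1) :
    (fun i => aeval l (R.coord i)) = ((O.T.map (algebraMap k M)).ofPencil _ _ γ δ h).vec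
      ![aeval l (O.dir R.A), -aeval l (O.dir R.B)] := by
  funext i
  simp only [coord, map_sub, map_mul, algHom_C, aeval_lin, Frame.vec, Frame.ofPencil, Frame.map,
    Matrix.cons_val_zero, Matrix.cons_val_one]
  simp only [mul_comm (l _)]
  ring

/-- The residual point is on the surface. -/
theorem aeval_coord_eq_zero {M : Type*} [Field M] [Algebra k M] (l : Fin 3 → M) {γ δ : M}
    (h : γ * (∑ i, l i * algebraMap k M (O.T.s i)) +
      δ * (∑ i, l i * algebraMap k M (O.T.p i)) = 1) :
    aeval (fun i => aeval l (R.coord i)) (O.q ^ 2 + f * O.q - g) = 0 := by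
  have h1 := O.res_eq (algebraMap k M) h
  have h2 : ∀ A : MvPolynomial (Fin 2) k, eval ![∑ i, l i * algebraMap k M (O.T.p i),
      -∑ i, l i * algebraMap k M (O.T.s i)] (MvPolynomial.map (algebraMap k M) A) =
      aeval l (O.dir A) := fun A => by
    rw [O.aeval_dir, MvPolynomial.eval_map, aeval_def]
  rw [h2, h2, ← map_pow, ← map_mul, ← map_add, ← map_sub] at h1
  have h3 := congrArg (eval ![aeval l (O.dir R.A), -aeval l (O.dir R.B)]) h1
  rw [Frame.eval_res, ← R.aeval_coord l h, MvPolynomial.eval_map, ← aeval_def] at h3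
  rw [h3, R.eq₃, R.eq₄]
  simp only [map_mul, map_add, map_pow, eval_X, eval_C, Matrix.cons_val_zero, Matrix.cons_val_one]
  ring

theorem dir_ne_zero {l : Fin 3 → K} {γ δ : K}
    (h : γ * (∑ i, l i * algebraMap k K (O.T.s i)) +
      δ * (∑ i, l i * algebraMap k K (O.T.p i)) = 1) :
    ![aeval l (O.dir R.A), -aeval l (O.dir R.B)] ≠ 0 := by
  intro h0
  have h1 : aeval l (O.dir R.A) = 0 := congrFun h0 0
  have h2 : -aeval l (O.dir R.B) = 0 := congrFun h0 1
  rw [neg_eq_zero, O.aeval_dir] at h2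
  rw [O.aeval_dir] at h1
  refine R.coprime _ (fun h3 => ?_) h1 h2
  have h4 := congrFun h3 0
  have h5 := congrFun h3 1
  simp only [Matrix.cons_val_zero, Matrix.cons_val_one, Pi.zero_apply, neg_eq_zero] at h4 h5
  rw [h4, h5] at h
  simp at h

variable [IsAlgClosed K]

theorem coord_ne_zero (L : linesThrough (phi (O.point K))) :
    (fun i => aeval L.1.rep (R.coord i)) ≠ 0 := by
  obtain ⟨γ, δ, h, -⟩ := O.exists_frame L
  rw [R.aeval_coord _ h]
  exact Frame.vec_ne_zero _ (R.dir_ne_zero h)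

/-- The residual point of intersection, on a line through the point of contact. -/
def rho (L : linesThrough (phi (O.point K))) : U K :=
  upt _ (R.coord_ne_zero L) (aeval (fun i => aeval L.1.rep (R.coord i)) O.q)

theorem isLocalRep_rho : IsLocalRep k R.rho 1 (cvec R.coord (aeval R.coord O.q)) := by
  have hhom : (aeval R.coord O.q).IsHomogeneous ((4 - R.d) * 2) :=
    (O.hq.aeval (R := k) (S := k) (m := 2) R.coord R.isHomogeneous_coord)
  refine ⟨⟨0, isHomogeneous_one _ _⟩, ⟨4 - R.d, fun i => ?_⟩, fun L v hv hL _ => ?_⟩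
  · induction i using Fin.lastCases with
    | last => exact (cvec_three R.coord (aeval R.coord O.q)).symm ▸ hhom
    | cast i => rw [cvec_castSucc, wt_castSucc, mul_one]; exact R.isHomogeneous_coord i
  · obtain ⟨L, hLQ⟩ := L
    obtain rfl : Projectivization.mk K v hv = L := hL
    obtain ⟨c, hc⟩ := Projectivization.exists_smul_eq_mk_rep K v hv
    have h1 : (Projectivization.mk K v hv).rep = fun i => (c : K) * v i := by
      rw [← hc]; rfl
    have h2 : ∀ i, aeval (Projectivization.mk K v hv).rep (R.coord i) =
        (c : K) ^ (4 - R.d) * aeval v (R.coord i) := fun i => by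
      rw [h1, (R.isHomogeneous_coord i).aeval_smul']
    have h3 : (fun i => aeval v (cvec R.coord (aeval R.coord O.q) i)) =
        cvec (fun i => aeval v (R.coord i)) (aeval (fun i => aeval v (R.coord i)) O.q) := by
      rw [← cvec_eta fun i => aeval v (cvec R.coord (aeval R.coord O.q) i), cvec_three]
      simp only [cvec_castSucc]
      rw [← AlgHom.comp_apply, comp_aeval]
    have h4 : (fun i => aeval v (R.coord i)) ≠ 0 := by
      intro h5
      refine R.coord_ne_zero ⟨_, hLQ⟩ (funext fun i => ?_)
      change aeval (Projectivization.mk K v hv).rep (R.coord i) = 0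
      rw [h2, congrFun h5 i]
      exact mul_zero _
    simp only [h3]
    refine ⟨cvec_ne_zero h4 _, congrArg Subtype.val (?_ : upt _ h4 _ = R.rho ⟨_, hLQ⟩)⟩
    refine upt_eq_iff.mpr ⟨(c : K) ^ (4 - R.d), pow_ne_zero _ c.ne_zero, h2, ?_⟩
    rw [← O.hq.aeval_smul']
    exact congrArg (fun x => aeval x O.q) (funext h2)

theorem isSection_rho : IsSection f g R.rho where
  morphism L := ⟨1, _, R.isLocalRep_rho, by simp⟩
  mem_surface L := by
    obtain ⟨γ, δ, h, -⟩ := O.exists_frame L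
    rw [rho, upt_mem_surface O.hf O.hg]
    have := R.aeval_coord_eq_zero L.1.rep h
    simpa only [map_sub, map_add, map_mul, map_pow] using this
  mem_line L := by
    obtain ⟨γ, δ, h, hl⟩ := O.exists_frame L
    rw [rho, phi_upt, mk_mem_line, R.aeval_coord _ h, ← congrFun (congrArg dotProduct hl) _]
    exact Frame.l_vec _ _

end Residual

end Osculation

end ResidualSection

/-! ### The residual section is the inverse of `σ_P` -/

section InverseSection

variable {k K : Type*} [Field k] [Field K] [Algebra k K]
variable {f g : MvPolynomial (Fin 3) k}

theorem Frame.exists_eq_vec_dualFrame (T : Frame k) {a : Fin 3 → k} (ha : ∑ i, a i * T.m i = 0) :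
    a = T.dualFrame.vec ![∑ i, a i * T.s i, ∑ i, a i * T.p i] := by
  have h := T.dualFrame.exists_eq_vec (x := a) (by
    rw [← ha]; exact Finset.sum_congr rfl fun i _ => mul_comm _ _)
  refine h.trans ?_
  congr 1
  funext j
  fin_cases j
  · change ∑ i, T.s i * a i = ∑ i, a i * T.s i
    exact Finset.sum_congr rfl fun i _ => mul_comm _ _
  · change ∑ i, T.p i * a i = ∑ i, a i * T.p i
    exact Finset.sum_congr rfl fun i _ => mul_comm _ _

theorem Frame.det_ne_zero (T : Frame k) {a b : Fin 3 → k} (hab : LinearIndependent k ![a, b])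
    (ha : ∑ i, a i * T.m i = 0) (hb : ∑ i, b i * T.m i = 0) :
    (∑ i, a i * T.s i) * (∑ i, b i * T.p i) - (∑ i, b i * T.s i) * (∑ i, a i * T.p i) ≠ 0 := by
  rw [T.exists_eq_vec_dualFrame ha, T.exists_eq_vec_dualFrame hb] at hab
  exact T.dualFrame.vec_linearIndependent hab

/-- The lines `a`, `b` through the point `m` of the frame, together with the opposite side `l`, are
coordinates on the plane. -/
theorem Frame.exists_X_eq (T : Frame k) {a b : Fin 3 → k} (hab : LinearIndependent k ![a, b])
    (ha : ∑ i, a i * T.m i = 0) (hb : ∑ i, b i * T.m i = 0) (i : Fin 3) :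
    ∃ x y z : k, X i = C x * lin a + C y * lin b + C z * lin T.l := by
  have hdet := T.det_ne_zero hab ha hb
  have hlin : ∀ {x : Fin 3 → k}, ∑ i, x i * T.m i = 0 →
      lin x = C (∑ i, x i * T.s i) * lin T.u + C (∑ i, x i * T.p i) * lin T.v := by
    intro x hx
    simp only [lin, Finset.mul_sum, ← Finset.sum_add_distrib]
    refine Finset.sum_congr rfl fun j _ => ?_
    have h1 := congrFun (T.exists_eq_vec_dualFrame hx) j
    simp only [vec, dualFrame, Matrix.cons_val_zero, Matrix.cons_val_one] at h1
    conv_lhs => rw [h1]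
    simp only [C_add, C_mul]
    ring
  set a₀ := ∑ i, a i * T.s i
  set a₁ := ∑ i, a i * T.p i
  set b₀ := ∑ i, b i * T.s i
  set b₁ := ∑ i, b i * T.p i
  have hinv : (C (a₀ * b₁ - b₀ * a₁)⁻¹ * C (a₀ * b₁ - b₀ * a₁) : MvPolynomial (Fin 3) k) = 1 := by
    rw [← C_mul, inv_mul_cancel₀ hdet, C_1]
  set Δ := (a₀ * b₁ - b₀ * a₁)⁻¹
  refine ⟨Δ * (T.s i * b₁ - T.p i * b₀), Δ * (T.p i * a₀ - T.s i * a₁), T.m i, ?_⟩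
  rw [hlin ha, hlin hb, T.X_eq i]
  simp only [C_mul, C_sub] at hinv ⊢
  linear_combination (-(C (T.p i) * lin T.v + C (T.s i) * lin T.u)) * hinv

namespace Osculation

variable (O : Osculation f g)

theorem isGenericValue_point {a b : Fin 3 → k} {Q : ℙ K (Fin 3 → K)} {F : Frame (RatFunc k)}
    (hF : F.p = fun i => algebraMap k (RatFunc k) (O.T.m i)) :
    IsGenericValue a b (fun _ : linesThrough Q => O.point K)
      (F.pt (MvPolynomial.map (algebraMap k (RatFunc k)) O.q)) := by
  have h := isGenericValue_const (a := a) (b := b) (Q := Q) (O.map_m_ne_zero K) (eval O.T.m O.q)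
  rw [← eval_map_comp (algebraMap k (RatFunc k)), ← hF] at h
  exact h

theorem isGenericValue_iota_point [IsAlgClosed K] {a b : Fin 3 → k} {Q : ℙ K (Fin 3 → K)}
    {F : Frame (RatFunc k)} (hF : F.p = fun i => algebraMap k (RatFunc k) (O.T.m i)) :
    IsGenericValue a b (fun _ : linesThrough Q => iota f (O.point K))
      (F.pt (-MvPolynomial.map (algebraMap k (RatFunc k)) f -
        MvPolynomial.map (algebraMap k (RatFunc k)) O.q)) := by
  have h := isGenericValue_const (a := a) (b := b) (Q := Q) (O.map_m_ne_zero K)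
    (eval O.T.m (-f - O.q))
  rw [← eval_map_comp (algebraMap k (RatFunc k)), ← hF, map_sub (MvPolynomial.map _),
    map_neg (MvPolynomial.map _), map_sub (eval _), map_neg (eval _), map_sub (algebraMap k K),
    map_neg (algebraMap k K), ← aeval_algebraMap_comp (K := K) f] at h
  rw [point, iota_upt O.hf]
  exact h

variable {O}

/-- The generic line of the pencil: the osculating section meets the curve above it three times at
the point of contact, and at the value of the residual section. -/
theorem Residual.exists_generic_frame (R : O.Residual K) {a b : Fin 3 → k}
    (hab : LinearIndependent k ![a, b]) (ha : ∑ i, a i * O.T.m i = 0)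
    (hb : ∑ i, b i * O.T.m i = 0) :
    ∃ (F : Frame (RatFunc k)) (c₀ c₁ d₀ d₁ : RatFunc k) (hd : d₁ * c₁ - d₀ * c₀ = 1),
      F.l = genericLine a b ∧ (F.p = fun i => algebraMap k (RatFunc k) (O.T.m i)) ∧
      F.Osculates (MvPolynomial.map (algebraMap k (RatFunc k)) f)
        (MvPolynomial.map (algebraMap k (RatFunc k)) g)
        (MvPolynomial.map (algebraMap k (RatFunc k)) O.q) ∧
      F.res (MvPolynomial.map (algebraMap k (RatFunc k)) O.q ^ 2 +
        MvPolynomial.map (algebraMap k (RatFunc k)) f *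
          MvPolynomial.map (algebraMap k (RatFunc k)) O.q -
        MvPolynomial.map (algebraMap k (RatFunc k)) g) =
          X 0 ^ 3 * (C c₁ * X 1 + C c₀ * X 0) ∧
      pointIdeal (fun i => aeval (genericLine a b) (cvec R.coord (aeval R.coord O.q) i)) =
        pointIdeal ((F.rot c₀ c₁ d₀ d₁ hd).pt
          (MvPolynomial.map (algebraMap k (RatFunc k)) O.q)) := by
  set l := genericLine a b with hl
  have hsum : ∀ x : Fin 3 → k, ∑ i, l i * algebraMap k (RatFunc k) (x i) =
      RatFunc.C (∑ i, a i * x i) + RatFunc.X * RatFunc.C (∑ i, b i * x i) := fun x => by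
    simp only [hl, genericLine, RatFunc.algebraMap_eq_C, map_sum, map_mul, Finset.mul_sum,
      ← Finset.sum_add_distrib]
    exact Finset.sum_congr rfl fun i _ => by ring
  have hdet := O.T.det_ne_zero hab ha hb
  -- a form that does not vanish identically does not vanish at the generic line
  have hgen : ∀ {P : MvPolynomial (Fin 2) k} {n : ℕ}, P.IsHomogeneous n → P ≠ 0 →
      aeval l (O.dir P) ≠ 0 := by
    intro P n hP h0
    rw [O.aeval_dir, hsum, hsum]
    have h1 := aeval_generic_ne_zero hP h0 (a₁ := ∑ i, a i * O.T.p i) (a₂ := ∑ i, b i * O.T.p i)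
      (b₁ := -∑ i, a i * O.T.s i) (b₂ := -∑ i, b i * O.T.s i) fun h =>
        hdet (by linear_combination h)
    rwa [map_neg RatFunc.C, map_neg RatFunc.C, mul_neg, ← neg_add] at h1
  have hl0 : l ≠ 0 := by
    intro h0
    have h1 := hgen (isHomogeneous_X k (0 : Fin 2)) (X_ne_zero _)
    rw [O.aeval_dir] at h1
    simp [h0] at h1
  obtain ⟨γ, δ, h, hFl⟩ := (O.T.map (algebraMap k (RatFunc k))).exists_ofPencil hl0 (by
    change ∑ i, l i * algebraMap k (RatFunc k) (O.T.m i) = 0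
    rw [hsum, ha, hb]; simp)
  set F := (O.T.map (algebraMap k (RatFunc k))).ofPencil _ _ γ δ h with hF
  have hev : ∀ A : MvPolynomial (Fin 2) k, eval ![∑ i, l i * algebraMap k (RatFunc k) (O.T.p i),
      -∑ i, l i * algebraMap k (RatFunc k) (O.T.s i)]
        (MvPolynomial.map (algebraMap k (RatFunc k)) A) = aeval l (O.dir A) := fun A => by
    rw [O.aeval_dir, MvPolynomial.eval_map, aeval_def]
  have hΦ := O.res_eq (algebraMap k (RatFunc k)) h
  change F.res _ = X 0 ^ 3 * (C (eval ![∑ i, l i * algebraMap k (RatFunc k) (O.T.p i),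
    -∑ i, l i * algebraMap k (RatFunc k) (O.T.s i)] _) * X 1 +
    C (eval ![∑ i, l i * algebraMap k (RatFunc k) (O.T.p i),
    -∑ i, l i * algebraMap k (RatFunc k) (O.T.s i)] _) * X 0) at hΦ
  rw [hev, hev] at hΦ
  set c₁ := aeval l (O.dir O.P₃) with hc₁
  set c₀ := aeval l (O.dir O.P₄) with hc₀
  obtain ⟨d₀, d₁, hd⟩ := Frame.exists_rot (c₀ := c₀) (c₁ := c₁)
    (R.ne.symm.imp (hgen O.hP₄) (hgen O.hP₃))
  refine ⟨F, c₀, c₁, d₀, d₁, hd, hFl, rfl, O.osculates _ h, hΦ, ?_⟩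
  set t := aeval l (O.dir R.D) with ht
  have h3 : c₁ = t * aeval l (O.dir R.A) := by rw [hc₁, R.eq₃, map_mul, map_mul]
  have h4 : c₀ = t * aeval l (O.dir R.B) := by rw [hc₀, R.eq₄, map_mul, map_mul]
  have ht0 : t ≠ 0 := by
    intro h0
    rw [h3, h4, h0] at hd
    simp at hd
  rw [← pointIdeal_smul ht0]
  congr 1
  have h5 : (F.rot c₀ c₁ d₀ d₁ hd).p = fun i => t * aeval l (R.coord i) := by
    funext i
    rw [congrFun (R.aeval_coord l h) i]
    change (F.rot c₀ c₁ d₀ d₁ hd).p i =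
      t * F.vec ![aeval l (O.dir R.A), -aeval l (O.dir R.B)] i
    simp only [Frame.rot, Frame.vec, h3, h4, Matrix.cons_val_zero, Matrix.cons_val_one]
    ring
  have h6 : aeval l (aeval R.coord O.q) = aeval (fun i => aeval l (R.coord i)) O.q := by
    rw [← AlgHom.comp_apply, comp_aeval]
  funext i
  induction i using Fin.lastCases with
  | last =>
    change t ^ 2 * aeval l (cvec R.coord (aeval R.coord O.q) 3) = Frame.pt _ _ 3
    rw [cvec_three, Frame.pt_three, h5, MvPolynomial.eval_map, ← aeval_def, O.hq.aeval_smul', h6]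
  | cast i => rw [Frame.pt_castSucc, h5, cvec_castSucc, wt_castSucc, pow_one]

theorem fibre_eq_span {F : Frame (RatFunc k)} {a b : Fin 3 → k} (hF : F.l = genericLine a b) :
    Ideal.span {MvPolynomial.map (algebraMap k (RatFunc k)) (surfacePoly f g),
      ∑ i : Fin 3, C (genericLine a b i) * X i.castSucc} =
      F.fibre (MvPolynomial.map (algebraMap k (RatFunc k)) f)
        (MvPolynomial.map (algebraMap k (RatFunc k)) g) := by
  rw [map_surfacePoly, ← emb_lin, ← hF, Frame.fibre]

theorem res_ne_zero_of_eq {F : Frame k} {A : MvPolynomial (Fin 3) k} {c₀ c₁ d₀ d₁ : k}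
    (hd : d₁ * c₁ - d₀ * c₀ = 1) (hA : F.res A = X 0 ^ 3 * (C c₁ * X 1 + C c₀ * X 0)) :
    F.res A ≠ 0 := by
  rw [hA]
  refine mul_ne_zero (pow_ne_zero 3 (X_ne_zero 0)) fun h => ?_
  have h1 := congrArg (eval ![-d₀, d₁]) h
  simp only [map_add, map_mul, eval_C, eval_X, Matrix.cons_val_zero, Matrix.cons_val_one,
    map_zero] at h1
  exact one_ne_zero (hd.symm.trans (by linear_combination h1))

variable [IsAlgClosed K]

variable (O) in
theorem exists_rep_phi_point : ∃ t : K, t ≠ 0 ∧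
    ∀ i, (phi (O.point K)).rep i = t * algebraMap k K (O.T.m i) := by
  obtain ⟨c, hc⟩ := Projectivization.exists_smul_eq_mk_rep K _ (O.map_m_ne_zero K)
  refine ⟨c, c.ne_zero, fun i => ?_⟩
  rw [phi_point, ← hc]
  rfl

theorem Residual.isRho (R : O.Residual K) : IsRho f g (O.point K) R.rho where
  isSection := R.isSection_rho
  isNeg := by
    have hab : LinearIndependent k ![O.T.u, O.T.v] := by
      refine LinearIndependent.pair_iff.mpr fun x y hxy => ?_
      have h1 : ∀ z : Fin 3 → k, x * (∑ i, O.T.u i * z i) + y * ∑ i, O.T.v i * z i = 0 := by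
        intro z
        simp only [Finset.mul_sum, ← Finset.sum_add_distrib]
        refine Finset.sum_eq_zero fun i _ => ?_
        have := congrFun hxy i
        simp only [Pi.add_apply, Pi.smul_apply, smul_eq_mul, Pi.zero_apply] at this
        linear_combination z i * this
      have h2 := h1 O.T.s
      have h3 := h1 O.T.p
      rw [O.T.u_s, O.T.v_s] at h2
      rw [O.T.u_p, O.T.v_p] at h3
      constructor
      · linear_combination h2
      · linear_combination h3
    obtain ⟨F, c₀, c₁, d₀, d₁, hd, hFl, hFp, hosc, hΦ, hpt⟩ :=
      R.exists_generic_frame hab O.T.u_m O.T.v_m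
    obtain ⟨t, -, ht⟩ := O.exists_rep_phi_point (K := K)
    have hdot : ∀ x : Fin 3 → k, ∑ i, x i * O.T.m i = 0 →
        dotProduct (fun i => algebraMap k K (x i)) (phi (O.point K)).rep = 0 := by
      intro x hx
      have h1 : dotProduct (fun i => algebraMap k K (x i)) (phi (O.point K)).rep =
          t * algebraMap k K (∑ i, x i * O.T.m i) := by
        simp only [dotProduct, map_sum, map_mul, Finset.mul_sum, ht]
        exact Finset.sum_congr rfl fun i _ => by ring
      rw [h1, hx, map_zero, mul_zero]
    refine ⟨O.T.u, O.T.v, _, _, _, _, hab, hdot _ O.T.u_m, hdot _ O.T.v_m,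
      O.isGenericValue_iota_point hFp, O.isGenericValue_point hFp,
      ⟨1, _, R.isLocalRep_rho, by simp, rfl⟩, O.isGenericValue_iota_point hFp, ?_⟩
    rw [fibre_eq_span hFl]
    exact hosc.linearlyEquivalent hd hΦ (res_ne_zero_of_eq hd hΦ) rfl hpt rfl rfl

theorem Residual.eq_of_isRho (R : O.Residual K) (hX : IsSmoothSurface K f g)
    {ρ : linesThrough (phi (O.point K)) → U K} (hρ : IsRho f g (O.point K) ρ) : ρ = R.rho := by
  obtain ⟨a, b, yo, y₁, y₂, y₃, hab, ha, hb, ho, h1, h2, h3, hlin⟩ := hρ.isNeg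
  obtain ⟨t, ht, hQ⟩ := O.exists_rep_phi_point (K := K)
  obtain ⟨⟨ha', hb'⟩, hspan⟩ := spansPencil_of_linearIndependent O.T ht hQ hab ha hb
  obtain ⟨F, c₀, c₁, d₀, d₁, hd, hFl, hFp, hosc, hΦ, hpt⟩ := R.exists_generic_frame hab ha' hb'
  rw [fibre_eq_span hFl] at hlin
  have hres := res_ne_zero_of_eq hd hΦ
  have hbp : ∑ i, algebraMap k (RatFunc k) (b i) * F.p i = 0 := by
    simp only [hFp, ← map_mul, ← map_sum]
    rw [hb', map_zero]
  have key := Frame.Osculates.pointIdeal_eq_of_linearlyEquivalent hosc hd hΦ hres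
    (fun 𝔭 _ hhom hle hirr => isLocPrincipal_fibre hX hab (O.T.exists_X_eq hab ha' hb') hFl hbp
      hosc 𝔭 hhom hle hirr)
    (hspan.pointIdeal_eq (O.isGenericValue_point hFp) h1)
    (hspan.pointIdeal_eq (O.isGenericValue_iota_point hFp) h3)
    (hspan.pointIdeal_eq (O.isGenericValue_iota_point hFp) ho) hlin
  exact hspan.eq_of_pointIdeal_eq hρ.isSection.morphism R.isSection_rho.morphism h2
    ⟨1, _, R.isLocalRep_rho, by simp, rfl⟩ (key.trans hpt.symm)

end Osculation

end InverseSection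

/-! ### Exceptional curves above lines -/

section ExceptionalCurves

variable {K : Type*} [Field K]

theorem mk_eq_mk_of_pointIdeal_le {v v' : Fin 4 → K} {hv : v ≠ 0} {hv' : v' ≠ 0} {j : Fin 3}
    (hj : v j.castSucc ≠ 0) (h : pointIdeal v ≤ pointIdeal v') : WP.mk v hv = WP.mk v' hv' := by
  have h1 := mul_eq_mul_of_pointIdeal_le h
  have h2 := mul_sq_eq_of_pointIdeal_le h
  have h0 : (fun i : Fin 3 => v i.castSucc) ≠ 0 := fun h0 => hj (congrFun h0 j)
  have h0' : (fun i : Fin 3 => v' i.castSucc) ≠ 0 := by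
    intro h0'
    have h3 : ∀ i : Fin 3, v' i.castSucc = 0 := congrFun h0'
    have h4 := h2 j
    rw [h3, zero_pow two_ne_zero, mul_zero, mul_eq_zero, or_iff_right (pow_ne_zero 2 hj)] at h4
    apply hv'
    rw [← cvec_eta v']
    funext i
    induction i using Fin.lastCases with
    | last => exact (cvec_three _ _).trans h4
    | cast i => rw [cvec_castSucc]; exact h3 i
  have h3 := congrArg Subtype.val (upt_eq_upt_of_mul_eq (hv := h0) (hv' := h0') h1 h2)
  simp only [upt, cvec_eta] at h3
  exact h3

theorem mult_pointIdeal_rep {v : Fin 4 → K} (hv : v ≠ 0) {j : Fin 3} (hj : v j.castSucc ≠ 0)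
    (x : WP K) [Decidable (x = WP.mk v hv)] :
    mult (pointIdeal v) (pointIdeal x.rep) = if x = WP.mk v hv then 1 else 0 := by
  split_ifs with h
  · have h1 : pointIdeal x.rep = pointIdeal v := by
      obtain ⟨c, hc, h2⟩ := WP.exists_rep_mk hv
      rw [h, funext h2, pointIdeal_smul hc]
    rw [← h1]
    exact mult_self _
  · refine mult_eq_zero fun hle => h ?_
    rw [mk_eq_mk_of_pointIdeal_le (hv := hv) (hv' := x.rep_ne_zero) hj hle, WP.mk_rep]

theorem finsum_mult_pointIdeal {v : Fin 4 → K} (hv : v ≠ 0) {j : Fin 3} (hj : v j.castSucc ≠ 0) :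
    (Function.support fun x : WP K => mult (pointIdeal v) (pointIdeal x.rep)).Finite ∧
      ∑ᶠ x : WP K, mult (pointIdeal v) (pointIdeal x.rep) = 1 := by
  classical
  simp only [mult_pointIdeal_rep hv hj]
  constructor
  · refine (Set.finite_singleton (WP.mk v hv)).subset fun x hx => ?_
    by_contra h
    exact hx (if_neg h)
  · rw [finsum_eq_single _ (WP.mk v hv) fun x hx => if_neg hx, if_pos rfl]

/-- A binary form with a zero is divisible by the corresponding linear form. -/
theorem exists_eq_mul_of_binary_form_eq_zero {P : MvPolynomial (Fin 2) K} {n : ℕ}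
    (hP : P.IsHomogeneous (n + 1)) {c : Fin 2 → K} (hc : c ≠ 0) (h : eval c P = 0) :
    ∃ R : MvPolynomial (Fin 2) K, R.IsHomogeneous n ∧ P = (C (c 1) * X 0 - C (c 0) * X 1) * R := by
  set m : MvPolynomial (Fin 2) K := C (c 1) * X 0 - C (c 0) * X 1 with hm
  have hmh : m.IsHomogeneous 1 := (isHomogeneous_C_mul_X _ _).sub (isHomogeneous_C_mul_X _ _)
  obtain ⟨j, hj⟩ := Function.ne_iff.mp hc
  change c j ≠ 0 at hj
  have hinv : (C (c j)⁻¹ * C (c j) : MvPolynomial (Fin 2) K) = 1 := by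
    rw [← C_mul, inv_mul_cancel₀ hj, C_1]
  have h1 : P ∈ Ideal.span {m} := by
    have h2 := aeval_sub_aeval_mem (J := Ideal.span {m}) (x := fun i => X i)
      (y := fun i => (C (c j)⁻¹ * X j) * C (c i)) (fun i => ?_) P
    · rw [hP.aeval_smul'] at h2
      have h3 : aeval (fun i => C (c i) : Fin 2 → MvPolynomial (Fin 2) K) P = 0 := by
        have := aeval_algebraMap_apply (MvPolynomial (Fin 2) K) c P
        rw [algebraMap_eq, aeval_eq_eval] at this
        exact this.trans (by rw [h, C_0])
      rw [h3, mul_zero, sub_zero] at h2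
      simpa using h2
    · rw [Ideal.mem_span_singleton]
      have h4 : ∀ x y : Fin 2, m ∣ C (c x) * X y - C (c y) * X x := by
        intro x y
        fin_cases x <;> fin_cases y
        · simp
        · exact ⟨-1, by rw [hm]; simp⟩
        · exact ⟨1, by rw [hm]; simp⟩
        · simp
      obtain ⟨z, hz⟩ := h4 j i
      exact ⟨C (c j)⁻¹ * z, by linear_combination C (c j)⁻¹ * hz - X i * hinv⟩
  obtain ⟨r, hr⟩ := Ideal.mem_span_singleton.mp h1
  refine ⟨homogeneousComponent n r, homogeneousComponent_isHomogeneous n r, ?_⟩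
  have h2 : homogeneousComponent (n + 1) P = P := homogeneousComponent_of_mem hP |>.trans
    (if_pos rfl)
  rw [hr, mul_comm] at h2
  have h3 : homogeneousComponent (n + 1) (r * m) = homogeneousComponent n r * m :=
    weightedHomogeneousComponent_mul_right (w := 1) hmh r n
  rw [← h2.trans (mul_comm r m) |>.trans hr.symm, h3, mul_comm]

namespace Frame

variable (F : Frame K) {q : MvPolynomial (Fin 3) K}

theorem curveIdeal_sup_span_congr {A B : MvPolynomial (Fin 4) K} (h : F.cut q A = F.cut q B) :
    F.curveIdeal q ⊔ Ideal.span {A} = F.curveIdeal q ⊔ Ideal.span {B} :=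
  sup_span_eq_of_sub_mem (F.mem_curveIdeal.mpr (by rw [map_sub, h, sub_self]))

theorem ringKrullDim_curveIdeal (q : MvPolynomial (Fin 3) K) :
    ringKrullDim (MvPolynomial (Fin 4) K ⧸ F.curveIdeal q) = 2 := by
  have hsurj : Function.Surjective (F.cut q) := fun A =>
    ⟨emb (F.ext A), by rw [cut_emb, res_ext]⟩
  rw [← F.ker_cut, ringKrullDim_eq_of_ringEquiv
      (Ideal.quotientKerAlgEquivOfSurjective hsurj).toRingEquiv,
    MvPolynomial.ringKrullDim_of_isNoetherianRing, ringKrullDim_eq_zero_of_field]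
  simp

/-- If a line splits in the double cover, then its inverse image consists of the curves `w = q` and
`w = -f - q`. -/
theorem mul_mem_fibre_iff {F : Frame K} {f g q : MvPolynomial (Fin 3) K}
    (h0 : F.res (q ^ 2 + f * q - g) = 0) (hne : F.res (f + 2 * q) ≠ 0)
    {A : MvPolynomial (Fin 4) K} :
    A * (X 3 - emb q) ∈ F.fibre f g ↔ A ∈ F.curveIdeal (-f - q) := by
  have h1 : ∀ q' : MvPolynomial (Fin 3) K, F.res (q' ^ 2 + f * q' - g) = 0 →
      F.fibre f g ≤ F.curveIdeal q' := by
    intro q' h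
    rw [fibre, Ideal.span_le]
    rintro A (rfl | rfl)
    · exact F.mem_curveIdeal.mpr (by rw [cut_surfacePoly, h])
    · exact Ideal.subset_span (by simp)
  constructor
  · intro h
    have h2 := F.mem_curveIdeal.mp (h1 (-f - q) (by rw [← h0]; congr 1; ring) h)
    rw [map_mul, map_sub, cut_X, cut_emb] at h2
    refine F.mem_curveIdeal.mpr ((mul_eq_zero.mp h2).resolve_right fun h3 => hne ?_)
    rw [← neg_eq_zero, ← map_neg, ← h3, ← map_sub]
    congr 1
    ring
  · intro h
    obtain ⟨x, y, rfl⟩ := Ideal.mem_span_pair.mp h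
    have h2 : emb (q ^ 2 + f * q - g) ∈ F.fibre f g := by
      have h3 := F.sub_ext_res_mem (q ^ 2 + f * q - g)
      rw [h0, map_zero, sub_zero] at h3
      obtain ⟨z, hz⟩ := Ideal.mem_span_singleton.mp h3
      rw [hz, map_mul]
      exact Ideal.mul_mem_right _ _ (F.l_mem_fibre f g)
    have h3 : (x * emb (lin F.l) + y * (X 3 - emb (-f - q))) * (X 3 - emb q) =
        x * (X 3 - emb q) * emb (lin F.l) + y * (surfacePoly f g - emb (q ^ 2 + f * q - g)) := by
      rw [surfacePoly_eq f g q]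
      simp only [map_sub, map_neg]
      ring
    rw [h3]
    exact Ideal.add_mem _ (Ideal.mul_mem_left _ _ (F.l_mem_fibre f g))
      (Ideal.mul_mem_left _ _ (Ideal.sub_mem _ (F.surfacePoly_mem_fibre f g) h2))

variable [IsAlgClosed K]

/-- The curve `l = 0`, `w = q` is a rational curve, which is parametrised by a line: a form of
degree `n` on it has `n` zeros. -/
theorem finsum_mult_curveIdeal (hq : q.IsHomogeneous 2) (n : ℕ) :
    ∀ P : MvPolynomial (Fin 2) K, P.IsHomogeneous n → P ≠ 0 →
    ∀ A : MvPolynomial (Fin 4) K, F.cut q A = P →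
      (Function.support fun x : WP K =>
        mult (F.curveIdeal q ⊔ Ideal.span {A}) (pointIdeal x.rep)).Finite ∧
      ∑ᶠ x : WP K, mult (F.curveIdeal q ⊔ Ideal.span {A}) (pointIdeal x.rep) = n := by
  induction n with
  | zero =>
    intro P hP h0 A hA
    obtain ⟨r, rfl⟩ := exists_eq_C_of_isHomogeneous_zero hP
    have hr : r ≠ 0 := by rintro rfl; exact h0 C_0
    have h1 : F.curveIdeal q ⊔ Ideal.span {A} = ⊤ := by
      rw [F.curveIdeal_sup_span_congr (B := C r) (by
        rw [hA, algHom_C, algebraMap_eq]), eq_top_iff]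
      refine le_sup_of_le_right (top_le_iff.mpr (Ideal.span_singleton_eq_top.mpr ?_))
      exact (isUnit_iff_ne_zero.mpr hr).map C
    have h2 : ∀ x : WP K, mult (F.curveIdeal q ⊔ Ideal.span {A}) (pointIdeal x.rep) = 0 :=
      fun x => mult_eq_zero (by rw [h1]; exact fun h => Ideal.IsPrime.ne_top' (top_le_iff.mp h))
    simp only [h2]
    simp
  | succ n ih =>
    intro P hP h0 A hA
    obtain ⟨c, hc, hcP⟩ := exists_zero_of_binary_form (K := K) hP (Nat.succ_ne_zero n)
    obtain ⟨R, hR, rfl⟩ := exists_eq_mul_of_binary_form_eq_zero hP hc hcP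
    obtain ⟨h0m, h0R⟩ := mul_ne_zero_iff.mp h0
    obtain ⟨d₀, d₁, hd⟩ := exists_rot (c₀ := c 1) (c₁ := -c 0) (by
      by_contra! h
      refine hc (funext fun j => ?_)
      fin_cases j
      · exact neg_eq_zero.mp h.2
      · exact h.1)
    set G := F.rot (c 1) (-c 0) d₀ d₁ hd with hG
    have hGu : F.cut q (emb (lin G.u)) = C (c 1) * X 0 - C (c 0) * X 1 := by
      rw [cut_emb]
      have h1 : lin G.u = C (-c 0) * lin F.v + C (c 1) * lin F.u := by
        simp only [lin, hG, rot, Finset.mul_sum, ← Finset.sum_add_distrib, C_add, C_mul]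
        exact Finset.sum_congr rfl fun i _ => by ring
      rw [h1, map_add, map_mul, map_mul, res_u, res_v, algHom_C, algHom_C, algebraMap_eq, C_neg]
      ring
    obtain ⟨j, hj⟩ := G.exists_pt_ne_zero q
    have hv : G.pt q ≠ 0 := fun h => hj (congrFun h _)
    obtain ⟨hfin1, hsum1⟩ := finsum_mult_pointIdeal hv hj
    obtain ⟨hfin2, hsum2⟩ := ih R hR h0R (emb (F.ext R)) (by rw [cut_emb, res_ext])
    have hpt : pointIdeal (G.pt q) = F.curveIdeal q ⊔ Ideal.span {emb (lin G.u)} :=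
      G.pointIdeal_pt hq
    have hadd : ∀ x : WP K, mult (F.curveIdeal q ⊔ Ideal.span {A}) (pointIdeal x.rep) =
        mult (pointIdeal (G.pt q)) (pointIdeal x.rep) +
          mult (F.curveIdeal q ⊔ Ideal.span {emb (F.ext R)}) (pointIdeal x.rep) := fun x => by
      rw [F.curveIdeal_sup_span_congr (B := emb (lin G.u) * emb (F.ext R)) (by
        rw [hA, map_mul, hGu, cut_emb, res_ext]), hpt]
      refine mult_sup_mul (fun y hy => ?_) _
      rw [mem_curveIdeal, map_mul, hGu] at hy
      exact F.mem_curveIdeal.mpr ((mul_eq_zero.mp hy).resolve_left h0m)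
    simp only [hadd]
    refine ⟨(hfin1.union hfin2).subset (Function.support_add _ _), ?_⟩
    rw [finsum_add_distrib hfin1 hfin2, hsum1, hsum2, Nat.cast_succ, add_comm]

theorem anticanonicalDegree_curveIdeal (hq : q.IsHomogeneous 2) :
    AnticanonicalDegree (F.curveIdeal q) 1 := fun m hm hmI =>
  (F.finsum_mult_curveIdeal hq 1 _ (F.isWeightedHomogeneous_cut hq hm)
    (fun h => hmI (F.mem_curveIdeal.mpr h)) m rfl).2

variable {f g : MvPolynomial (Fin 3) K} {F}

theorem selfIntersection_curveIdeal (hf : f.IsHomogeneous 2) (hq : q.IsHomogeneous 2)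
    (h0 : F.res (q ^ 2 + f * q - g) = 0) (hne : F.res (f + 2 * q) ≠ 0) :
    SelfIntersection (surfacePoly f g) (F.curveIdeal q) (-1) := by
  have hfib : F.fibre f g ≤ F.curveIdeal q := by
    rw [fibre, Ideal.span_le]
    rintro A (rfl | rfl)
    · exact F.mem_curveIdeal.mpr (by rw [cut_surfacePoly, h0])
    · exact Ideal.subset_span (by simp)
  have hcolon : (Ideal.span {surfacePoly f g, emb (lin F.l)}).colon
      (F.curveIdeal q : Set (MvPolynomial (Fin 4) K)) = F.curveIdeal (-f - q) := by
    ext A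
    rw [Submodule.mem_colon, ← mul_mem_fibre_iff h0 hne]
    constructor
    · intro h
      exact h _ (Ideal.subset_span (by simp))
    · intro h B hB
      obtain ⟨x, y, rfl⟩ := Ideal.mem_span_pair.mp hB
      have h1 : A • (x * emb (lin F.l) + y * (X 3 - emb q)) =
          A * x * emb (lin F.l) + y * (A * (X 3 - emb q)) := by
        rw [smul_eq_mul]; ring
      rw [h1]
      exact Ideal.add_mem _ (Ideal.mul_mem_left _ _ (F.l_mem_fibre f g))
        (Ideal.mul_mem_left _ _ h)
  have hcut : F.cut q (X 3 - emb (-f - q)) = F.res (f + 2 * q) := by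
    rw [map_sub, cut_X, cut_emb, ← map_sub]
    congr 1
    ring
  have hhom : (f + 2 * q).IsHomogeneous 2 := by
    have := hq.C_mul 2
    rw [map_ofNat] at this
    exact hf.add this
  refine ⟨1, emb (lin F.l), 1, 2, isWeightedHomogeneous_emb (isHomogeneous_lin _),
    Ideal.subset_span (by simp), ?_, F.anticanonicalDegree_curveIdeal hq, ?_, by norm_num⟩
  · rw [hcolon]
    intro hle
    have h1 : X 3 - emb (-f - q) ∈ F.curveIdeal (-f - q) := Ideal.subset_span (by simp)
    exact hne (hcut.symm.trans (F.mem_curveIdeal.mp (hle h1)))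
  · have hsup : F.curveIdeal q ⊔ F.curveIdeal (-f - q) =
        F.curveIdeal q ⊔ Ideal.span {X 3 - emb (-f - q)} := by
      refine le_antisymm (sup_le le_sup_left ?_) (sup_le_sup_left ?_ _)
      · rw [curveIdeal, curveIdeal, Ideal.span_le]
        rintro A (rfl | rfl)
        · exact Ideal.mem_sup_left (Ideal.subset_span (by simp))
        · exact Ideal.mem_sup_right (Ideal.mem_span_singleton_self _)
      · rw [Ideal.span_singleton_le_iff_mem]
        exact Ideal.subset_span (by simp)
    rw [hcolon, hsup]
    exact (F.finsum_mult_curveIdeal hq 2 _ (F.isHomogeneous_res hhom) hne _ hcut).2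

end Frame

end ExceptionalCurves

section ExceptionalCurvesThroughPoint

/-- The dimension drops on dividing a domain by a nonzero element; stated for the preimage of the
principal ideal under a surjection. -/
theorem ringKrullDim_quotient_ker_succ_le {A B : Type*} [CommRing A] [CommRing B] [IsDomain B]
    (φ : A →+* B) (hφ : Function.Surjective φ) {b : B} (hb : b ≠ 0) :
    ringKrullDim (A ⧸ (Ideal.span {b}).comap φ) + 1 ≤ ringKrullDim B := by
  have hs : Function.Surjective ((Ideal.Quotient.mk (Ideal.span {b})).comp φ) :=
    Ideal.Quotient.mk_surjective.comp hφ
  have hker : (Ideal.span {b}).comap φ =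
      RingHom.ker ((Ideal.Quotient.mk (Ideal.span {b})).comp φ) := by
    rw [← RingHom.comap_ker, Ideal.mk_ker]
  rw [hker, ringKrullDim_eq_of_ringEquiv (RingHom.quotientKerEquivOfSurjective hs)]
  exact ringKrullDim_quotient_succ_le_of_nonZeroDivisor (mem_nonZeroDivisors_of_ne_zero hb)

variable {K : Type*} [Field K]

/-- A curve of degree one is contained in every plane that contains two of its points. -/
theorem AnticanonicalDegree.mem_of_mem {I : Ideal (MvPolynomial (Fin 4) K)}
    (h : AnticanonicalDegree I 1) {x y : WP K} (hxy : x ≠ y) (hx : I ≤ pointIdeal x.rep)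
    (hy : I ≤ pointIdeal y.rep) {m : MvPolynomial (Fin 4) K} (hm : IsWeightedHomogeneous wt m 1)
    (hmx : m ∈ pointIdeal x.rep) (hmy : m ∈ pointIdeal y.rep) : m ∈ I := by
  classical
  by_contra hmI
  have h1 := h m hm hmI
  have hle : ∀ z : WP K, I ≤ pointIdeal z.rep → m ∈ pointIdeal z.rep →
      1 ≤ mult (I ⊔ Ideal.span {m}) (pointIdeal z.rep) := fun z hz hmz =>
    one_le_mult (sup_le hz ((Ideal.span_singleton_le_iff_mem _).mpr hmz))
  by_cases hfin : (Function.support fun z : WP K =>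
      mult (I ⊔ Ideal.span {m}) (pointIdeal z.rep)).Finite
  · rw [finsum_eq_sum _ hfin] at h1
    have h2 : ∑ z ∈ ({x, y} : Finset (WP K)), mult (I ⊔ Ideal.span {m}) (pointIdeal z.rep) ≤
        ∑ z ∈ hfin.toFinset, mult (I ⊔ Ideal.span {m}) (pointIdeal z.rep) := by
      refine Finset.sum_le_sum_of_subset fun z hz => ?_
      rw [Set.Finite.mem_toFinset, Function.mem_support, ← pos_iff_ne_zero,
        ← Order.one_le_iff_pos]
      rcases Finset.mem_insert.mp hz with rfl | hz
      · exact hle z hx hmx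
      · exact Finset.mem_singleton.mp hz ▸ hle y hy hmy
    rw [Finset.sum_pair hxy, h1] at h2
    have h3 := (add_le_add (hle x hx hmx) (hle y hy hmy)).trans h2
    norm_num at h3
  · rw [finsum_of_infinite_support hfin] at h1
    simp at h1

namespace Frame

variable {F : Frame K} {f g q : MvPolynomial (Fin 3) K}

/-- A prime ideal that contains the ideal of the integral curve above a line properly is not the
ideal of a curve. -/
theorem eq_fibre_of_le {I : Ideal (MvPolynomial (Fin 4) K)} (hfib : (F.fibre f g).IsPrime)
    (hle : F.fibre f g ≤ I) (hdim : ringKrullDim (MvPolynomial (Fin 4) K ⧸ I) = 2) :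
    I = F.fibre f g := by
  refine le_antisymm (fun r hr => ?_) hle
  by_contra hrG
  have h1 : ringKrullDim (MvPolynomial (Fin 4) K ⧸ F.fibre f g) + 1 ≤ 3 := by
    have hker : F.fibre f g = (Ideal.span {F.fibrePoly f g}).comap F.toPoly.toRingHom := by
      ext A
      rw [mem_fibre, Ideal.mem_comap, Ideal.mem_span_singleton]
      rfl
    rw [hker]
    refine (ringKrullDim_quotient_ker_succ_le _ F.toPoly_surjective
      (F.monic_fibrePoly f g).ne_zero).trans ?_
    rw [Polynomial.ringKrullDim_of_isNoetherianRing, MvPolynomial.ringKrullDim_of_isNoetherianRing,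
      ringKrullDim_eq_zero_of_field]
    norm_num
  have h2 : ringKrullDim (MvPolynomial (Fin 4) K ⧸ I) + 1 ≤
      ringKrullDim (MvPolynomial (Fin 4) K ⧸ F.fibre f g) := by
    refine ringKrullDim_succ_le_of_surjective (Ideal.Quotient.factor hle)
      (Ideal.Quotient.factor_surjective hle) (r := Ideal.Quotient.mk _ r)
      (mem_nonZeroDivisors_of_ne_zero fun h => hrG (Ideal.Quotient.eq_zero_iff_mem.mp h)) ?_
    rw [Ideal.Quotient.factor_mk]
    exact Ideal.Quotient.eq_zero_iff_mem.mpr hr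
  rw [hdim] at h2
  have h3 := (add_le_add_left h2 1).trans h1
  norm_num at h3

/-- A curve of degree one above a line through the point of contact lies on the osculating
section. -/
theorem Osculates.X_sub_mem (h : F.Osculates f g q) {I : Ideal (MvPolynomial (Fin 4) K)}
    [hI : I.IsPrime] (hF : surfacePoly f g ∈ I)
    (hdim : ringKrullDim (MvPolynomial (Fin 4) K ⧸ I) = 2) (hdeg : AnticanonicalDegree I 1)
    (hl : emb (lin F.l) ∈ I) (hP : I ≤ pointIdeal (F.pt q)) : X 3 - emb q ∈ I := by
  have hmemI : ∀ A : MvPolynomial (Fin 3) K, emb A - emb (F.ext (F.res A)) ∈ I := fun A => by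
    obtain ⟨z, hz⟩ := Ideal.mem_span_singleton.mp (F.sub_ext_res_mem A)
    rw [← map_sub, hz, map_mul]
    exact Ideal.mul_mem_right _ _ hl
  have hle : F.fibre f g ≤ I := by
    rw [fibre, Ideal.span_le]
    rintro A (rfl | rfl)
    exacts [hF, hl]
  have hmem : emb (q ^ 2 + f * q - g) ∈ I := by
    by_cases h0 : F.res (q ^ 2 + f * q - g) = 0
    · have := hmemI (q ^ 2 + f * q - g)
      rwa [h0, map_zero, map_zero, sub_zero] at this
    -- the curve above the line would be integral, of degree two
    exfalso
    have hIG := eq_fibre_of_le (h.fibre_isPrime h0) hle hdim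
    have hrep : ∀ {v : Fin 4 → K} (hv : v ≠ 0), pointIdeal (WP.mk v hv).rep = pointIdeal v :=
      fun {v} hv => by
        obtain ⟨c, hc, h1⟩ := WP.exists_rep_mk hv
        rw [funext h1, pointIdeal_smul hc]
    have hne : ∀ q' : MvPolynomial (Fin 3) K, F.pt q' ≠ 0 := fun q' h1 => by
      obtain ⟨j, hj⟩ := F.exists_pt_ne_zero q'
      exact hj (congrFun h1 _)
    have hqι : (-f - q).IsHomogeneous 2 := h.hf.neg.sub h.hq
    have hu : emb (lin F.u) ∈ I := by
      refine hdeg.mem_of_mem (x := WP.mk _ (hne q)) (y := WP.mk _ (hne (-f - q))) ?_ ?_ ?_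
        (isWeightedHomogeneous_emb (isHomogeneous_lin _)) ?_ ?_
      · intro heq
        refine h.pointIdeal_conj_ne ?_
        rw [← hrep (hne q), ← hrep (hne (-f - q)), heq]
      · rwa [hrep]
      · rw [hrep, hIG]
        refine F.fibre_le_pointIdeal_pt hqι ?_
        have h1 : (-f - q) ^ 2 + f * (-f - q) - g = q ^ 2 + f * q - g := by ring
        rw [h1]
        exact (dvd_pow_self _ three_ne_zero).trans h.dvd
      · rw [hrep, F.mem_pointIdeal_pt h.hq, cut_emb, res_u]
      · rw [hrep, F.mem_pointIdeal_pt hqι, cut_emb, res_u]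
    rw [hIG] at hu
    exact emb_notMem_fibre (by rw [res_u]; exact X_ne_zero _) hu
  have hprod : (X 3 - emb q) * (X 3 + emb f + emb q) ∈ I := by
    have h1 := Ideal.sub_mem _ hF hmem
    rwa [surfacePoly_eq f g q, add_sub_cancel_right] at h1
  refine (hI.mem_or_mem hprod).resolve_right fun h1 => h.ne ?_
  have h2 := eval_eq_zero_of_mem_pointIdeal (hP h1)
  rw [map_add, map_add, eval_pt_emb, eval_pt_emb, eval_X, pt_three] at h2
  rw [map_add, map_mul, map_ofNat]
  linear_combination h2

end Frame

end ExceptionalCurvesThroughPoint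

/-! ### The intersection of the surface with the osculating section -/

section Intersection

variable {k K : Type*} [Field k] [Field K] [Algebra k K]
variable {f g : MvPolynomial (Fin 3) k}

theorem exists_dotProduct_eq_zero (a b : Fin 3 → K) :
    ∃ l : Fin 3 → K, l ≠ 0 ∧ ∑ i, l i * a i = 0 ∧ ∑ i, l i * b i = 0 := by
  have h := LinearMap.ker_ne_bot_of_finrank_lt (f := Matrix.mulVecLin (Matrix.of ![a, b]))
    (by simp)
  obtain ⟨l, hl, hl0⟩ := (Submodule.ne_bot_iff _).mp h
  rw [LinearMap.mem_ker, Matrix.mulVecLin_apply] at hl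
  refine ⟨l, hl0, ?_, ?_⟩
  · simpa [Matrix.mulVec, dotProduct, mul_comm] using congrFun hl 0
  · simpa [Matrix.mulVec, dotProduct, mul_comm] using congrFun hl 1

theorem exists_line (Q S : ℙ K (Fin 3 → K)) : ∃ L, Q ∈ line L ∧ S ∈ line L := by
  obtain ⟨l, hl0, hlQ, hlS⟩ := exists_dotProduct_eq_zero Q.rep S.rep
  have hline : ∀ x : ℙ K (Fin 3 → K), ∑ i, l i * x.rep i = 0 →
      x ∈ line (Projectivization.mk K l hl0) := fun x hx => by
    have h1 := (Projectivization.orthogonal_mk (F := K) hl0 x.rep_nonzero).mpr hx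
    rwa [x.mk_rep] at h1
  exact ⟨_, hline Q hlQ, hline S hlS⟩

theorem bl_surjective {Q : ℙ K (Fin 3 → K)} : Function.Surjective (bl (Q := Q)) := fun S =>
  let ⟨L, hQ, hS⟩ := exists_line Q S
  ⟨⟨(S, ⟨L, hQ⟩), hS⟩, rfl⟩

/-- If the osculating section and the surface coincide above a line, the curve in which they meet
there is exceptional. -/
theorem Frame.Osculates.isExceptionalCurve [IsAlgClosed K] {F : Frame K}
    {q : MvPolynomial (Fin 3) K}
    (h : F.Osculates (MvPolynomial.map (algebraMap k K) f) (MvPolynomial.map (algebraMap k K) g) q)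
    (h0 : F.res (q ^ 2 + MvPolynomial.map (algebraMap k K) f * q -
      MvPolynomial.map (algebraMap k K) g) = 0) :
    IsExceptionalCurve f g (F.curveIdeal q) where
  prime := inferInstance
  homogeneous := F.isHomogeneousIdeal_curveIdeal h.hq
  le_surface := by rw [map_surfacePoly, Frame.mem_curveIdeal, Frame.cut_surfacePoly, h0]
  dim := F.ringKrullDim_curveIdeal q
  degree := F.anticanonicalDegree_curveIdeal h.hq
  selfIntersection := by
    rw [map_surfacePoly]
    refine Frame.selfIntersection_curveIdeal h.hf h.hq h0 fun h1 => h.ne ?_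
    rw [← F.vec_zero_one, ← F.eval_res, h1, map_zero]

namespace Osculation

variable (O : Osculation f g)

theorem xi_mem_zeroLocus_curveIdeal {F : Frame K} {S : ℙ K (Fin 3 → K)}
    (hS : ∑ i, F.l i * S.rep i = 0) :
    (O.xi K S).1 ∈ zeroLocus
      (F.curveIdeal (MvPolynomial.map (algebraMap k K) O.q) : Set (MvPolynomial (Fin 4) K)) := by
  have hq : (MvPolynomial.map (algebraMap k K) O.q).IsHomogeneous 2 :=
    isWeightedHomogeneous_map _ O.hq
  refine (mem_zeroLocus_iff (F.isHomogeneousIdeal_curveIdeal hq) _).mpr ?_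
  rw [Frame.curveIdeal, Ideal.span_le]
  rintro A (rfl | rfl)
  · refine (mem_pointIdeal_of_isWeightedHomogeneous
      (isWeightedHomogeneous_emb (isHomogeneous_lin _))).mpr ?_
    rw [← aeval_eq_eval, aeval_cvec_emb, aeval_lin]
    exact hS
  · refine (mem_pointIdeal_of_isWeightedHomogeneous ((isWeightedHomogeneous_X K wt 3).sub
      (isWeightedHomogeneous_emb hq))).mpr ?_
    rw [← aeval_eq_eval, map_sub, aeval_cvec_emb, aeval_X, cvec_three, sub_eq_zero,
      aeval_map_algebraMap]

theorem xi_mem_surface {S : ℙ K (Fin 3 → K)} :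
    (O.xi K S).1 ∈ surface K f g ↔ aeval S.rep (O.q ^ 2 + f * O.q - g) = 0 := by
  rw [xi, upt_mem_surface O.hf O.hg]
  simp only [map_sub, map_add, map_mul, map_pow]

variable [IsAlgClosed K]

/-- The osculating section and the surface, on a line through the point of contact. -/
theorem res_rep_eq (L : linesThrough (phi (O.point K))) {γ δ : K}
    (h : γ * (∑ i, L.1.rep i * algebraMap k K (O.T.s i)) +
      δ * (∑ i, L.1.rep i * algebraMap k K (O.T.p i)) = 1) :
    ((O.T.map (algebraMap k K)).ofPencil _ _ γ δ h).res
      (MvPolynomial.map (algebraMap k K) O.q ^ 2 + MvPolynomial.map (algebraMap k K) f *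
        MvPolynomial.map (algebraMap k K) O.q - MvPolynomial.map (algebraMap k K) g) =
      X 0 ^ 3 * (C (aeval L.1.rep (O.dir O.P₃)) * X 1 + C (aeval L.1.rep (O.dir O.P₄)) * X 0) := by
  rw [O.res_eq (algebraMap k K) h, O.aeval_dir, O.aeval_dir, MvPolynomial.eval_map,
    MvPolynomial.eval_map, ← aeval_def, ← aeval_def]

theorem exists_isExceptionalCurve {L : linesThrough (phi (O.point K))}
    (h₃ : aeval L.1.rep (O.dir O.P₃) = 0) (h₄ : aeval L.1.rep (O.dir O.P₄) = 0) :
    ∃ I : Ideal (MvPolynomial (Fin 4) K), IsExceptionalCurve f g I ∧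
      ∀ S ∈ line L.1, (O.xi K S).1 ∈ zeroLocus (I : Set (MvPolynomial (Fin 4) K)) := by
  obtain ⟨γ, δ, h, hl⟩ := O.exists_frame L
  have h0 := O.res_rep_eq L h
  rw [h₃, h₄, map_zero, zero_mul, zero_mul, add_zero, mul_zero] at h0
  refine ⟨_, (O.osculates (algebraMap k K) h).isExceptionalCurve h0, fun S hS =>
    O.xi_mem_zeroLocus_curveIdeal ?_⟩
  rw [hl]
  exact dotProduct_rep_eq_zero hS

/-- A binary form of positive degree vanishes in the direction of some line. -/
theorem exists_aeval_dir_eq_zero {A : MvPolynomial (Fin 2) k} {n : ℕ} (hA : A.IsHomogeneous n)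
    (hn : n ≠ 0) : ∃ L : linesThrough (phi (O.point K)), aeval L.1.rep (O.dir A) = 0 := by
  obtain ⟨c, hc, hcA⟩ := exists_zero_of_binary_form (K := K) hA hn
  set T := O.T.map (algebraMap k K) with hT
  let l : Fin 3 → K := fun i => T.v i * c 0 - T.u i * c 1
  have hdot : ∀ x : Fin 3 → K,
      ∑ i, l i * x i = (∑ i, T.v i * x i) * c 0 - (∑ i, T.u i * x i) * c 1 := fun x => by
    simp only [l, Finset.sum_mul, ← Finset.sum_sub_distrib]
    exact Finset.sum_congr rfl fun i _ => by ring
  have hp : ∑ i, l i * T.p i = c 0 := by rw [hdot, T.v_p, T.u_p]; ring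
  have hs : ∑ i, l i * T.s i = -c 1 := by rw [hdot, T.v_s, T.u_s]; ring
  have hm : ∑ i, l i * T.m i = 0 := by rw [hdot, T.v_m, T.u_m]; ring
  have hl0 : l ≠ 0 := by
    intro h0
    refine hc (funext fun j => ?_)
    simp only [h0, Pi.zero_apply, zero_mul, Finset.sum_const_zero] at hp hs
    fin_cases j
    · exact hp.symm
    · exact neg_eq_zero.mp hs.symm
  obtain ⟨t, ht⟩ := Projectivization.exists_smul_eq_mk_rep K l hl0
  have hL : phi (O.point K) ∈ line (Projectivization.mk K l hl0) := by
    rw [phi_point, mk_mem_line, ← ht]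
    change ∑ i, ((t : K) * l i) * T.m i = 0
    simp only [mul_assoc, ← Finset.mul_sum, hm, mul_zero]
  refine ⟨⟨Projectivization.mk K l hl0, hL⟩, ?_⟩
  change aeval (Projectivization.mk K l hl0).rep (O.dir A) = 0
  have h1 : (Projectivization.mk K l hl0).rep = fun i => (t : K) * l i := by
    rw [← ht]; rfl
  have h2 : ![∑ i, l i * T.p i, -∑ i, l i * T.s i] = c := by
    rw [hp, hs, neg_neg]
    funext j
    fin_cases j <;> rfl
  rw [h1, (O.isHomogeneous_dir hA).aeval_smul', O.aeval_dir]
  change _ * aeval ![∑ i, l i * T.p i, -∑ i, l i * T.s i] A = 0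
  rw [h2, hcA, mul_zero]

namespace Residual

variable {O} (R : O.Residual K)

theorem xi_phi_rho (L : linesThrough (phi (O.point K))) : O.xi K (phi (R.rho L)) = R.rho L := by
  rw [rho, phi_upt, xi_mk]

theorem exists_isExceptionalCurve {L : linesThrough (phi (O.point K))}
    (h : aeval L.1.rep (O.dir R.D) = 0) :
    ∃ I : Ideal (MvPolynomial (Fin 4) K), IsExceptionalCurve f g I ∧
      ∀ S ∈ line L.1, (O.xi K S).1 ∈ zeroLocus (I : Set (MvPolynomial (Fin 4) K)) := by
  refine O.exists_isExceptionalCurve (L := L) ?_ ?_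
  · rw [R.eq₃, map_mul, map_mul, h, zero_mul]
  · rw [R.eq₄, map_mul, map_mul, h, zero_mul]

/-- The point of contact is a residual point, or it lies on an exceptional curve: either the common
divisor `D` has a zero, or `A` is a cubic form and has a zero. -/
theorem point_mem : (∃ L, R.rho L = O.point K) ∨
    ∃ I : Ideal (MvPolynomial (Fin 4) K), IsExceptionalCurve f g I ∧
      (O.point K).1 ∈ zeroLocus (I : Set (MvPolynomial (Fin 4) K)) := by
  by_cases hd : R.d = 0
  · left
    obtain ⟨L, hL⟩ := O.exists_aeval_dir_eq_zero (K := K) R.hA (by omega)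
    refine ⟨L, ?_⟩
    obtain ⟨γ, δ, h, -⟩ := O.exists_frame L
    rw [← xi_phi_rho, ← O.xi_phi_point]
    congr 1
    refine (phi_upt _ _).trans (Eq.trans ?_ O.phi_point.symm)
    rw [Projectivization.mk_eq_mk_iff']
    refine ⟨-aeval L.1.rep (O.dir R.B), ?_⟩
    rw [R.aeval_coord _ h, hL]
    funext i
    simp [Frame.vec, Frame.ofPencil, Frame.map, mul_comm]
  · right
    obtain ⟨L, hL⟩ := O.exists_aeval_dir_eq_zero (K := K) R.hD hd
    obtain ⟨I, hI, hIS⟩ := R.exists_isExceptionalCurve hL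
    refine ⟨I, hI, ?_⟩
    rw [← O.xi_phi_point]
    exact hIS _ L.2

/-- On a line through the point of contact, the surface meets the osculating section outside of the
point of contact in the residual point only, unless `D` vanishes in the direction of the line. -/
theorem xi_eq_rho {L : linesThrough (phi (O.point K))} {S : ℙ K (Fin 3 → K)} (hS : S ∈ line L.1)
    (hne : S ≠ phi (O.point K)) (hX : (O.xi K S).1 ∈ surface K f g)
    (hD : aeval L.1.rep (O.dir R.D) ≠ 0) : O.xi K S = R.rho L := by
  obtain ⟨γ, δ, h, hl⟩ := O.exists_frame L
  have h0 := O.res_rep_eq L h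
  have hAB := R.dir_ne_zero h
  set F := (O.T.map (algebraMap k K)).ofPencil _ _ γ δ h with hF
  obtain ⟨c, hc⟩ : ∃ c, S.rep = F.vec c := ⟨_, F.exists_eq_vec (by
    rw [hl]; exact dotProduct_rep_eq_zero hS)⟩
  have hc0 : c 0 ≠ 0 := by
    intro hc0
    apply hne
    rw [phi_point, ← S.mk_rep, Projectivization.mk_eq_mk_iff']
    refine ⟨c 1, ?_⟩
    rw [hc]
    funext i
    simp [Frame.vec, hF, Frame.ofPencil, Frame.map, hc0, mul_comm]
  have h1 := congrArg (eval c) h0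
  rw [Frame.eval_res, ← hc, ← aeval_eq_eval] at h1
  change aeval _ _ = _ at h1
  have h2 : MvPolynomial.map (algebraMap k K) O.q ^ 2 + MvPolynomial.map (algebraMap k K) f *
        MvPolynomial.map (algebraMap k K) O.q - MvPolynomial.map (algebraMap k K) g =
      MvPolynomial.map (algebraMap k K) (O.q ^ 2 + f * O.q - g) := by
    simp only [map_sub, map_add, map_mul, map_pow]
  rw [h2, aeval_map_algebraMap, O.xi_mem_surface.mp hX, R.eq₃, R.eq₄] at h1
  simp only [map_mul, map_add, map_pow, eval_X, eval_C] at h1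
  set A := aeval L.1.rep (O.dir R.A)
  set B := aeval L.1.rep (O.dir R.B)
  have h3 : A * c 1 + B * c 0 = 0 := by
    refine mul_left_cancel₀ (mul_ne_zero (pow_ne_zero 3 hc0) hD) ?_
    linear_combination -h1
  have hA : A ≠ 0 := by
    intro hA
    rw [hA, zero_mul, zero_add] at h3
    have hB := (mul_eq_zero.mp h3).resolve_right hc0
    apply hAB
    rw [hA, hB]
    simp
  rw [← R.xi_phi_rho]
  congr 1
  rw [rho, phi_upt, ← S.mk_rep, Projectivization.mk_eq_mk_iff']
  refine ⟨c 0 / A, ?_⟩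
  rw [R.aeval_coord _ h, hc, ← hF]
  funext i
  simp only [Frame.vec, Pi.smul_apply, smul_eq_mul, Matrix.cons_val_zero, Matrix.cons_val_one]
  field_simp
  linear_combination -F.p i * h3

theorem xi_mem {S : ℙ K (Fin 3 → K)} (hX : (O.xi K S).1 ∈ surface K f g) :
    (∃ L, R.rho L = O.xi K S) ∨
    ∃ I : Ideal (MvPolynomial (Fin 4) K), IsExceptionalCurve f g I ∧
      (O.point K).1 ∈ zeroLocus (I : Set (MvPolynomial (Fin 4) K)) ∧
      (O.xi K S).1 ∈ zeroLocus (I : Set (MvPolynomial (Fin 4) K)) := by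
  by_cases hS : S = phi (O.point K)
  · rw [hS, O.xi_phi_point]
    simpa only [and_self] using R.point_mem
  obtain ⟨L, hL, hSL⟩ := exists_line (phi (O.point K)) S
  by_cases hD : aeval L.rep (O.dir R.D) = 0
  · right
    obtain ⟨I, hI, hIS⟩ := R.exists_isExceptionalCurve (L := ⟨_, hL⟩) hD
    refine ⟨I, hI, ?_, hIS S hSL⟩
    rw [← O.xi_phi_point]
    exact hIS _ hL
  · exact Or.inl ⟨⟨_, hL⟩, (R.xi_eq_rho (L := ⟨_, hL⟩) hSL hS hX hD).symm⟩

end Residual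

/-- The exceptional curves through the point of contact lie on the osculating section. -/
theorem mem_range_xi {I : Ideal (MvPolynomial (Fin 4) K)} (hI : IsExceptionalCurve f g I)
    (hP : (O.point K).1 ∈ zeroLocus (I : Set (MvPolynomial (Fin 4) K))) {x : WP K}
    (hx : x ∈ zeroLocus (I : Set (MvPolynomial (Fin 4) K))) :
    x ∈ Set.range fun S => (O.xi K S).1 := by
  by_cases hxP : x = (O.point K).1
  · exact ⟨phi (O.point K), hxP ▸ congrArg Subtype.val O.xi_phi_point⟩
  obtain ⟨l, hl0, hl, hlx⟩ := exists_dotProduct_eq_zero (fun i => algebraMap k K (O.T.m i))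
    (fun i : Fin 3 => x.rep i.castSucc)
  obtain ⟨γ, δ, h, hFl⟩ := (O.T.map (algebraMap k K)).exists_ofPencil hl0 hl
  have hosc := O.osculates (algebraMap k K) h
  set F := (O.T.map (algebraMap k K)).ofPencil _ _ γ δ h with hF
  set q := MvPolynomial.map (algebraMap k K) O.q with hq
  have hlin : IsWeightedHomogeneous wt (emb (lin F.l)) 1 :=
    isWeightedHomogeneous_emb (isHomogeneous_lin _)
  have hpt : ∃ hv : F.pt q ≠ 0, (O.point K).1 = WP.mk (F.pt q) hv := by
    have h1 : cvec (fun i => algebraMap k K (O.T.m i)) (algebraMap k K (eval O.T.m O.q)) =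
        F.pt q := by
      rw [Frame.pt, ← Osculation.eval_map_comp]
      rfl
    exact ⟨h1 ▸ cvec_ne_zero (O.map_m_ne_zero K) _, by simp only [← h1]; rfl⟩
  obtain ⟨hv, hpt⟩ := hpt
  have hIP : I ≤ pointIdeal (F.pt q) := by
    rw [hpt, mem_zeroLocus_iff hI.homogeneous] at hP
    exact hP
  have hIx : I ≤ pointIdeal x.rep := by
    rw [← x.mk_rep, mem_zeroLocus_iff hI.homogeneous x.rep_ne_zero] at hx
    exact hx
  have hIP' : I ≤ pointIdeal (O.point K).1.rep := by
    rw [← (O.point K).1.mk_rep, mem_zeroLocus_iff hI.homogeneous (O.point K).1.rep_ne_zero] at hP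
    exact hP
  have hlI : emb (lin F.l) ∈ I := by
    refine hI.degree.mem_of_mem hxP hIx hIP' hlin ?_ ?_
    · rw [mem_pointIdeal_of_isWeightedHomogeneous hlin, hFl, ← cvec_eta x.rep, ← aeval_eq_eval]
      rw [aeval_cvec_emb, aeval_lin]
      exact hlx
    · rw [mem_pointIdeal_of_isWeightedHomogeneous hlin, hpt, ← aeval_eq_eval]
      rw [aeval_rep_eq_zero_iff hlin, aeval_eq_eval]
      exact (F.eval_pt_emb _ _).trans ((eval_lin _ _).trans F.l_p)
  have := hI.prime
  have hmem := hosc.X_sub_mem (map_surfacePoly (algebraMap k K) f g ▸ hI.le_surface) hI.dim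
    hI.degree hlI hIP
  rw [range_xi]
  rintro A rfl
  rw [map_sub, map_X, map_rename]
  exact eval_eq_zero_of_mem_pointIdeal (hIx hmem)

/-- The intersection of the surface with the osculating section. A point of it other than the point
of contact spans a line together with the point of contact; on this line the equation is `D` times
the equation of the residual point. -/
theorem surface_inter_range_xi (R : O.Residual K) :
    surface K f g ∩ (Set.range fun S => (O.xi K S).1) =
      (Set.range fun L => (R.rho L).1) ∪
        {x | ∃ I : Ideal (MvPolynomial (Fin 4) K), IsExceptionalCurve f g I ∧
          (O.point K).1 ∈ zeroLocus (I : Set (MvPolynomial (Fin 4) K)) ∧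
          x ∈ zeroLocus (I : Set (MvPolynomial (Fin 4) K))} := by
  ext x
  constructor
  · rintro ⟨hX, S, rfl⟩
    rcases R.xi_mem hX with ⟨L, hL⟩ | h
    · exact Or.inl ⟨L, congrArg Subtype.val hL⟩
    · exact Or.inr h
  · rintro (⟨L, rfl⟩ | ⟨I, hI, hP, hx⟩)
    · exact ⟨R.isSection_rho.mem_surface L, phi (R.rho L), congrArg Subtype.val (R.xi_phi_rho L)⟩
    · refine ⟨?_, O.mem_range_xi hI hP hx⟩
      have h1 := hx _ hI.le_surface
      rwa [MvPolynomial.eval_map, ← aeval_def] at h1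

end Osculation

end Intersection

end

end DelPezzoTwo

open DelPezzoTwo in
theorem proposition4p9 {k K : Type*} [Field k] [Field K] [Algebra k K] [IsAlgClosed K]
    (f g : MvPolynomial (Fin 3) k) (hf : f.IsHomogeneous 2) (hg : g.IsHomogeneous 4)
    (hX : IsSmoothSurface K f g)
    -- a `k`-rational point `P` of `X` that does not lie on the ramification locus
    (P : U K)
    (hPk : ∃ (p : Fin 4 → k) (hp : (fun i => algebraMap k K (p i)) ≠ 0),
      P.1 = WP.mk (fun i => algebraMap k K (p i)) hp)
    (hPX : P.1 ∈ surface K f g) (hPR : phi P ∉ branch K f g) :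
    -- the maps `τ_L` and `ρ` are well defined
    (∀ L : linesThrough (phi P), ∃! τ : line L.1 → U K, IsTau f g P L τ) ∧
    (∃! ρ : linesThrough (phi P) → U K, IsRho f g P ρ) ∧
    ∀ (τ : (L : linesThrough (phi P)) → line L.1 → U K) (ρ : linesThrough (phi P) → U K),
      (∀ L, IsTau f g P L (τ L)) → IsRho f g P ρ →
      ∃ ξ : ℙ K (Fin 3 → K) → U K,
        -- `ν` factors through the morphism `ξ`, and only through `ξ`
        IsMorphism k (fun S : (Set.univ : Set (ℙ K (Fin 3 → K))) => ξ S.1) ∧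
        nu τ = ξ ∘ bl ∧
        (∀ ξ' : ℙ K (Fin 3 → K) → U K,
          IsMorphism k (fun S : (Set.univ : Set (ℙ K (Fin 3 → K))) => ξ' S.1) →
          nu τ = ξ' ∘ bl → ξ' = ξ) ∧
        -- the restriction of `ξ` to `L` is `τ_L`
        (∀ (L : linesThrough (phi P)) (S : line L.1), ξ S.1 = τ L S) ∧
        -- `ξ` is a section of `φ`
        (∀ S, phi (ξ S) = S) ∧ ξ (phi P) = P ∧
        -- the image is a surface of degree two
        IsSurfaceOfDegree k (Set.range fun S => (ξ S).1) 2 ∧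
        -- the intersection of the image with `X`
        surface K f g ∩ (Set.range fun S => (ξ S).1) =
          (Set.range fun L => (ρ L).1) ∪
            {x | ∃ I : Ideal (MvPolynomial (Fin 4) K), IsExceptionalCurve f g I ∧
              P.1 ∈ zeroLocus (I : Set (MvPolynomial (Fin 4) K)) ∧
              x ∈ zeroLocus (I : Set (MvPolynomial (Fin 4) K))} := by
  obtain ⟨O, rfl⟩ := exists_osculation hf hg hPk hPX hPR
  obtain ⟨R⟩ := O.nonempty_residual hX
  refine ⟨fun L => ⟨_, O.isTau_xi L, fun τ hτ => O.isTau_unique L hτ⟩,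
    ⟨R.rho, R.isRho, fun ρ hρ => R.eq_of_isRho hX hρ⟩, fun τ ρ hτ hρ => ?_⟩
  obtain rfl : ρ = R.rho := R.eq_of_isRho hX hρ
  obtain rfl : τ = fun L S => O.xi K S.1 := funext fun L => O.isTau_unique L (hτ L)
  exact ⟨O.xi K, O.isMorphism_xi Set.univ, rfl,
    fun ξ' _ h => bl_surjective.injective_comp_right h.symm, fun _ _ => rfl, O.phi_xi,
    O.xi_phi_point, O.isSurfaceOfDegree_range_xi, O.surface_inter_range_xi R⟩
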